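/- **Proposition 3.1.** Let $r\ge 1$, let $t$, $a=(a_1,\dots,a_r)$, $b=(b_1,\dots,b_{r-1})$, $q$ be independent variables, put $b_0=q$ and $K=\mathbb Q(t,a,b,q)$. For each of the variables $x\in\{t,a_i,b_j\}$ let $\sigma_x$ be the automorphism of $K$ with $x\mapsto qx$ that fixes the other variables, and let $\mathcal W$ be the $q$-Weyl algebra over $K$ generated by the $\sigma_x^{\pm1}$ (so $\sigma_x f=\sigma_x(f)\sigma_x$ for $f\in K$). Let $M$ be the cyclic left $\mathcal W$-module whose generator is subject to the relations $$\prod_{j=0}^{r-1}(1-q^{-1}b_j\sigma_t)-t\prod_{j=1}^{r}(1-a_j\sigma_t),\qquad \sigma_{a_i}^{-1}-q^{-1}a_i\sigma_t\sigma_{a_i}^{-1}-(1-q^{-1}a_i)\ (1\le i\le r),$$ $$1-q^{-1}b_j\sigma_t-(1-q^{-1}b_j)\sigma_{b_j}^{-1}\ (1\le j\le r-1).$$ Let $M^\wedge$ be $M$ with $\mathcal W$ acting through the involution $q\mapsto q^{-1}$, $\sigma_x\mapsto\sigma_x^{-1}$ (fixing $t,a,b$), and let $M^\vee=\mathrm{Hom}_K(M,K)$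 with $(\sigma_x\lambda)(m)=\sigma_x(\lambda(\sigma_x^{-1}m))$. Then $$M^\vee\cong M^\wedge\quad\text{as }\mathcal W\text{-modules}.$$ Let $e_k$ denote the elementary symmetric polynomials, let $b/q=(b_0/q,\dots,b_{r-1}/q)$, and let $A(t,a,b,q)\in GL_r(K)$ be the companion matrix of the first relation: its entries at $(i,i+1)$, $1\le i<r$, are $1$, its last row is $\left((-1)^{r-1+k}\frac{e_k(b/q)-t\,e_k(a)}{e_r(b/q)-t\,e_r(a)}\right)_{k=0,\dots,r-1}$, and its other entries are $0$. There exists $Q=Q(t,a,b,q)\in GL_r(K)$ such that $$Q(qt,a,b,q)\,A(qt,a,b,q^{-1})^{-1}=A(t,a,b,q)^{-T}\,Q(t,a,b,q)$$ and such that moreover, for all nonzero complex values of $a_i,b_j,q$ with $|q|\ne1$ for which none of the ratios $b_i/b_j$ ($0\le i\ne j\le r-1$) and $a_i/b_j$ ($1\le i\le r$, $0\le j\le r-1$; $b_0=q$) is an integer power of $q$, the following holds as an identity of meromorphic functions of $t\in\mathbb C^\times$, with $Q$ defined and $U(t,a,b,q)$ invertible for all $t\in\mathbb C^\times$ outside a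 discrete closed subset of $\mathbb C^\times$: $$U(t,a,b,q)^{-T}=Q(t,a,b,q)\,U(t,a,b,q^{-1})\,\mathrm{diag}(1,-1,\dots,-1).$$ Here $U(t,a,b,q)_{i,j}=f_{j}(q^{i}t,a,b,q)$ for $0\le i,j\le r-1$, where $$f_j(t,a,b,q)=B_j(a,b,q)\,\frac{\theta(q^{-1}b_jt;q)}{\theta(t;q)}\,\phi_j(t),\qquad B_0=1,$$ $$B_j(a,b,q)=\left(\prod_{i=1}^{r}\frac{(a_i;q)_\infty\,(qb_{i-1}/b_j;q)_\infty}{(qa_i/b_j;q)_\infty\,(b_{i-1};q)_\infty}\right)\frac{(q;q)_\infty^3}{\theta(q^{-1}b_j;q)}\quad(j>0),$$ and $\phi_j$ is the meromorphic continuation to $\mathbb C$, which exists, of the series $$\sum_{k\ge0}\ \prod_{i=1}^{r}\frac{(qa_i/b_j;q)_k}{(qb_{i-1}/b_j;q)_k}\,t^k ,$$ convergent near $t=0$ (the factor $i-1=j$ in the denominator is $(q;q)_k$). Further $\theta(t;q)=(qt;q)_\infty(t^{-1};q)_\infty(q;q)_\infty$ and $(x;q)_k=\prod_{i=0}^{k-1}(1-xq^i)$;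 $(x;q)_\infty=\prod_{i\ge0}(1-xq^i)$ for $|q|<1$, while for $|q|>1$ one sets $(x;q)_\infty=1/(q^{-1}x;q^{-1})_\infty$ for $x\ne q$ and $(q;q)_\infty=1/(q^{-1};q^{-1})_\infty$. In $U(t,a,b,q^{-1})$ every $q$ is replaced by $q^{-1}$, including $b_0=q$. -/

import Mathlib

open Filter Topology Matrix

noncomputable section

namespace Heine

/-! ### The field `ℚ(t,a,b,q)` and its `q`-shifts

The rank is `r = n + 1`; there are parameters `a₁, …, a_{n+1}` and `b₁, …, b_n`. -/

/-- Indices of the variables that can be `q`-shifted: `t`, the `aᵢ` and the `bⱼ`. -/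
abbrev Var (n : ℕ) := Unit ⊕ Fin (n + 1) ⊕ Fin n

/-- The index of `t`. -/
abbrev vT (n : ℕ) : Var n := Sum.inl ()

/-- The index of `aᵢ`. -/
abbrev vA {n : ℕ} (i : Fin (n + 1)) : Var n := Sum.inr (Sum.inl i)

/-- The index of `bⱼ`. -/
abbrev vB {n : ℕ} (j : Fin n) : Var n := Sum.inr (Sum.inr j)

/-- Exponents of Laurent monomials `q ^ k * ∏ v, x_v ^ m v`, as pairs `(k, m)`. -/
abbrev Expo (n : ℕ) := ℤ × (Var n → ℤ)

/-- The ring `ℚ[t^±, a^±, b^±, q^±]` of Laurent polynomials. -/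
abbrev Laurent (n : ℕ) := AddMonoidAlgebra ℚ (Expo n)

/-- The field `ℚ(t,a,b,q)`. -/
def RatField (n : ℕ) := FractionRing (Laurent n)

instance (n : ℕ) : Field (RatField n) := inferInstanceAs (Field (FractionRing (Laurent n)))

instance (n : ℕ) : Algebra (Laurent n) (RatField n) :=
  inferInstanceAs (Algebra (Laurent n) (FractionRing (Laurent n)))

instance (n : ℕ) : IsFractionRing (Laurent n) (RatField n) :=
  inferInstanceAs (IsFractionRing (Laurent n) (FractionRing (Laurent n)))

/-- The element `q` of `ℚ(t,a,b,q)`. -/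
def qq (n : ℕ) : RatField n :=
  algebraMap (Laurent n) (RatField n) (AddMonoidAlgebra.single (1, 0) 1)

/-- The element `x_v` of `ℚ(t,a,b,q)`, where `x_v` is `t`, an `aᵢ` or a `bⱼ`. -/
def xx {n : ℕ} (v : Var n) : RatField n :=
  algebraMap (Laurent n) (RatField n) (AddMonoidAlgebra.single (0, Pi.single v 1) 1)

/-- The field automorphism of `ℚ(t,a,b,q)` given by an automorphism of the exponent lattice. -/
def monomialAut {n : ℕ} (e : Expo n ≃+ Expo n) : RatField n ≃+* RatField n :=
  IsFractionRing.ringEquivOfRingEquiv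
    ((AddMonoidAlgebra.domCongr ℚ ℚ e : Laurent n ≃ₐ[ℚ] Laurent n).toRingEquiv)

theorem monomialAut_single {n : ℕ} (e : Expo n ≃+ Expo n) (m : Expo n) (c : ℚ) :
    monomialAut e (algebraMap (Laurent n) (RatField n) (AddMonoidAlgebra.single m c)) =
      algebraMap (Laurent n) (RatField n) (AddMonoidAlgebra.single (e m) c) := by
  unfold monomialAut
  rw [IsFractionRing.ringEquivOfRingEquiv_algebraMap]
  congr 1
  simp

theorem ratField_hom_ext {n : ℕ} {R : Type*} [CommRing R] {f g : RatField n →+* R}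
    (h : ∀ m c, f (algebraMap (Laurent n) (RatField n) (AddMonoidAlgebra.single m c)) =
      g (algebraMap (Laurent n) (RatField n) (AddMonoidAlgebra.single m c))) : f = g := by
  apply IsLocalization.ringHom_ext (nonZeroDivisors (Laurent n))
  have key : (f.comp (algebraMap (Laurent n) (RatField n))).toAddMonoidHom =
      (g.comp (algebraMap (Laurent n) (RatField n))).toAddMonoidHom :=
    AddMonoidAlgebra.addMonoidHom_ext h
  exact RingHom.ext fun x => DFunLike.congr_fun key x

theorem monomialAut_comp {n : ℕ} (e e' e'' : Expo n ≃+ Expo n) (h : ∀ m, e'' m = e (e' m))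
    (x : RatField n) : monomialAut e'' x = monomialAut e (monomialAut e' x) := by
  have : (monomialAut e'').toRingHom =
      (monomialAut e).toRingHom.comp (monomialAut e').toRingHom := by
    apply ratField_hom_ext
    intro m c
    simp [monomialAut_single, h]
  exact DFunLike.congr_fun this x

theorem monomialAut_id {n : ℕ} (e : Expo n ≃+ Expo n) (h : ∀ m, e m = m)
    (x : RatField n) : monomialAut e x = x := by
  have : (monomialAut e).toRingHom = RingHom.id _ := by
    apply ratField_hom_ext
    intro m c
    simp [monomialAut_single, h]
  exact DFunLike.congr_fun this x

/-- The effect on exponents of the substitution `x_v ↦ q ^ (g v) * x_v`, with `q` fixed. -/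
def shiftExpo {n : ℕ} (g : Var n → ℤ) : Expo n ≃+ Expo n where
  toFun m := (m.1 + ∑ v, g v * m.2 v, m.2)
  invFun m := (m.1 - ∑ v, g v * m.2 v, m.2)
  left_inv m := by simp
  right_inv m := by simp
  map_add' m m' := by
    ext
    · simp [mul_add, Finset.sum_add_distrib]; ring
    · simp

/-- The effect on exponents of the substitution `q ↦ q⁻¹`, with all `x_v` fixed. -/
def invExpo (n : ℕ) : Expo n ≃+ Expo n where
  toFun m := (-m.1, m.2)
  invFun m := (-m.1, m.2)
  left_inv m := by simp
  right_inv m := by simp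
  map_add' m m' := by
    ext
    · simp [add_comm]
    · simp

/-- The field automorphism `q ↦ q⁻¹` of `ℚ(t,a,b,q)` (fixing `t`, `a`, `b`). -/
def qInv (n : ℕ) : RatField n ≃+* RatField n := monomialAut (invExpo n)

/-- The group of `q`-shifts, written multiplicatively: `ofAdd g` stands for the substitution
`x_v ↦ q ^ (g v) * x_v`. -/
abbrev Shift (n : ℕ) := Multiplicative (Var n → ℤ)

theorem shiftExpo_zero {n : ℕ} (m : Expo n) : shiftExpo (0 : Var n → ℤ) m = m := by
  simp [shiftExpo]

theorem shiftExpo_add {n : ℕ} (g h : Var n → ℤ) (m : Expo n) :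
    shiftExpo (g + h) m = shiftExpo g (shiftExpo h m) := by
  ext
  · simp [shiftExpo, add_mul, Finset.sum_add_distrib]; ring
  · simp [shiftExpo]

theorem invExpo_shiftExpo {n : ℕ} (g : Var n → ℤ) (m : Expo n) :
    invExpo n (shiftExpo g m) = shiftExpo (-g) (invExpo n m) := by
  ext
  · simp [shiftExpo, invExpo]; ring
  · simp [shiftExpo, invExpo]

/-- The shift group acts on `ℚ(t,a,b,q)` by field automorphisms. -/
def shiftAut (n : ℕ) : Shift n →* RingAut (RatField n) where
  toFun g := monomialAut (shiftExpo (Multiplicative.toAdd g))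
  map_one' := RingEquiv.ext fun x => monomialAut_id (shiftExpo (0 : Var n → ℤ)) shiftExpo_zero x
  map_mul' g h := RingEquiv.ext fun x =>
    monomialAut_comp (shiftExpo (Multiplicative.toAdd g)) (shiftExpo (Multiplicative.toAdd h))
      (shiftExpo (Multiplicative.toAdd g + Multiplicative.toAdd h))
      (shiftExpo_add (Multiplicative.toAdd g) (Multiplicative.toAdd h)) x

instance (n : ℕ) : MulSemiringAction (Shift n) (RatField n) :=
  MulSemiringAction.compHom (RatField n) (shiftAut n)

/-- The generator of the shift group that sends `x_v` to `q * x_v`. -/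
def shiftOf {n : ℕ} (v : Var n) : Shift n := Multiplicative.ofAdd (Pi.single v 1)

theorem smul_ratField_def {n : ℕ} (g : Shift n) (x : RatField n) :
    g • x = monomialAut (shiftExpo (Multiplicative.toAdd g)) x := rfl

theorem qInv_smul {n : ℕ} (g : Shift n) (x : RatField n) :
    qInv n (g • x) = g⁻¹ • qInv n x := by
  rw [smul_ratField_def, smul_ratField_def, qInv,
    ← monomialAut_comp (invExpo n) (shiftExpo (Multiplicative.toAdd g))
      ((shiftExpo (Multiplicative.toAdd g)).trans (invExpo n)) (fun m => rfl),
    ← monomialAut_comp (shiftExpo (Multiplicative.toAdd g⁻¹)) (invExpo n)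
      ((shiftExpo (Multiplicative.toAdd g)).trans (invExpo n))
      (fun m => invExpo_shiftExpo (Multiplicative.toAdd g) m)]

/-! ### The `q`-Weyl algebra and its modules -/

/-- The `q`-Weyl algebra over `ℚ(t,a,b,q)` generated by the invertible shift operators
`σ_t, σ_{aᵢ}, σ_{bⱼ}`, with `σ_v x_v = q x_v σ_v` and all other pairs commuting. -/
abbrev QWeyl (n : ℕ) := SkewMonoidAlgebra (RatField n) (Shift n)

/-- A rational function as an element of the `q`-Weyl algebra. -/
abbrev scal {n : ℕ} : RatField n →+* QWeyl n := SkewMonoidAlgebra.singleOneRingHom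

/-- A shift as an element of the `q`-Weyl algebra. -/
abbrev oper {n : ℕ} : Shift n →* QWeyl n := SkewMonoidAlgebra.of (RatField n) (Shift n)

theorem oper_mul_scal {n : ℕ} (g : Shift n) (x : RatField n) :
    oper g * scal x = scal (g • x) * oper g := by
  simp [SkewMonoidAlgebra.of_apply, SkewMonoidAlgebra.singleOneRingHom,
    SkewMonoidAlgebra.single_mul_single]

/-- The involution of the `q`-Weyl algebra with `q ↦ q⁻¹` and `σ_v ↦ σ_v⁻¹`, fixing `t, a, b`. -/
def weylInv (n : ℕ) : QWeyl n →+* QWeyl n :=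
  SkewMonoidAlgebra.liftNCRingHom (scal.comp (qInv n).toRingHom)
    (oper.comp (invMonoidHom : Shift n →* Shift n)) (by
      intro x g
      have := oper_mul_scal g⁻¹ (qInv n x)
      rw [← qInv_smul] at this
      exact this.symm)

/-- The module `M^∧`: the additive group of `M`, on which the `q`-Weyl algebra acts through
the involution `q ↦ q⁻¹`, `σ_v ↦ σ_v⁻¹`. -/
def Wedge (M : Type*) := M

instance (M : Type*) [AddCommGroup M] : AddCommGroup (Wedge M) :=
  inferInstanceAs (AddCommGroup M)

instance (n : ℕ) (M : Type*) [AddCommGroup M] [Module (QWeyl n) M] :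
    Module (QWeyl n) (Wedge M) :=
  Module.compHom M (weylInv n)

/-- The `ℚ(t,a,b,q)`-linear functionals on a module over the `q`-Weyl algebra. -/
def Vee (n : ℕ) (M : Type*) [AddCommGroup M] [Module (QWeyl n) M] :
    AddSubgroup (M →+ RatField n) where
  carrier := {l | ∀ x m, l (scal x • m) = x * l m}
  zero_mem' := fun x _ => (mul_zero x).symm
  add_mem' := by
    intro l l' hl hl' x m
    rw [AddMonoidHom.add_apply, AddMonoidHom.add_apply, hl x m, hl' x m, mul_add]
  neg_mem' := by
    intro l hl x m
    rw [AddMonoidHom.neg_apply, AddMonoidHom.neg_apply, hl x m, mul_neg]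

/-- Multiplication of functionals by scalars: `(x l)(m) = x * l m`. -/
def veeScal (n : ℕ) (M : Type*) [AddCommGroup M] [Module (QWeyl n) M] :
    RatField n →+* AddMonoid.End (Vee n M) where
  toFun x :=
    { toFun := fun l => ⟨(AddMonoidHom.mulLeft x).comp l.1, fun y m => by
        have := l.2 y m
        simp only [AddMonoidHom.comp_apply, AddMonoidHom.coe_mulLeft, this]
        ring⟩
      map_zero' := by ext m; exact mul_zero x
      map_add' := fun l l' => by ext m; exact mul_add x (l.1 m) (l'.1 m) }
  map_one' := by ext l m; exact one_mul (l.1 m)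
  map_mul' x y := by ext l m; exact mul_assoc x y (l.1 m)
  map_zero' := by ext l m; exact zero_mul (l.1 m)
  map_add' x y := by ext l m; exact add_mul x y (l.1 m)

/-- The action of shifts on functionals by conjugation: `(σ l)(m) = σ (l (σ⁻¹ m))`. -/
def veeShift (n : ℕ) (M : Type*) [AddCommGroup M] [Module (QWeyl n) M] :
    Shift n →* AddMonoid.End (Vee n M) where
  toFun g :=
    { toFun := fun l => ⟨{ toFun := fun m => g • l.1 (oper g⁻¹ • m)
                           map_zero' := by rw [smul_zero, map_zero, smul_zero]
                           map_add' := fun m m' => by rw [smul_add, map_add, smul_add] }, fun y m => by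
        have h1 : (oper g⁻¹ : QWeyl n) • scal y • m = scal (g⁻¹ • y) • oper g⁻¹ • m := by
          rw [← mul_smul, oper_mul_scal, mul_smul]
        have := l.2 (g⁻¹ • y) (oper g⁻¹ • m)
        change g • l.1 (oper g⁻¹ • scal y • m) = y * g • l.1 (oper g⁻¹ • m)
        rw [h1, this, smul_mul', smul_inv_smul]⟩
      map_zero' := by ext m; exact smul_zero g
      map_add' := fun l l' => by
        ext m
        exact smul_add g (l.1 (oper g⁻¹ • m)) (l'.1 (oper g⁻¹ • m)) }
  map_one' := by
    ext l m
    change (1 : Shift n) • l.1 (oper (1 : Shift n)⁻¹ • m) = l.1 m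
    rw [inv_one, map_one, one_smul, one_smul]
  map_mul' g h := by
    ext l m
    change (g * h) • l.1 (oper (g * h)⁻¹ • m) = g • h • l.1 (oper h⁻¹ • oper g⁻¹ • m)
    rw [mul_smul, _root_.mul_inv_rev, map_mul, mul_smul]

/-- The action of the `q`-Weyl algebra on functionals: scalars act on values, shifts act by
conjugation. -/
def veeHom (n : ℕ) (M : Type*) [AddCommGroup M] [Module (QWeyl n) M] :
    QWeyl n →+* AddMonoid.End (Vee n M) :=
  SkewMonoidAlgebra.liftNCRingHom (veeScal n M) (veeShift n M) (by
    intro x g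
    ext l m
    change (g • x) * g • l.1 (oper g⁻¹ • m) = g • (x * l.1 (oper g⁻¹ • m))
    rw [smul_mul'])

/-- The module `M^∨ = Hom(M, ℚ(t,a,b,q))`. -/
instance (n : ℕ) (M : Type*) [AddCommGroup M] [Module (QWeyl n) M] :
    Module (QWeyl n) (Vee n M) :=
  Module.compHom (Vee n M) (veeHom n M)

/-! ### The `q`-hypergeometric system -/

/-- The list `(b₀, b₁, …, b_n)` with `b₀ = q`, in `ℚ(t,a,b,q)`. -/
def bAll (n : ℕ) : Fin (n + 1) → RatField n := Fin.cons (qq n) (fun j => xx (vB j))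

/-- The equation in `t`:
`∏_{j=0}^{r-1} (1 - q⁻¹ b_j σ_t) - t ∏_{j=1}^{r} (1 - a_j σ_t)`. -/
def relT (n : ℕ) : QWeyl n :=
  (List.ofFn fun j : Fin (n + 1) =>
      1 - scal ((qq n)⁻¹ * bAll n j) * oper (shiftOf (vT n))).prod
    - scal (xx (vT n)) * (List.ofFn fun j : Fin (n + 1) =>
        1 - scal (xx (vA j)) * oper (shiftOf (vT n))).prod

/-- The equation in `aᵢ`: `σ_{aᵢ}⁻¹ - q⁻¹ aᵢ σ_t σ_{aᵢ}⁻¹ - (1 - q⁻¹ aᵢ)`. -/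
def relA {n : ℕ} (i : Fin (n + 1)) : QWeyl n :=
  oper (shiftOf (vA i))⁻¹
    - scal ((qq n)⁻¹ * xx (vA i)) * oper (shiftOf (vT n)) * oper (shiftOf (vA i))⁻¹
    - scal (1 - (qq n)⁻¹ * xx (vA i))

/-- The equation in `bⱼ`: `1 - q⁻¹ bⱼ σ_t - (1 - q⁻¹ bⱼ) σ_{bⱼ}⁻¹`. -/
def relB {n : ℕ} (j : Fin n) : QWeyl n :=
  1 - scal ((qq n)⁻¹ * xx (vB j)) * oper (shiftOf (vT n))
    - scal (1 - (qq n)⁻¹ * xx (vB j)) * oper (shiftOf (vB j))⁻¹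

/-- The module `M` of the system: the cyclic left module over the `q`-Weyl algebra whose
generator satisfies exactly the equations of the system. -/
abbrev heineModule (n : ℕ) :=
  QWeyl n ⧸ Submodule.span (QWeyl n)
    ({relT n} ∪ Set.range (relA (n := n)) ∪ Set.range (relB (n := n)))

/-- The elementary symmetric polynomial `e_k`. -/
def elemSymm {m : ℕ} {R : Type*} [CommRing R] (k : ℕ) (x : Fin m → R) : R :=
  ∑ s ∈ Finset.powersetCard k (Finset.univ : Finset (Fin m)), ∏ i ∈ s, x i

/-- `e_k(b/q) - t e_k(a)` -/
def coefE (n k : ℕ) : RatField n :=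
  elemSymm k (fun j => bAll n j / qq n) - xx (vT n) * elemSymm k (fun i => xx (vA i))

/-- The companion matrix `A(t,a,b,q)` of the equation in `t`. -/
def compA (n : ℕ) : Matrix (Fin (n + 1)) (Fin (n + 1)) (RatField n) := fun i j =>
  if i = Fin.last n then (-1) ^ (n + j.val) * coefE n j.val / coefE n (n + 1)
  else if j.val = i.val + 1 then 1 else 0

/-! ### Values of rational functions at complex points -/

/-- The value of a Laurent polynomial at nonzero complex numbers `q`, `x_v`. -/
def evalLaurent {n : ℕ} (q : ℂ) (x : Var n → ℂ) (f : Laurent n) : ℂ :=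
  f.coeff.sum fun m c => (c : ℂ) * (q ^ m.1 * ∏ v, x v ^ m.2 v)

/-- The rational function `y` is defined at the point `(q, x)`, with value `z` there. -/
def HasValue {n : ℕ} (q : ℂ) (x : Var n → ℂ) (y : RatField n) (z : ℂ) : Prop :=
  ∃ N D : Laurent n, evalLaurent q x D ≠ 0 ∧
    y = algebraMap (Laurent n) (RatField n) N / algebraMap (Laurent n) (RatField n) D ∧
    z = evalLaurent q x N / evalLaurent q x D

/-- The point with coordinates `t`, `a`, `b`. -/
def point {n : ℕ} (t : ℂ) (a : Fin (n + 1) → ℂ) (b : Fin n → ℂ) : Var n → ℂ :=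
  Sum.elim (fun _ => t) (Sum.elim a b)

/-! ### The fundamental matrix -/

/-- `(x;q)_k` -/
def qPoch (x q : ℂ) (k : ℕ) : ℂ := ∏ i ∈ Finset.range k, (1 - x * q ^ i)

/-- `(x;q)_∞`. For `|q| < 1` this is the infinite product. For `|q| > 1` the conventions
`(x;q⁻¹)_∞ = (q x;q)_∞⁻¹` and `(q⁻¹;q⁻¹)_∞ = (q;q)_∞⁻¹` (for `|q| < 1`) are in force. -/
def qPochInf (x q : ℂ) : ℂ :=
  if ‖q‖ < 1 then ∏' k : ℕ, (1 - x * q ^ k)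
  else if x = q then (∏' k : ℕ, (1 - q⁻¹ * q⁻¹ ^ k))⁻¹
  else (∏' k : ℕ, (1 - q⁻¹ * x * q⁻¹ ^ k))⁻¹

/-- The theta function `θ(t;q) = (q t;q)_∞ (t⁻¹;q)_∞ (q;q)_∞`. -/
def theta (t q : ℂ) : ℂ := qPochInf (q * t) q * qPochInf t⁻¹ q * qPochInf q q

/-- `F` is the meromorphic continuation to `ℂ` of the `q`-hypergeometric series
`∑ k, (∏ i, (α i;q)_k / (β i;q)_k) t ^ k`, where one of the `β i` is `q`. -/
def IsPhi {m : ℕ} (α β : Fin m → ℂ) (q : ℂ) (F : ℂ → ℂ) : Prop :=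
  MeromorphicOn F Set.univ ∧
    ∀ᶠ t in 𝓝 (0 : ℂ), HasSum (fun k : ℕ => (∏ i, qPoch (α i) q k / qPoch (β i) q k) * t ^ k) (F t)

/-- The meromorphic continuation to `ℂ` of the `q`-hypergeometric series (if it exists; it is
then unique up to its values on a discrete set). -/
def phi {m : ℕ} (α β : Fin m → ℂ) (q : ℂ) : ℂ → ℂ := Classical.epsilon (IsPhi α β q)

/-- The parameters `(b₀, b₁, …, b_n)` with `b₀ = q`. -/
def bFull {n : ℕ} (b : Fin n → ℂ) (q : ℂ) : Fin (n + 1) → ℂ := Fin.cons q b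

/-- The constants `B_j`; `B₀ = 1`. -/
def constB {n : ℕ} (a : Fin (n + 1) → ℂ) (b : Fin n → ℂ) (q : ℂ) (j : Fin (n + 1)) : ℂ :=
  if j = 0 then 1 else
    (∏ i, qPochInf (a i) q * qPochInf (q * bFull b q i / bFull b q j) q /
      (qPochInf (q * a i / bFull b q j) q * qPochInf (bFull b q i) q)) *
    (qPochInf q q ^ 3 / theta (q⁻¹ * bFull b q j) q)

/-- The upper parameters `q a / b_j`. -/
def upper {n : ℕ} (a : Fin (n + 1) → ℂ) (b : Fin n → ℂ) (q : ℂ) (j : Fin (n + 1)) :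
    Fin (n + 1) → ℂ := fun i => q * a i / bFull b q j

/-- The lower parameters `q b / b_j`; the entry at `j` is `q`. -/
def lower {n : ℕ} (b : Fin n → ℂ) (q : ℂ) (j : Fin (n + 1)) :
    Fin (n + 1) → ℂ := fun i => q * bFull b q i / bFull b q j

/-- The solutions at `t = 0`:
`f_j(t,a,b,q) = B_j(a,b,q) θ(q⁻¹ b_j t;q) / θ(t;q) * φ(q a / b_j; q b / b_j; q, t)`. -/
def sol {n : ℕ} (a : Fin (n + 1) → ℂ) (b : Fin n → ℂ) (q : ℂ) (j : Fin (n + 1)) (t : ℂ) : ℂ :=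
  constB a b q j * (theta (q⁻¹ * bFull b q j * t) q / theta t q) *
    phi (upper a b q j) (lower b q j) q t

/-- The fundamental matrix `U(t,a,b,q)`, the `q`-Wronskian of the solutions at `t = 0`. -/
def matU {n : ℕ} (t : ℂ) (a : Fin (n + 1) → ℂ) (b : Fin n → ℂ) (q : ℂ) :
    Matrix (Fin (n + 1)) (Fin (n + 1)) ℂ := fun i j => sol a b q j (q ^ i.val * t)

/-- Admissible parameters: all are nonzero, `|q| ≠ 1`, and with `b₀ = q` no ratio `bᵢ / bⱼ`
(`i ≠ j`) and no ratio `aᵢ / bⱼ` is an integer power of `q`. -/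
structure NonResonant {n : ℕ} (a : Fin (n + 1) → ℂ) (b : Fin n → ℂ) (q : ℂ) : Prop where
  q_ne_zero : q ≠ 0
  norm_q_ne_one : ‖q‖ ≠ 1
  a_ne_zero : ∀ i, a i ≠ 0
  b_ne_zero : ∀ j, b j ≠ 0
  b_div_b : ∀ i j, i ≠ j → ∀ k : ℤ, bFull b q i / bFull b q j ≠ q ^ k
  a_div_b : ∀ i j, ∀ k : ℤ, a i / bFull b q j ≠ q ^ k

end Heine

end

open Filter Topology Matrix

noncomputable section

namespace Heine

/-! Both claims come from one bilinear form in the solutions. Put `D = diag(1, -1, ..., -1)` and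
`P(t) = U(t,a,b,q⁻¹) D U(t,a,b,q)ᵀ`. If the entries of `P` are rational in `t, a, b, q` and `P` is
generically invertible, then `Q = P⁻¹` is the required matrix: the identity for `U⁻ᵀ` is the
definition of `P` solved for `U⁻ᵀ`. The equation `U(qt) = A(t) U(t)`, used at `q` and at `q⁻¹`,
gives `A(qt,q⁻¹) P(qt) = P(t) A(t)ᵀ`, whose inverse is the equation for `Q`.

Rationality starts from an explicit case. If `b` is replaced by `q⁻¹ b` in the factor at `q⁻¹`, then
the signed sum over `j` of `f_j(t; q⁻¹) f_j(q^(m+1) t; q)` is identically `1` for `0 ≤ m ≤ n`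
(`NonResonant.sol_pairing`). Indeed the theta quotients cancel up to the factor `-t`, the constants
`B_j` multiply to rational functions, and each coefficient of positive degree in `t` is a sum of all
residues of a rational function that has none at infinity (`sum_eval_div_prod_one_sub`,
`NonResonant.coef_relation`). The recurrence in `t` then gives rationality for all shifts of `t`,
and the contiguity relation in `b_j` (`NonResonant.sol_update_b`) brings each `q⁻¹ b_j` back to
`b_j` (`isRat_pairSum`). Invertibility is visible at `t = 0`: up to column factors, `U` degenerates
to a Vandermonde matrix in the numbers `q / b_j` (`NonResonant.eventually_det_ne_zero`).

For the duality, take a point with algebraically independent coordinates, so that evaluation there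
embeds `ℚ(t,a,b,q)` in `ℂ`. Each solution at `q` maps `M` to functions on the orbit of this point
under `q`-shifts, and each solution at `q⁻¹` does the same for `M^∧`. The signed sum of products is
a pairing of `M^∧` with `M`. It takes rational values, because it is `1` on suitable elements and `n
+ 1` consecutive powers of `σ_t` applied to the generator span `M` (`eq_top_of_consecutive`). Its
Gram matrix on `σ_t^i` applied to the generator evaluates to `P`, so the pairing is perfect
(`nonempty_equiv_of_pairing`).

The meromorphic continuation of the series comes from iterating the recurrence in `t`. Identities
between continued functions are proved for power series near `0` and extended by the identity
theorem. The exceptional sets of `t` are discrete in `ℂˣ`, hence countable, so a common good point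
always exists. -/

/-! ### Generic points of `ℂˣ` -/

/-- The filter of sets whose complement in `ℂˣ` is discrete and closed in `ℂˣ`. -/
abbrev gen : Filter ℂ := codiscreteWithin ({0}ᶜ : Set ℂ)

theorem eventually_gen_iff {p : ℂ → Prop} :
    (∀ᶠ t in gen, p t) ↔ ∀ x : ℂ, x ≠ 0 → ∀ᶠ t in 𝓝[≠] x, p t := by
  have key : ∀ x : ℂ, x ≠ 0 → ({0}ᶜ : Set ℂ) ∈ 𝓝[≠] x := fun x hx =>
    mem_nhdsWithin_of_mem_nhds (isOpen_compl_singleton.mem_nhds hx)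
  rw [Filter.Eventually, mem_codiscreteWithin_iff_forall_mem_nhdsNE]
  constructor
  · intro h x hx
    filter_upwards [h x hx, key x hx] with t ht h0
    rcases ht with ht | ht
    · exact ht
    · exact absurd h0 ht
  · intro h x hx
    filter_upwards [h x hx] with t ht
    exact Or.inl ht

theorem eventually_gen_ne_zero : ∀ᶠ t in gen, t ≠ 0 := self_mem_codiscreteWithin _

theorem tendsto_mul_gen {c : ℂ} (hc : c ≠ 0) : Tendsto (fun t => c * t) gen gen := by
  intro s hs
  change ∀ᶠ t in gen, c * t ∈ s
  have hs' : ∀ᶠ t in gen, t ∈ s := hs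
  rw [eventually_gen_iff] at hs' ⊢
  intro x hx
  have h1 : Tendsto (fun t => c * t) (𝓝[≠] x) (𝓝[≠] (c * x)) := by
    apply tendsto_nhdsWithin_of_tendsto_nhds_of_eventually_within
    · exact ((continuous_const.mul continuous_id).tendsto x).mono_left nhdsWithin_le_nhds
    · filter_upwards [self_mem_nhdsWithin] with t ht
      simpa [hc] using ht
  exact h1 (hs' (c * x) (mul_ne_zero hc hx))

/-- The identity theorem: on the connected plane the order of a meromorphic function is infinite
everywhere or nowhere. -/
theorem eventually_gen_of_nhdsNE_zero {f : ℂ → ℂ} (hf : Meromorphic f)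
    (h : ∀ᶠ t in 𝓝[≠] (0 : ℂ), f t = 0) : ∀ᶠ t in gen, f t = 0 := by
  rw [eventually_gen_iff]
  intro x _
  rw [← meromorphicOrderAt_eq_top_iff]
  by_contra hx
  exact (hf.exists_meromorphicOrderAt_ne_top_iff_forall.1 ⟨x, hx⟩ 0)
    (meromorphicOrderAt_eq_top_iff.2 h)

/-- The passage from identities of power series near `0` to identities of the continued functions.
-/
theorem eventually_gen_eq {f g : ℂ → ℂ} (hf : Meromorphic f) (hg : Meromorphic g)
    (h : ∀ᶠ t in 𝓝 (0 : ℂ), f t = g t) : ∀ᶠ t in gen, f t = g t := by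
  have := eventually_gen_of_nhdsNE_zero (hf.sub hg)
    ((h.filter_mono nhdsWithin_le_nhds).mono fun t ht => by simp [ht])
  filter_upwards [this] with t ht
  exact sub_eq_zero.1 ht

theorem eventually_gen_ne {f : ℂ → ℂ} (hf : Meromorphic f)
    (h : ∀ᶠ t in 𝓝 (0 : ℂ), f t ≠ 0) : ∀ᶠ t in gen, f t ≠ 0 := by
  rw [eventually_gen_iff]
  intro x _
  rw [← meromorphicOrderAt_ne_top_iff_eventually_ne_zero (hf x)]
  refine hf.exists_meromorphicOrderAt_ne_top_iff_forall.1 ⟨0, ?_⟩ x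
  rw [meromorphicOrderAt_ne_top_iff_eventually_ne_zero (hf 0)]
  exact h.filter_mono nhdsWithin_le_nhds

/-- Countability of the exceptional sets allows infinitely many generic conditions, one for each
shift, to be imposed on `t` together with algebraic independence. -/
theorem countable_of_mem_gen {s : Set ℂ} (hs : s ∈ gen) : (sᶜ).Countable := by
  have h1 : IsDiscrete (sᶜ ∩ {0}ᶜ) := isDiscrete_of_codiscreteWithin (by simpa using hs)
  have h2 : (sᶜ ∩ {0}ᶜ).Countable := by
    have := h1.to_subtype
    exact Set.countable_coe_iff.1 (TopologicalSpace.separableSpace_iff_countable.1 inferInstance)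
  refine (h2.union (Set.countable_singleton (0 : ℂ))).mono fun x hx => ?_
  by_cases h0 : x = 0
  · exact Or.inr h0
  · exact Or.inl ⟨hx, h0⟩

theorem zpow_ne_one_of_norm {q : ℂ} (hq1 : ‖q‖ ≠ 1) {k : ℤ} (hk : k ≠ 0) :
    q ^ k ≠ 1 := by
  intro h
  have h1 : ‖q‖ ^ k = 1 := by rw [← norm_zpow, h, norm_one]
  rcases (zpow_eq_one_iff_of_ne_zero₀ hk).1 h1 with h2 | h2
  · exact hq1 h2
  · have := norm_nonneg q
    linarith [h2.1]

/-- The continuous function `log ‖t‖ / log ‖q‖` takes the value `k` at `q ^ k`. At most one integer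
lies within `1/2` of its value at `x`, so only one power of `q` has to be avoided near `x`. This
covers `‖q‖ < 1` and `‖q‖ > 1` alike. -/
theorem eventually_gen_ne_zpow {q : ℂ} (hq : q ≠ 0) (hq1 : ‖q‖ ≠ 1) {c : ℂ} (hc : c ≠ 0) :
    ∀ᶠ t in gen, ∀ k : ℤ, c * t ≠ q ^ k := by
  have key : ∀ᶠ t in gen, ∀ k : ℤ, t ≠ q ^ k := by
    rw [eventually_gen_iff]
    intro x hx
    have hlog : Real.log ‖q‖ ≠ 0 := by
      have := norm_pos_iff.2 hq
      intro h
      rcases Real.log_eq_zero.1 h with h | h | h <;> first | exact hq1 h | linarith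
    set l := Real.log ‖q‖ with hl
    have hcont : ContinuousAt (fun t : ℂ => Real.log ‖t‖ / l) x :=
      ((continuous_norm.continuousAt).log (norm_ne_zero_iff.2 hx)).div_const l
    have hnear : ∀ᶠ t in 𝓝 x, |Real.log ‖t‖ / l - Real.log ‖x‖ / l| < 1 / 2 := by
      have := Metric.continuousAt_iff.1 hcont (1 / 2) (by norm_num)
      obtain ⟨δ, hδ, h⟩ := this
      filter_upwards [Metric.ball_mem_nhds x hδ] with t ht
      simpa [Real.dist_eq] using h ht
    obtain ⟨k₀, hk₀⟩ : ∃ k₀ : ℤ, ∀ k : ℤ, |(k : ℝ) - Real.log ‖x‖ / l| < 1 / 2 → k = k₀ := by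
      by_cases hex : ∃ k : ℤ, |(k : ℝ) - Real.log ‖x‖ / l| < 1 / 2
      · obtain ⟨k₀, h₀⟩ := hex
        refine ⟨k₀, fun k h => ?_⟩
        rw [abs_lt] at h h₀
        have h1 : (k : ℝ) - k₀ < 1 := by linarith [h.1, h.2, h₀.1, h₀.2]
        have h2 : (-1 : ℝ) < (k : ℝ) - k₀ := by linarith [h.1, h.2, h₀.1, h₀.2]
        have h1' : k - k₀ < 1 := by exact_mod_cast h1
        have h2' : -1 < k - k₀ := by exact_mod_cast h2
        omega
      · exact ⟨0, fun k h => absurd ⟨k, h⟩ hex⟩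
    have hval : ∀ᶠ t in 𝓝[≠] x, t ≠ q ^ k₀ := by
      by_cases h : x = q ^ k₀
      · rw [← h]; exact self_mem_nhdsWithin
      · exact nhdsWithin_le_nhds (isOpen_compl_singleton.mem_nhds h)
    filter_upwards [hval, hnear.filter_mono nhdsWithin_le_nhds] with t h1 h2 k hk
    have : k = k₀ := by
      apply hk₀
      have h3 : Real.log ‖t‖ / l = k := by
        rw [hk, norm_zpow, Real.log_zpow, ← hl]
        field_simp
      rwa [h3] at h2
    exact h1 (this ▸ hk)
  exact (tendsto_mul_gen hc).eventually key

/-! ### Infinite `q`-Pochhammer symbols and theta functions -/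

theorem summable_norm_mul_pow {p : ℂ} (hp : ‖p‖ < 1) (x : ℂ) :
    Summable fun k : ℕ => ‖-(x * p ^ k)‖ := by
  simpa [norm_mul, norm_pow] using (summable_geometric_of_lt_one (norm_nonneg p) hp).mul_left ‖x‖

theorem multipliable_one_sub_mul_pow {p : ℂ} (hp : ‖p‖ < 1) (x : ℂ) :
    Multipliable fun k : ℕ => 1 - x * p ^ k := by
  simpa [sub_eq_add_neg] using multipliable_one_add_of_summable (summable_norm_mul_pow hp x)

theorem tprod_one_sub_mul_pow_succ {p : ℂ} (hp : ‖p‖ < 1) (x : ℂ) :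
    ∏' k : ℕ, (1 - x * p ^ k) = (1 - x) * ∏' k : ℕ, (1 - p * x * p ^ k) := by
  have h := (multipliable_one_sub_mul_pow hp (p * x))
  rw [tprod_eq_zero_mul']
  · simp only [pow_zero, mul_one]
    congr 1
    exact tprod_congr fun k => by ring
  · exact h.congr fun k => by ring

theorem tprod_one_sub_mul_pow_ne_zero {p : ℂ} (hp : ‖p‖ < 1) {x : ℂ}
    (hx : ∀ k : ℕ, x * p ^ k ≠ 1) : ∏' k : ℕ, (1 - x * p ^ k) ≠ 0 := by
  have := tprod_one_add_ne_zero_of_summable (f := fun k : ℕ => -(x * p ^ k))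
    (fun k => by rw [← sub_eq_add_neg]; exact sub_ne_zero.2 (hx k).symm) (summable_norm_mul_pow hp x)
  simpa [sub_eq_add_neg] using this

theorem norm_inv_lt_one {q : ℂ} (hq1 : ‖q‖ ≠ 1) (h : ¬‖q‖ < 1) : ‖q⁻¹‖ < 1 := by
  rw [norm_inv]
  exact inv_lt_one_of_one_lt₀ (lt_of_le_of_ne (not_lt.1 h) (Ne.symm hq1))

/-- For `‖q‖ > 1` the symbol has a separate value at `x = q`. That value would enter on the left for
`x = q` and on the right for `x = 1`, hence the two exclusions. -/
theorem qPochInf_eq_mul {q : ℂ} (hq : q ≠ 0) (hq1 : ‖q‖ ≠ 1) {x : ℂ} (h1 : x ≠ 1) (h2 : x ≠ q) :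
    qPochInf x q = (1 - x) * qPochInf (q * x) q := by
  unfold qPochInf
  by_cases h : ‖q‖ < 1
  · simp only [h, if_true]
    exact tprod_one_sub_mul_pow_succ h x
  · have h3 : q * x ≠ q := fun h3 => h1 (by simpa [hq] using h3)
    simp only [h, h2, h3, if_false]
    have hp := norm_inv_lt_one hq1 h
    rw [inv_mul_cancel_left₀ hq, tprod_one_sub_mul_pow_succ hp x, mul_inv,
      mul_inv_cancel_left₀ (sub_ne_zero.2 (Ne.symm h1))]

theorem qPochInf_ne_zero {q : ℂ} (hq : q ≠ 0) (hq1 : ‖q‖ ≠ 1) {x : ℂ} (hx : ∀ k : ℤ, x ≠ q ^ k) :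
    qPochInf x q ≠ 0 := by
  unfold qPochInf
  have h2 : x ≠ q := by simpa using hx 1
  by_cases h : ‖q‖ < 1
  · simp only [h, if_true]
    apply tprod_one_sub_mul_pow_ne_zero h
    intro k hk
    apply hx (-k)
    rw [_root_.zpow_neg, zpow_natCast]
    exact eq_inv_of_mul_eq_one_left hk
  · simp only [h, h2, if_false]
    apply inv_ne_zero
    apply tprod_one_sub_mul_pow_ne_zero (norm_inv_lt_one hq1 h)
    intro k hk
    apply hx (k + 1)
    rw [inv_pow] at hk
    have : q ^ k ≠ 0 := pow_ne_zero _ hq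
    rw [zpow_add₀ hq, zpow_natCast, zpow_one]
    field_simp at hk
    linear_combination hk

theorem qPochInf_self_ne_zero {q : ℂ} (hq : q ≠ 0) (hq1 : ‖q‖ ≠ 1) : qPochInf q q ≠ 0 := by
  have aux : ∀ p : ℂ, p ≠ 0 → ‖p‖ < 1 → ∏' k : ℕ, (1 - p * p ^ k) ≠ 0 := by
    intro p hp0 hp
    apply tprod_one_sub_mul_pow_ne_zero hp
    intro k
    rw [← pow_succ']
    exact_mod_cast zpow_ne_one_of_norm hp.ne (k := (k + 1 : ℕ)) (by positivity)
  unfold qPochInf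
  by_cases h : ‖q‖ < 1
  · simp only [h, if_true]
    exact aux q hq h
  · simp only [h, if_true, if_false]
    exact inv_ne_zero (aux _ (inv_ne_zero hq) (norm_inv_lt_one hq1 h))

theorem qPochInf_inv_inv {q : ℂ} (hq : q ≠ 0) (hq1 : ‖q‖ ≠ 1) :
    qPochInf q⁻¹ q⁻¹ = (qPochInf q q)⁻¹ := by
  unfold qPochInf
  by_cases h : ‖q‖ < 1
  · have h' : ¬ ‖q⁻¹‖ < 1 := by
      rw [norm_inv]
      exact not_lt.2 ((one_lt_inv₀ (norm_pos_iff.2 hq)).2 h).le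
    simp only [h, h', if_true, if_false, inv_inv]
  · have h' := norm_inv_lt_one hq1 h
    simp only [h, h', if_true, if_false, inv_inv]

/-- The convention for `‖q‖ > 1` is symmetric under `q ↦ q⁻¹`, apart from the separate values: `x =
q⁻¹` would meet the one in base `q⁻¹`, and `x = 1` the one in base `q`. -/
theorem qPochInf_inv_right {q : ℂ} (hq : q ≠ 0) (hq1 : ‖q‖ ≠ 1) {x : ℂ} (h1 : x ≠ 1)
    (h2 : x ≠ q⁻¹) : qPochInf x q⁻¹ = (qPochInf (q * x) q)⁻¹ := by
  have h3 : q * x ≠ q := fun h3 => h1 (by simpa [hq] using h3)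
  unfold qPochInf
  by_cases h : ‖q‖ < 1
  · have h' : ¬ ‖q⁻¹‖ < 1 := by
      rw [norm_inv]
      exact not_lt.2 ((one_lt_inv₀ (norm_pos_iff.2 hq)).2 h).le
    simp only [h, h', h2, if_true, if_false, inv_inv]
  · have h' := norm_inv_lt_one hq1 h
    simp only [h, h', h3, if_true, if_false, inv_inv, inv_mul_cancel_left₀ hq]

theorem theta_ne_zero {q : ℂ} (hq : q ≠ 0) (hq1 : ‖q‖ ≠ 1) {t : ℂ} (ht : ∀ k : ℤ, t ≠ q ^ k) :
    theta t q ≠ 0 := by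
  unfold theta
  refine mul_ne_zero (mul_ne_zero (qPochInf_ne_zero hq hq1 fun k hk => ht (k - 1) ?_)
    (qPochInf_ne_zero hq hq1 fun k hk => ht (-k) ?_)) (qPochInf_self_ne_zero hq hq1)
  · rw [zpow_sub_one₀ hq, ← hk]
    field_simp
  · rw [_root_.zpow_neg, ← hk, inv_inv]

theorem theta_mul_q {q : ℂ} (hq : q ≠ 0) (hq1 : ‖q‖ ≠ 1) {t : ℂ} (ht0 : t ≠ 0)
    (ht : ∀ k : ℤ, t ≠ q ^ k) : theta (q * t) q = -(q * t)⁻¹ * theta t q := by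
  have hne : ∀ k : ℤ, q * t ≠ q ^ k := fun k hk => ht (k - 1) (by
    rw [zpow_sub_one₀ hq, ← hk]; field_simp)
  have hne' : ∀ k : ℤ, (q * t)⁻¹ ≠ q ^ k := fun k hk => hne (-k) (by rw [_root_.zpow_neg, ← hk, inv_inv])
  unfold theta
  rw [qPochInf_eq_mul hq hq1 (x := q * t) (by simpa using hne 0) (by simpa using hne 1),
    qPochInf_eq_mul hq hq1 (x := (q * t)⁻¹) (by simpa using hne' 0) (by simpa using hne' 1)]
  have : q * (q * t)⁻¹ = t⁻¹ := by field_simp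
  rw [this]
  field_simp
  ring

theorem theta_inv_left {q : ℂ} (hq : q ≠ 0) (hq1 : ‖q‖ ≠ 1) {t : ℂ} (ht0 : t ≠ 0)
    (ht : ∀ k : ℤ, t ≠ q ^ k) : theta t⁻¹ q = -t * theta t q := by
  have hne' : ∀ k : ℤ, t⁻¹ ≠ q ^ k := fun k hk => ht (-k) (by rw [_root_.zpow_neg, ← hk, inv_inv])
  unfold theta
  rw [inv_inv, qPochInf_eq_mul hq hq1 (x := t) (by simpa using ht 0) (by simpa using ht 1),
    qPochInf_eq_mul hq hq1 (x := t⁻¹) (by simpa using hne' 0) (by simpa using hne' 1)]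
  field_simp
  ring

/-- Inverting the base turns `(q⁻¹ t; q⁻¹)_∞` and `(t⁻¹; q⁻¹)_∞` into the reciprocals of `(t; q)_∞`
and `(q t⁻¹; q)_∞`, and these are the two variable factors of `θ(t⁻¹; q)`. -/
theorem theta_inv_right {q : ℂ} (hq : q ≠ 0) (hq1 : ‖q‖ ≠ 1) {t : ℂ}
    (ht : ∀ k : ℤ, t ≠ q ^ k) : theta t q⁻¹ = (theta t⁻¹ q)⁻¹ := by
  have h1 : t ≠ 1 := by simpa using ht 0
  have h2 : t ≠ q := by simpa using ht 1
  have h3 : t ≠ q⁻¹ := by simpa using ht (-1)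
  unfold theta
  rw [qPochInf_inv_inv hq hq1, qPochInf_inv_right hq hq1 (x := q⁻¹ * t), qPochInf_inv_right hq hq1 (x := t⁻¹),
    mul_inv_cancel_left₀ hq, inv_inv, mul_inv, mul_inv]
  · ring
  · simpa using h1
  · simpa using h2
  · intro h; apply h2; field_simp at h; simpa using h
  · simpa [hq] using h1

/-! ### Elementary symmetric polynomials -/

/-- With `z = q ^ N` this describes the action of `∏ (1 - x_i T)`, where `T` is `t ↦ q t`, on the
coefficient of `t ^ N`. With `z` a polynomial variable it expands the products in `relT`. -/
theorem sum_elemSymm {m : ℕ} {R : Type*} [CommRing R] (x : Fin m → R) (z : R) :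
    ∑ k ∈ Finset.range (m + 1), (-1) ^ k * elemSymm k x * z ^ k = ∏ i, (1 - x i * z) := by
  have h : ∏ i, (1 - x i * z) = ∏ i, (1 + (-(x i * z))) := by simp [sub_eq_add_neg]
  rw [h, Finset.prod_one_add, Finset.sum_powerset, Finset.card_univ, Fintype.card_fin]
  refine Finset.sum_congr rfl fun k _ => ?_
  rw [elemSymm, Finset.mul_sum, Finset.sum_mul]
  refine Finset.sum_congr rfl fun s hs => ?_
  rw [Finset.prod_neg, Finset.prod_mul_distrib, Finset.prod_const, (Finset.mem_powersetCard.1 hs).2]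
  ring

theorem elemSymm_zero {m : ℕ} {R : Type*} [CommRing R] (x : Fin m → R) : elemSymm 0 x = 1 := by
  simp [elemSymm]

theorem elemSymm_self {m : ℕ} {R : Type*} [CommRing R] (x : Fin m → R) :
    elemSymm m x = ∏ i, x i := by
  have : Finset.powersetCard m (Finset.univ : Finset (Fin m)) = {Finset.univ} := by
    simpa using Finset.powersetCard_self (Finset.univ : Finset (Fin m))
  simp [elemSymm, this]

theorem elemSymm_mul {m : ℕ} {R : Type*} [CommRing R] (k : ℕ) (c : R) (x : Fin m → R) :
    elemSymm k (fun i => c * x i) = c ^ k * elemSymm k x := by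
  unfold elemSymm
  rw [Finset.mul_sum]
  refine Finset.sum_congr rfl fun s hs => ?_
  rw [Finset.prod_mul_distrib, Finset.prod_const, (Finset.mem_powersetCard.1 hs).2]

theorem map_elemSymm {m : ℕ} {R S : Type*} [CommRing R] [CommRing S] (f : R →+* S) (k : ℕ)
    (x : Fin m → R) : f (elemSymm k x) = elemSymm k (fun i => f (x i)) := by
  simp [elemSymm]

/-! ### `q`-hypergeometric series -/

section Series

variable {m : ℕ}

/-- The coefficients of the `q`-hypergeometric series. -/
def coefPhi (α β : Fin m → ℂ) (q : ℂ) (k : ℕ) : ℂ := ∏ i, qPoch (α i) q k / qPoch (β i) q k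

/-- Parameters for which the coefficients of the `q`-hypergeometric series are defined. -/
structure Regular (α β : Fin m → ℂ) (q : ℂ) : Prop where
  q_ne_zero : q ≠ 0
  norm_q_ne_one : ‖q‖ ≠ 1
  β_ne_zero : ∀ i, β i ≠ 0
  β_mul_pow : ∀ i (k : ℕ), β i * q ^ k ≠ 1
  exists_eq : ∃ i, β i = q

theorem qPoch_zero (x q : ℂ) : qPoch x q 0 = 1 := by simp [qPoch]

theorem qPoch_succ (x q : ℂ) (k : ℕ) : qPoch x q (k + 1) = qPoch x q k * (1 - x * q ^ k) := by
  simp [qPoch, Finset.prod_range_succ]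

theorem qPoch_succ' (x q : ℂ) (k : ℕ) : qPoch x q (k + 1) = (1 - x) * qPoch (q * x) q k := by
  simp only [qPoch, Finset.prod_range_succ', pow_zero, mul_one]
  rw [mul_comm]
  congr 1
  exact Finset.prod_congr rfl fun i _ => by ring

theorem qPoch_ne_zero {x q : ℂ} (h : ∀ k : ℕ, x * q ^ k ≠ 1) (k : ℕ) : qPoch x q k ≠ 0 :=
  Finset.prod_ne_zero_iff.2 fun i _ => sub_ne_zero.2 (h i).symm

variable {α β : Fin m → ℂ} {q : ℂ}

theorem coefPhi_zero : coefPhi α β q 0 = 1 := by simp [coefPhi, qPoch_zero]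

theorem coefPhi_succ (k : ℕ) : coefPhi α β q (k + 1) =
    coefPhi α β q k * ∏ i, (1 - α i * q ^ k) / (1 - β i * q ^ k) := by
  simp only [coefPhi, qPoch_succ, ← Finset.prod_mul_distrib]
  exact Finset.prod_congr rfl fun i _ => by rw [mul_div_mul_comm]

theorem Regular.one_sub_ne_zero (h : Regular α β q) (i : Fin m) (k : ℕ) : 1 - β i * q ^ k ≠ 0 :=
  sub_ne_zero.2 (h.β_mul_pow i k).symm

theorem Regular.coefPhi_succ_mul (h : Regular α β q) (k : ℕ) :
    coefPhi α β q (k + 1) * ∏ i, (1 - β i * q ^ k) =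
      coefPhi α β q k * ∏ i, (1 - α i * q ^ k) := by
  rw [coefPhi_succ, mul_assoc, ← Finset.prod_mul_distrib]
  congr 1
  exact Finset.prod_congr rfl fun i _ => div_mul_cancel₀ _ (h.one_sub_ne_zero i k)

theorem Regular.tendsto_ratio (h : Regular α β q) :
    ∃ l, Tendsto (fun k : ℕ => ∏ i, (1 - α i * q ^ k) / (1 - β i * q ^ k)) atTop (𝓝 l) := by
  by_cases hq : ‖q‖ < 1
  · refine ⟨∏ i : Fin m, (1 - α i * 0) / (1 - β i * 0), tendsto_finsetProd _ fun i _ => ?_⟩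
    have hp : Tendsto (fun k : ℕ => q ^ k) atTop (𝓝 0) := tendsto_pow_atTop_nhds_zero_of_norm_lt_one hq
    exact (tendsto_const_nhds.sub (hp.const_mul _)).div (tendsto_const_nhds.sub (hp.const_mul _))
      (by simp)
  · refine ⟨∏ i : Fin m, (0 - α i) / (0 - β i), tendsto_finsetProd _ fun i _ => ?_⟩
    have hp : Tendsto (fun k : ℕ => q⁻¹ ^ k) atTop (𝓝 0) :=
      tendsto_pow_atTop_nhds_zero_of_norm_lt_one (norm_inv_lt_one h.norm_q_ne_one hq)
    -- For `‖q‖ > 1` numerator and denominator are divided by `q ^ k`; the limit exists because the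
    -- `β i` do not vanish.
    have := (hp.sub (tendsto_const_nhds (x := α i))).div (hp.sub (tendsto_const_nhds (x := β i)))
      (by simpa using h.β_ne_zero i)
    refine this.congr fun k => ?_
    have hk : q ^ k ≠ 0 := pow_ne_zero _ h.q_ne_zero
    rw [Pi.div_apply, ← mul_div_mul_right _ _ hk, sub_mul, sub_mul, inv_pow, inv_mul_cancel₀ hk]

theorem Regular.exists_norm_coefPhi_le (h : Regular α β q) :
    ∃ R : ℝ, 0 < R ∧ ∀ k, ‖coefPhi α β q k‖ ≤ R ^ k := by
  obtain ⟨l, hl⟩ := h.tendsto_ratio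
  obtain ⟨R, hR⟩ := hl.norm.bddAbove_range
  refine ⟨max R 1, by positivity, fun k => ?_⟩
  induction k with
  | zero => simp [coefPhi_zero]
  | succ k ih =>
    rw [coefPhi_succ, norm_mul, pow_succ]
    have := hR ⟨k, rfl⟩
    exact mul_le_mul ih (this.trans (le_max_left _ _)) (norm_nonneg _) (by positivity)

theorem Regular.exists_analytic (h : Regular α β q) :
    ∃ (φ : ℂ → ℂ) (ρ : ℝ), 0 < ρ ∧ (∀ t ∈ Metric.ball (0 : ℂ) ρ, AnalyticAt ℂ φ t) ∧
      ∀ t ∈ Metric.ball (0 : ℂ) ρ, HasSum (fun k => coefPhi α β q k * t ^ k) (φ t) := by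
  -- On the disc of radius `1 / (2 R)` the series is dominated by the geometric series of ratio
  -- `1/2`.
  obtain ⟨R, hR, hle⟩ := h.exists_norm_coefPhi_le
  have hbound : ∀ (k : ℕ) (t : ℂ), t ∈ Metric.ball (0 : ℂ) (1 / (2 * R)) →
      ‖coefPhi α β q k * t ^ k‖ ≤ (1 / 2 : ℝ) ^ k := by
    intro k t ht
    rw [norm_mul, norm_pow]
    have ht' : ‖t‖ ≤ 1 / (2 * R) := by simpa using (Metric.mem_ball.1 ht).le
    calc _ ≤ R ^ k * (1 / (2 * R)) ^ k := by
          gcongr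
          exact hle k
      _ = (1 / 2 : ℝ) ^ k := by rw [← mul_pow]; congr 1; field_simp
  have hs : Summable fun k : ℕ => (1 / 2 : ℝ) ^ k := summable_geometric_two
  refine ⟨fun t => ∑' k, coefPhi α β q k * t ^ k, 1 / (2 * R), by positivity, ?_, ?_⟩
  · have := Complex.differentiableOn_tsum_of_summable_norm hs
      (F := fun k t => coefPhi α β q k * t ^ k)
      (fun k => (by fun_prop : Differentiable ℂ fun t : ℂ => coefPhi α β q k * t ^ k).differentiableOn)
      Metric.isOpen_ball hbound
    exact fun t ht => this.analyticAt (Metric.isOpen_ball.mem_nhds ht)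
  · intro t ht
    exact (Summable.of_norm_bounded hs fun k => hbound k t ht).hasSum

theorem hasSum_elemSymm {c : ℕ → ℂ} {F : ℂ → ℂ} {t : ℂ} (x : Fin m → ℂ)
    (h : ∀ k ≤ m, HasSum (fun N => c N * (q ^ k * t) ^ N) (F (q ^ k * t))) :
    HasSum (fun N => c N * (∏ i, (1 - x i * q ^ N)) * t ^ N)
      (∑ k ∈ Finset.range (m + 1), (-1) ^ k * elemSymm k x * F (q ^ k * t)) := by
  have := hasSum_sum (s := Finset.range (m + 1)) fun k hk =>
    (h k (Finset.mem_range_succ_iff.1 hk)).mul_left ((-1) ^ k * elemSymm k x)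
  refine this.congr_fun fun N => ?_
  rw [← sum_elemSymm, Finset.mul_sum, Finset.sum_mul]
  refine Finset.sum_congr rfl fun k _ => ?_
  ring

theorem HasSum.eq_mul_of_shift {f g : ℕ → ℂ} {a b t : ℂ} (hf : HasSum f a) (hg : HasSum g b)
    (h0 : f 0 = 0) (h : ∀ N, f (N + 1) = t * g N) : a = t * b := by
  have h1 := (hasSum_nat_add_iff (f := f) (g := a) 1).2 (by simpa [h0] using hf)
  have h2 := hg.mul_left t
  simp only [h] at h1
  exact h1.unique h2

/-- With `T` denoting `t ↦ q t`, the operator `∏ (1 - (β_i / q) T)` multiplies the `N`-th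
coefficient by `∏ (1 - β_i q^(N-1))`. This kills the constant term, as some `β_i` is `q`. By the
recursion for the coefficients the result is `t` times `∏ (1 - α_i T)` applied to the series. -/
theorem Regular.recurrence_of_hasSum (h : Regular α β q) {F : ℂ → ℂ} {t : ℂ}
    (hF : ∀ k ≤ m, HasSum (fun N => coefPhi α β q N * (q ^ k * t) ^ N) (F (q ^ k * t))) :
    ∑ k ∈ Finset.range (m + 1), (-1) ^ k *
      (elemSymm k (fun i => β i / q) - t * elemSymm k α) * F (q ^ k * t) = 0 := by
  have h1 := hasSum_elemSymm (fun i => β i / q) hF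
  have h2 := hasSum_elemSymm α hF
  have h3 := HasSum.eq_mul_of_shift (t := t) h1 h2 ?_ ?_
  · rw [← sub_eq_zero, Finset.mul_sum, ← Finset.sum_sub_distrib] at h3
    rw [← h3]
    exact Finset.sum_congr rfl fun k _ => by ring
  · obtain ⟨i, hi⟩ := h.exists_eq
    have : ∏ i, (1 - β i / q * q ^ 0) = 0 :=
      Finset.prod_eq_zero (Finset.mem_univ i) (by simp [hi, h.q_ne_zero])
    simp only [this, mul_zero, zero_mul]
  · intro N
    have h4 : ∏ i, (1 - β i / q * q ^ (N + 1)) = ∏ i, (1 - β i * q ^ N) :=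
      Finset.prod_congr rfl fun i _ => by
        have := h.q_ne_zero
        rw [pow_succ]
        field_simp
    rw [h4, h.coefPhi_succ_mul]
    ring

/-- A function near `0` that is expressed through its values at contracted points extends to a
meromorphic function. -/
theorem exists_meromorphic_continuation {p : ℂ} (hp : ‖p‖ < 1) (m : ℕ) (e : ℕ → ℂ → ℂ)
    (he : ∀ k, Meromorphic (e k)) {φ : ℂ → ℂ} {ρ : ℝ} (hρ : 0 < ρ)
    (han : ∀ t ∈ Metric.ball (0 : ℂ) ρ, AnalyticAt ℂ φ t)
    (hrec : ∀ t ∈ Metric.ball (0 : ℂ) ρ,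
      φ t = ∑ k ∈ Finset.range m, e k t * φ (p ^ (k + 1) * t)) :
    ∃ F : ℂ → ℂ, Meromorphic F ∧ ∀ t ∈ Metric.ball (0 : ℂ) ρ, F t = φ t := by
  -- `G N` applies the relation `N` times. It involves `φ` only at points of norm at most `‖p‖ ^ N *
  -- ‖t‖`, so where this is less than `ρ` it is meromorphic and agrees with all later iterates.
  -- These functions glue to the continuation.
  let G : ℕ → ℂ → ℂ := fun N => Nat.rec φ
    (fun _ g t => ∑ k ∈ Finset.range m, e k t * g (p ^ (k + 1) * t)) N
  have G0 : G 0 = φ := rfl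
  have Gs : ∀ N t, G (N + 1) t = ∑ k ∈ Finset.range m, e k t * G N (p ^ (k + 1) * t) :=
    fun N t => rfl
  have hle : ∀ (k : ℕ) (t : ℂ), ‖p ^ (k + 1) * t‖ ≤ ‖p‖ * ‖t‖ := by
    intro k t
    rw [norm_mul, norm_pow, pow_succ]
    gcongr
    exact mul_le_of_le_one_left (norm_nonneg _) (pow_le_one₀ (norm_nonneg _) hp.le)
  have hle' : ∀ (N k : ℕ) (t : ℂ), ‖p‖ ^ N * ‖p ^ (k + 1) * t‖ ≤ ‖p‖ ^ (N + 1) * ‖t‖ := by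
    intro N k t
    calc ‖p‖ ^ N * ‖p ^ (k + 1) * t‖ ≤ ‖p‖ ^ N * (‖p‖ * ‖t‖) :=
          mul_le_mul_of_nonneg_left (hle k t) (pow_nonneg (norm_nonneg _) _)
      _ = ‖p‖ ^ (N + 1) * ‖t‖ := by ring
  have hstep : ∀ N t, ‖p‖ ^ N * ‖t‖ < ρ → G (N + 1) t = G N t := by
    intro N
    induction N with
    | zero => intro t ht; rw [Gs, G0]; exact (hrec t (by simpa using ht)).symm
    | succ N ih =>
      intro t ht
      rw [Gs (N + 1), Gs N]
      refine Finset.sum_congr rfl fun k _ => ?_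
      rw [ih]
      exact (hle' N k t).trans_lt ht
  have hmer : ∀ N t, ‖p‖ ^ N * ‖t‖ < ρ → MeromorphicAt (G N) t := by
    intro N
    induction N with
    | zero => intro t ht; exact (han t (by simpa using ht)).meromorphicAt
    | succ N ih =>
      intro t ht
      have : MeromorphicAt (fun t => ∑ k ∈ Finset.range m, e k t * G N (p ^ (k + 1) * t)) t := by
        refine MeromorphicAt.fun_sum fun k _ => (he k t).fun_mul ?_
        refine MeromorphicAt.comp_analyticAt (f := G N) (g := fun t => p ^ (k + 1) * t)
          (ih _ ?_) (by fun_prop)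
        exact (hle' N k t).trans_lt ht
      exact this
  have hmono : ∀ N k t, ‖p‖ ^ N * ‖t‖ < ρ → G (N + k) t = G N t := by
    intro N k t ht
    induction k with
    | zero => rfl
    | succ k ih =>
      rw [← add_assoc, hstep _ _ ?_, ih]
      refine lt_of_le_of_lt ?_ ht
      rw [pow_add]
      gcongr
      exact mul_le_of_le_one_right (pow_nonneg (norm_nonneg _) _) (pow_le_one₀ (norm_nonneg _) hp.le)
  have hex : ∀ t : ℂ, ∃ N, ‖p‖ ^ N * ‖t‖ < ρ := by
    intro t
    have h1 : Tendsto (fun N : ℕ => ‖p‖ ^ N * ‖t‖) atTop (𝓝 (0 * ‖t‖)) :=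
      (tendsto_pow_atTop_nhds_zero_of_lt_one (norm_nonneg _) hp).mul_const _
    rw [zero_mul] at h1
    exact (h1.eventually_lt_const hρ).exists
  choose ν hν using hex
  have hF : ∀ N t, ‖p‖ ^ N * ‖t‖ < ρ → G (ν t) t = G N t := by
    intro N t ht
    rcases le_total N (ν t) with hl | hl
    · obtain ⟨k, hk⟩ := Nat.exists_eq_add_of_le hl
      rw [hk, hmono _ _ _ ht]
    · obtain ⟨k, hk⟩ := Nat.exists_eq_add_of_le hl
      rw [hk, hmono _ _ _ (hν t)]
  refine ⟨fun t => G (ν t) t, fun t => ?_, fun t ht => ?_⟩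
  · refine (hmer (ν t) t (hν t)).congr ?_
    have hopen : ∀ᶠ s in 𝓝 t, ‖p‖ ^ ν t * ‖s‖ < ρ :=
      (by fun_prop : Continuous fun s : ℂ => ‖p‖ ^ ν t * ‖s‖).continuousAt.eventually_lt_const (hν t)
    filter_upwards [hopen.filter_mono nhdsWithin_le_nhds] with s hs
    exact (hF _ _ hs).symm
  · exact hF 0 t (by simpa using ht)

theorem meromorphic_poly (a b : ℂ) : Meromorphic fun t : ℂ => a - t * b := fun t =>
  (by fun_prop : AnalyticAt ℂ (fun t : ℂ => a - t * b) t).meromorphicAt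

/-- The recurrence is solved for its term at the point farthest from `0`, the others being
contracted: the term with `k = 0` if `‖q‖ < 1`, the top term if `‖q‖ > 1`. -/
theorem Regular.exists_isPhi (h : Regular α β q) : ∃ F, IsPhi α β q F := by
  obtain ⟨φ, ρ, hρ, han, hsum⟩ := h.exists_analytic
  suffices ∃ F : ℂ → ℂ, Meromorphic F ∧ ∃ ρ' : ℝ, 0 < ρ' ∧ ρ' ≤ ρ ∧
      ∀ t ∈ Metric.ball (0 : ℂ) ρ', F t = φ t by
    obtain ⟨F, hF, ρ', hρ', hle, heq⟩ := this
    refine ⟨F, meromorphicOn_univ.2 hF, ?_⟩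
    filter_upwards [Metric.ball_mem_nhds (0 : ℂ) hρ'] with t ht
    rw [heq t ht]
    exact hsum t (Metric.ball_subset_ball hle ht)
  set c : ℕ → ℂ → ℂ := fun k t =>
    (-1) ^ k * (elemSymm k (fun i => β i / q) - t * elemSymm k α) with hc
  have hcm : ∀ k, Meromorphic (c k) := fun k =>
    (Meromorphic.const ((-1 : ℂ) ^ k)).fun_mul (meromorphic_poly _ _)
  by_cases hq : ‖q‖ < 1
  · have hle : ∀ (k : ℕ) (t : ℂ), ‖q ^ k * t‖ ≤ ‖t‖ := fun k t => by
      rw [norm_mul, norm_pow]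
      exact mul_le_of_le_one_left (norm_nonneg _) (pow_le_one₀ (norm_nonneg _) hq.le)
    -- The coefficient of `φ t` is `1 - t`, since `e_0 = 1`. Radius at most `1` keeps it nonzero.
    obtain ⟨F, hF, heq⟩ := exists_meromorphic_continuation hq m (fun k t => -(c (k + 1) t / (1 - t)))
      (fun k => ((hcm (k + 1)).fun_div (by simpa using meromorphic_poly 1 1)).fun_neg) (ρ := min ρ 1) (by positivity)
      (fun t ht => han t (Metric.ball_subset_ball (min_le_left _ _) ht)) (by
        intro t ht
        have h1 : ‖t‖ < ρ ∧ ‖t‖ < 1 := by simpa using ht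
        have hne : 1 - t ≠ 0 := by
          intro h0
          rw [← sub_eq_zero.1 h0] at h1
          simp at h1
        have hr := h.recurrence_of_hasSum (F := φ) (t := t) fun k _ =>
          hsum _ (by simpa using (hle k t).trans_lt h1.1)
        rw [Finset.sum_range_succ'] at hr
        simp only [pow_zero, elemSymm_zero, one_mul, mul_one] at hr
        have : ∑ k ∈ Finset.range m, -(c (k + 1) t / (1 - t)) * φ (q ^ (k + 1) * t) =
            -(∑ k ∈ Finset.range m, c (k + 1) t * φ (q ^ (k + 1) * t)) / (1 - t) := by
          rw [neg_div, Finset.sum_div, ← Finset.sum_neg_distrib]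
          exact Finset.sum_congr rfl fun k _ => by ring
        rw [this, eq_div_iff hne]
        linear_combination hr)
    exact ⟨F, hF, min ρ 1, by positivity, min_le_left _ _, heq⟩
  · have hp := norm_inv_lt_one h.norm_q_ne_one hq
    have hq0 := h.q_ne_zero
    -- The recurrence is taken at `q⁻¹ ^ m * t`, so that its top term is `φ t`, with coefficient `d
    -- t`. Near `0` this coefficient is nonzero because its value at `0` is, up to sign, the product
    -- of the `β_i / q`. The other terms are numbered in reverse order.
    set d : ℂ → ℂ := fun t => c m (q⁻¹ ^ m * t) with hd
    have hd0 : d 0 ≠ 0 := by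
      simp only [hd, hc, mul_zero, zero_mul, sub_zero, elemSymm_self]
      refine mul_ne_zero (by simp) (Finset.prod_ne_zero_iff.2 fun i _ => ?_)
      exact div_ne_zero (h.β_ne_zero i) hq0
    have hdcont : Continuous d := by
      simp only [hd, hc]
      fun_prop
    obtain ⟨δ, hδ, hδd⟩ := Metric.eventually_nhds_iff_ball.1 (hdcont.continuousAt.eventually_ne hd0)
    have hle : ∀ (k : ℕ) (t : ℂ), ‖q⁻¹ ^ k * t‖ ≤ ‖t‖ := fun k t => by
      rw [norm_mul, norm_pow]
      exact mul_le_of_le_one_left (norm_nonneg _) (pow_le_one₀ (norm_nonneg _) hp.le)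
    have hcomp : ∀ k, Meromorphic fun t => c k (q⁻¹ ^ m * t) := fun k t =>
      MeromorphicAt.comp_analyticAt (f := c k) (g := fun t => q⁻¹ ^ m * t) (hcm k _) (by fun_prop)
    obtain ⟨F, hF, heq⟩ := exists_meromorphic_continuation hp m
      (fun k t => -(c (m - 1 - k) (q⁻¹ ^ m * t) / d t))
      (fun k => ((hcomp _).fun_div (hcomp m)).fun_neg) (ρ := min ρ δ) (by positivity)
      (fun t ht => han t (Metric.ball_subset_ball (min_le_left _ _) ht)) (by
        intro t ht
        have h1 : ‖t‖ < ρ ∧ ‖t‖ < δ := by simpa using ht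
        have hne : d t ≠ 0 := hδd t (by simpa using h1.2)
        have hpow : ∀ k ≤ m, q ^ k * (q⁻¹ ^ m * t) = q⁻¹ ^ (m - k) * t := by
          intro k hk
          obtain ⟨l, rfl⟩ := Nat.exists_eq_add_of_le hk
          rw [Nat.add_sub_cancel_left, pow_add, inv_pow, inv_pow]
          field_simp
        have hr := h.recurrence_of_hasSum (F := φ) (t := q⁻¹ ^ m * t) fun k hk => by
          rw [hpow k hk]
          exact hsum _ (by simpa using (hle _ t).trans_lt h1.1)
        rw [Finset.sum_range_succ, hpow m le_rfl, Nat.sub_self, pow_zero, one_mul,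
          ← Finset.sum_range_reflect] at hr
        have : ∑ k ∈ Finset.range m, -(c (m - 1 - k) (q⁻¹ ^ m * t) / d t) * φ (q⁻¹ ^ (k + 1) * t) =
            -(∑ k ∈ Finset.range m, c (m - 1 - k) (q⁻¹ ^ m * t) *
              φ (q ^ (m - 1 - k) * (q⁻¹ ^ m * t))) / d t := by
          rw [neg_div, Finset.sum_div, ← Finset.sum_neg_distrib]
          refine Finset.sum_congr rfl fun k hk => ?_
          have hk' := Finset.mem_range.1 hk
          rw [hpow _ (by omega), show m - (m - 1 - k) = k + 1 by omega]
          ring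
        rw [this, eq_div_iff hne]
        linear_combination hr)
    exact ⟨F, hF, min ρ δ, by positivity, min_le_left _ _, heq⟩

theorem Regular.isPhi_phi (h : Regular α β q) : IsPhi α β q (phi α β q) :=
  Classical.epsilon_spec h.exists_isPhi

theorem Regular.meromorphic_phi (h : Regular α β q) : Meromorphic (phi α β q) :=
  meromorphicOn_univ.1 h.isPhi_phi.1

theorem Regular.meromorphic_phi_mul (h : Regular α β q) (c : ℂ) :
    Meromorphic fun t => phi α β q (c * t) := fun t =>
  MeromorphicAt.comp_analyticAt (f := phi α β q) (g := fun t => c * t) (h.meromorphic_phi _)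
    (by fun_prop)

theorem Regular.hasSum_phi (h : Regular α β q) (c : ℂ) :
    ∀ᶠ t in 𝓝 (0 : ℂ), HasSum (fun k => coefPhi α β q k * (c * t) ^ k) (phi α β q (c * t)) := by
  have : Tendsto (fun t : ℂ => c * t) (𝓝 0) (𝓝 0) := by
    simpa using (by fun_prop : Continuous fun t : ℂ => c * t).tendsto 0
  exact this.eventually h.isPhi_phi.2

theorem Regular.phi_recurrence (h : Regular α β q) :
    ∀ᶠ t in gen, ∑ k ∈ Finset.range (m + 1), (-1) ^ k *
      (elemSymm k (fun i => β i / q) - t * elemSymm k α) * phi α β q (q ^ k * t) = 0 := by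
  refine eventually_gen_eq (g := fun _ => 0) (Meromorphic.fun_sum fun k _ => ?_)
    (Meromorphic.const 0) ?_
  · exact ((Meromorphic.const ((-1 : ℂ) ^ k)).fun_mul (meromorphic_poly _ _)).fun_mul
      (h.meromorphic_phi_mul _)
  · have : ∀ᶠ t in 𝓝 (0 : ℂ), ∀ k ∈ Finset.range (m + 1), HasSum
        (fun N => coefPhi α β q N * (q ^ k * t) ^ N) (phi α β q (q ^ k * t)) :=
      (Finset.eventually_all _).2 fun k _ => h.hasSum_phi _
    filter_upwards [this] with t ht
    exact h.recurrence_of_hasSum fun k hk => ht k (Finset.mem_range_succ_iff.2 hk)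

end Series

/-! ### Contiguity relations for the series -/

section Series

variable {m : ℕ} {α β : Fin m → ℂ} {q : ℂ}

theorem coefPhi_update_upper (i : Fin m) (hi : 1 - α i ≠ 0) (k : ℕ) :
    (1 - α i) * coefPhi (Function.update α i (q * α i)) β q k =
      coefPhi α β q k * (1 - α i * q ^ k) := by
  have key : qPoch (q * α i) q k = qPoch (α i) q k * (1 - α i * q ^ k) / (1 - α i) := by
    rw [eq_div_iff hi, ← qPoch_succ, qPoch_succ', mul_comm]
  unfold coefPhi
  rw [← Finset.mul_prod_erase _ _ (Finset.mem_univ i), ← Finset.mul_prod_erase _ _ (Finset.mem_univ i),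
    Function.update_self, key,
    Finset.prod_congr rfl fun l hl => by rw [Function.update_of_ne (Finset.ne_of_mem_erase hl)]]
  field_simp

/-- Raising `α_i` to `q α_i` multiplies the `k`-th coefficient by `(1 - α_i q^k) / (1 - α_i)`, and
the factor `1 - α_i q^k` is the effect of `1 - α_i T` with `T` the map `t ↦ q t`. -/
theorem Regular.phi_update_upper (h : Regular α β q) (i : Fin m)
    (h' : Regular (Function.update α i (q * α i)) β q) (hi : 1 - α i ≠ 0) :
    ∀ᶠ t in gen, (1 - α i) * phi (Function.update α i (q * α i)) β q t =
      phi α β q t - α i * phi α β q (q * t) := by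
  refine eventually_gen_eq ((Meromorphic.const _).fun_mul h'.meromorphic_phi)
    (h.meromorphic_phi.fun_sub ((Meromorphic.const _).fun_mul (h.meromorphic_phi_mul q))) ?_
  filter_upwards [h'.hasSum_phi 1, h.hasSum_phi 1, h.hasSum_phi q] with t h1 h2 h3
  rw [one_mul] at h1 h2
  refine (h1.mul_left _).unique ((h2.sub (h3.mul_left (α i))).congr_fun fun k => ?_)
  rw [← mul_assoc, coefPhi_update_upper i hi]
  ring

theorem coefPhi_update_lower (i : Fin m) (hi : ∀ k : ℕ, 1 - β i * q ^ k ≠ 0) (k : ℕ) :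
    (1 - β i) * coefPhi α β q k =
      coefPhi α (Function.update β i (q * β i)) q k * (1 - β i * q ^ k) := by
  have h0 : 1 - β i ≠ 0 := by simpa using hi 0
  have h1 := hi k
  have h2 : qPoch (β i) q k ≠ 0 := qPoch_ne_zero (fun k hk => hi k (by rw [hk, sub_self])) k
  have key : qPoch (q * β i) q k = qPoch (β i) q k * (1 - β i * q ^ k) / (1 - β i) := by
    rw [eq_div_iff h0, ← qPoch_succ, qPoch_succ', mul_comm]
  unfold coefPhi
  rw [← Finset.mul_prod_erase _ _ (Finset.mem_univ i), ← Finset.mul_prod_erase _ _ (Finset.mem_univ i),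
    Function.update_self, key]
  conv_rhs =>
    rw [Finset.prod_congr rfl fun l hl => by rw [Function.update_of_ne (Finset.ne_of_mem_erase hl)]]
  field_simp

theorem Regular.phi_update_lower (h : Regular α β q) (i : Fin m)
    (h' : Regular α (Function.update β i (q * β i)) q) :
    ∀ᶠ t in gen, (1 - β i) * phi α β q t =
      phi α (Function.update β i (q * β i)) q t -
        β i * phi α (Function.update β i (q * β i)) q (q * t) := by
  refine eventually_gen_eq ((Meromorphic.const _).fun_mul h.meromorphic_phi)
    (h'.meromorphic_phi.fun_sub ((Meromorphic.const _).fun_mul (h'.meromorphic_phi_mul q))) ?_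
  filter_upwards [h.hasSum_phi 1, h'.hasSum_phi 1, h'.hasSum_phi q] with t h1 h2 h3
  rw [one_mul] at h1 h2
  refine (h1.mul_left _).unique ((h2.sub (h3.mul_left (β i))).congr_fun fun k => ?_)
  rw [← mul_assoc, coefPhi_update_lower i (h.one_sub_ne_zero i)]
  ring

/-- The factor `1 - q^k` produced by the `q`-difference kills the constant term and cancels the last
factor of `(q;q)_k`. What remains is `t` times a series in which every parameter except that `q` is
raised. It serves the case in which the shifted `b_j` is the one that defines the exponent of the
solution, for then all parameters move. -/
theorem Regular.phi_sub_phi_mul (h : Regular α β q) {α' β' : Fin m → ℂ} (h' : Regular α' β' q)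
    (j : Fin m) (hj : β j = q) (hj' : β' j = q) (hα : ∀ i, α' i = q * α i)
    (hβ : ∀ i, i ≠ j → β' i = q * β i) :
    ∀ᶠ t in gen, phi α β q t - phi α β q (q * t) =
      t * ((∏ i, (1 - α i) / (if i = j then 1 else 1 - β i)) * phi α' β' q t) := by
  have hcoef : ∀ k, coefPhi α β q (k + 1) * (1 - q ^ (k + 1)) =
      (∏ i, (1 - α i) / (if i = j then 1 else 1 - β i)) * coefPhi α' β' q k := by
    intro k
    have hone : ∏ i, (if i = j then (1 - q ^ (k + 1)) else 1) = 1 - q ^ (k + 1) := by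
      simp
    rw [← hone]
    unfold coefPhi
    rw [← Finset.prod_mul_distrib, ← Finset.prod_mul_distrib]
    refine Finset.prod_congr rfl fun i _ => ?_
    by_cases hi : i = j
    · subst hi
      have h1 := h.one_sub_ne_zero i k
      simp only [if_true, hα, hj', hj]
      rw [hj, ← pow_succ'] at h1
      rw [qPoch_succ', qPoch_succ q q, ← pow_succ', div_one]
      field_simp
    · simp only [hi, if_false, hα, hβ i hi]
      rw [qPoch_succ', qPoch_succ' (β i)]
      field_simp
  refine eventually_gen_eq (h.meromorphic_phi.fun_sub (h.meromorphic_phi_mul q))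
    (Meromorphic.fun_mul (f := fun t : ℂ => t) (fun t => analyticAt_id.meromorphicAt)
      ((Meromorphic.const _).fun_mul h'.meromorphic_phi)) ?_
  filter_upwards [h.hasSum_phi 1, h.hasSum_phi q, h'.hasSum_phi 1] with t h1 h2 h3
  rw [one_mul] at h1 h3
  refine HasSum.eq_mul_of_shift (t := t) (h1.sub h2) (h3.mul_left _) (by simp) fun N => ?_
  linear_combination t ^ (N + 1) * hcoef N

end Series

/-! ### The solutions `f_j` and their equations in `t`, `a` and `b` -/

section Solutions

variable {n : ℕ} {a : Fin (n + 1) → ℂ} {b : Fin n → ℂ} {q : ℂ}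

@[simp] theorem bFull_zero : bFull b q 0 = q := rfl

@[simp] theorem bFull_succ (j : Fin n) : bFull b q j.succ = b j := rfl

theorem NonResonant.bFull_ne_zero (h : NonResonant a b q) (j : Fin (n + 1)) : bFull b q j ≠ 0 := by
  refine Fin.cases h.q_ne_zero (fun j => h.b_ne_zero j) j

theorem NonResonant.b_ne_zpow (h : NonResonant a b q) (j : Fin n) (k : ℤ) : b j ≠ q ^ k := by
  have h1 := h.b_div_b j.succ 0 (Fin.succ_ne_zero j) (k - 1)
  intro h2
  apply h1
  rw [bFull_succ, bFull_zero, h2, zpow_sub_one₀ h.q_ne_zero, div_eq_mul_inv]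

theorem NonResonant.a_ne_zpow (h : NonResonant a b q) (i : Fin (n + 1)) (k : ℤ) : a i ≠ q ^ k := by
  have h1 := h.a_div_b i 0 (k - 1)
  intro h2
  apply h1
  rw [bFull_zero, h2, zpow_sub_one₀ h.q_ne_zero, div_eq_mul_inv]

/-- These conditions do not mention `b₀ = q`, which makes the invariance under `q ↦ q⁻¹` and under
`q`-shifts of the parameters visible. -/
theorem nonResonant_of (hq : q ≠ 0) (hq1 : ‖q‖ ≠ 1) (ha : ∀ i, a i ≠ 0) (hb : ∀ j, b j ≠ 0)
    (hb1 : ∀ (j : Fin n) (k : ℤ), b j ≠ q ^ k) (ha1 : ∀ (i : Fin (n + 1)) (k : ℤ), a i ≠ q ^ k)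
    (hbb : ∀ i j : Fin n, i ≠ j → ∀ k : ℤ, b i / b j ≠ q ^ k)
    (hab : ∀ (i : Fin (n + 1)) (j : Fin n) (k : ℤ), a i / b j ≠ q ^ k) : NonResonant a b q where
  q_ne_zero := hq
  norm_q_ne_one := hq1
  a_ne_zero := ha
  b_ne_zero := hb
  b_div_b i j := by
    refine Fin.cases ?_ (fun i => ?_) i <;> refine Fin.cases ?_ (fun j => ?_) j
    · exact fun h => absurd rfl h
    · intro _ k h
      apply hb1 j (1 - k)
      rw [bFull_zero, bFull_succ, div_eq_iff (hb j)] at h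
      rw [zpow_sub₀ hq, zpow_one, eq_div_iff (zpow_ne_zero _ hq), mul_comm, ← h]
    · intro _ k h
      apply hb1 i (k + 1)
      rw [bFull_zero, bFull_succ, div_eq_iff hq] at h
      rw [zpow_add_one₀ hq, h]
    · exact fun h k => hbb i j (fun h' => h (by rw [h'])) k
  a_div_b i j := by
    refine Fin.cases ?_ (fun j => ?_) j
    · intro k h
      apply ha1 i (k + 1)
      rw [bFull_zero, div_eq_iff hq] at h
      rw [zpow_add_one₀ hq, h]
    · exact fun k => hab i j k

theorem NonResonant.inv (h : NonResonant a b q) : NonResonant a b q⁻¹ := by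
  refine nonResonant_of (inv_ne_zero h.q_ne_zero) (by rw [norm_inv]; simpa using h.norm_q_ne_one)
    h.a_ne_zero h.b_ne_zero ?_ ?_ ?_ ?_
  · intro j k; rw [_root_.inv_zpow']; exact h.b_ne_zpow j _
  · intro j k; rw [_root_.inv_zpow']; exact h.a_ne_zpow j _
  · intro i j hij k; rw [_root_.inv_zpow']
    exact h.b_div_b i.succ j.succ (fun h' => hij (Fin.succ_injective _ h')) _
  · intro i j k; rw [_root_.inv_zpow']; exact h.a_div_b i j.succ _

theorem NonResonant.shift (h : NonResonant a b q) (k : Fin (n + 1) → ℤ) (l : Fin n → ℤ) :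
    NonResonant (fun i => q ^ k i * a i) (fun j => q ^ l j * b j) q := by
  have hq := h.q_ne_zero
  refine nonResonant_of hq h.norm_q_ne_one (fun i => mul_ne_zero (zpow_ne_zero _ hq) (h.a_ne_zero i))
    (fun j => mul_ne_zero (zpow_ne_zero _ hq) (h.b_ne_zero j)) ?_ ?_ ?_ ?_
  · intro j e he
    apply h.b_ne_zpow j (e - l j)
    rw [zpow_sub₀ hq, ← he, mul_div_cancel_left₀ _ (zpow_ne_zero _ hq)]
  · intro j e he
    apply h.a_ne_zpow j (e - k j)
    rw [zpow_sub₀ hq, ← he, mul_div_cancel_left₀ _ (zpow_ne_zero _ hq)]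
  · intro i j hij e he
    apply h.b_div_b i.succ j.succ (fun h' => hij (Fin.succ_injective _ h')) (e - l i + l j)
    rw [zpow_add₀ hq, zpow_sub₀ hq, ← he, bFull_succ, bFull_succ]
    have h1 := zpow_ne_zero (l i) hq
    have h2 := zpow_ne_zero (l j) hq
    field_simp
  · intro i j e he
    apply h.a_div_b i j.succ (e - k i + l j)
    rw [zpow_add₀ hq, zpow_sub₀ hq, ← he, bFull_succ]
    have h1 := zpow_ne_zero (k i) hq
    have h2 := zpow_ne_zero (l j) hq
    field_simp

theorem NonResonant.update_a (h : NonResonant a b q) (i : Fin (n + 1)) :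
    NonResonant (Function.update a i (q * a i)) b q := by
  have := h.shift (Pi.single i 1) 0
  convert this using 1
  · ext l
    by_cases hl : l = i
    · subst hl; simp
    · simp [hl]
  · ext l; simp

theorem NonResonant.update_b (h : NonResonant a b q) (j : Fin n) :
    NonResonant a (Function.update b j (q * b j)) q := by
  have := h.shift 0 (Pi.single j 1)
  convert this using 1
  · ext l; simp
  · ext l
    by_cases hl : l = j
    · subst hl; simp
    · simp [hl]

theorem NonResonant.regular (h : NonResonant a b q) (j : Fin (n + 1)) :
    Regular (upper a b q j) (lower b q j) q where
  q_ne_zero := h.q_ne_zero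
  norm_q_ne_one := h.norm_q_ne_one
  β_ne_zero i := div_ne_zero (mul_ne_zero h.q_ne_zero (h.bFull_ne_zero i)) (h.bFull_ne_zero j)
  β_mul_pow i k := by
    have hq := h.q_ne_zero
    have hb := h.bFull_ne_zero j
    unfold lower
    intro he
    by_cases hij : i = j
    · subst hij
      apply zpow_ne_one_of_norm h.norm_q_ne_one (k := (k + 1 : ℕ)) (by positivity)
      rw [mul_div_cancel_right₀ _ hb] at he
      rw [zpow_natCast, pow_succ', he]
    · apply h.b_div_b i j hij (-(k + 1 : ℕ))
      rw [_root_.zpow_neg, zpow_natCast, pow_succ']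
      refine eq_inv_of_mul_eq_one_left ?_
      rw [← he]
      ring
  exists_eq := ⟨j, mul_div_cancel_right₀ _ (h.bFull_ne_zero j)⟩

/-- The prefactor of the `j`-th solution, which has exponent `q / b_j`. -/
def prefactor (b : Fin n → ℂ) (q : ℂ) (j : Fin (n + 1)) (t : ℂ) : ℂ :=
  theta (q⁻¹ * bFull b q j * t) q / theta t q

theorem sol_eq (j : Fin (n + 1)) (t : ℂ) : sol a b q j t =
    constB a b q j * prefactor b q j t * phi (upper a b q j) (lower b q j) q t := rfl

theorem NonResonant.eventually_ne_zpow (h : NonResonant a b q) :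
    ∀ᶠ t in gen, t ≠ 0 ∧ (∀ k : ℤ, t ≠ q ^ k) ∧ ∀ j, ∀ k : ℤ, bFull b q j * t ≠ q ^ k := by
  filter_upwards [eventually_gen_ne_zero,
    eventually_gen_ne_zpow h.q_ne_zero h.norm_q_ne_one one_ne_zero,
    eventually_all.2 fun j => eventually_gen_ne_zpow h.q_ne_zero h.norm_q_ne_one
      (h.bFull_ne_zero j)] with t h0 h1 h2
  exact ⟨h0, fun k => by simpa using h1 k, h2⟩

theorem NonResonant.prefactor_mul_q (h : NonResonant a b q) (j : Fin (n + 1)) {t : ℂ}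
    (ht : t ≠ 0) (h1 : ∀ k : ℤ, t ≠ q ^ k) (h2 : ∀ k : ℤ, bFull b q j * t ≠ q ^ k) :
    prefactor b q j (q * t) = q / bFull b q j * prefactor b q j t := by
  have hq := h.q_ne_zero
  have hb := h.bFull_ne_zero j
  have h3 : ∀ k : ℤ, q⁻¹ * bFull b q j * t ≠ q ^ k := fun k hk => h2 (k + 1) (by
    rw [zpow_add_one₀ hq, ← hk]; field_simp)
  have hθ := theta_ne_zero hq h.norm_q_ne_one h1
  unfold prefactor
  rw [show q⁻¹ * bFull b q j * (q * t) = q * (q⁻¹ * bFull b q j * t) by ring,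
    theta_mul_q hq h.norm_q_ne_one (by positivity) h3, theta_mul_q hq h.norm_q_ne_one ht h1]
  field_simp

theorem NonResonant.prefactor_pow_mul (h : NonResonant a b q) (j : Fin (n + 1)) {t : ℂ}
    (ht : t ≠ 0) (h1 : ∀ k : ℤ, t ≠ q ^ k) (h2 : ∀ k : ℤ, bFull b q j * t ≠ q ^ k) (m : ℕ) :
    prefactor b q j (q ^ m * t) = (q / bFull b q j) ^ m * prefactor b q j t := by
  have hq := h.q_ne_zero
  induction m with
  | zero => simp
  | succ m ih =>
    have hm := pow_ne_zero m hq
    rw [pow_succ', mul_assoc, h.prefactor_mul_q j (mul_ne_zero hm ht), ih, pow_succ']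
    · ring
    · intro k hk
      apply h1 (k - m)
      rw [zpow_sub₀ hq, ← hk, zpow_natCast, mul_div_cancel_left₀ _ hm]
    · intro k hk
      apply h2 (k - m)
      rw [zpow_sub₀ hq, ← hk, zpow_natCast]
      field_simp

theorem NonResonant.prefactor_ne_zero (h : NonResonant a b q) (j : Fin (n + 1)) {t : ℂ}
    (h1 : ∀ k : ℤ, t ≠ q ^ k) (h2 : ∀ k : ℤ, bFull b q j * t ≠ q ^ k) :
    prefactor b q j t ≠ 0 := by
  have hq := h.q_ne_zero
  refine div_ne_zero (theta_ne_zero hq h.norm_q_ne_one fun k hk => h2 (k + 1) ?_)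
    (theta_ne_zero hq h.norm_q_ne_one h1)
  rw [zpow_add_one₀ hq, ← hk]
  field_simp

/-- Under `t ↦ q t` the prefactor is multiplied by `q / b_j`. The factor `(q / b_j) ^ k` is exactly
what changes `e_k(b / q)` and `e_k(a)` into the elementary symmetric functions of the parameters of
`φ_j`. -/
theorem NonResonant.sol_recurrence (h : NonResonant a b q) : ∀ᶠ t in gen, ∀ j,
    ∑ k ∈ Finset.range (n + 2), (-1) ^ k *
      (elemSymm k (fun i => bFull b q i / q) - t * elemSymm k a) * sol a b q j (q ^ k * t) = 0 := by
  rw [eventually_all]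
  intro j
  have hq := h.q_ne_zero
  have hb := h.bFull_ne_zero j
  filter_upwards [h.eventually_ne_zpow, (h.regular j).phi_recurrence] with t ht hφ
  have e1 : ∀ k, elemSymm k (fun i => lower b q j i / q) =
      (q / bFull b q j) ^ k * elemSymm k (fun i => bFull b q i / q) := fun k => by
    rw [← elemSymm_mul]
    congr 1
    ext i
    unfold lower
    field_simp
  have e2 : ∀ k, elemSymm k (upper a b q j) = (q / bFull b q j) ^ k * elemSymm k a := fun k => by
    rw [← elemSymm_mul]
    congr 1
    ext i
    unfold upper
    field_simp
  rw [← mul_zero (constB a b q j * prefactor b q j t), ← hφ, Finset.mul_sum]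
  refine Finset.sum_congr rfl fun k _ => ?_
  rw [sol_eq, h.prefactor_pow_mul j ht.1 ht.2.1 (ht.2.2 j), e1, e2]
  ring

/-- The prefactor turns `a_i` into the upper parameter `q a_i / b_j`, so the relation for the series
applies with `1 - q a_i / b_j`. The constant `B_j` converts this factor into `1 - a_i`; for `j = 0`
the two factors coincide. -/
theorem NonResonant.sol_update_a (h : NonResonant a b q) (i : Fin (n + 1)) : ∀ᶠ t in gen, ∀ j,
    sol a b q j t - a i * sol a b q j (q * t) =
      (1 - a i) * sol (Function.update a i (q * a i)) b q j t := by
  rw [eventually_all]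
  intro j
  have hq := h.q_ne_zero
  have hb := h.bFull_ne_zero j
  have hup : upper (Function.update a i (q * a i)) b q j =
      Function.update (upper a b q j) i (q * upper a b q j i) := by
    ext l
    by_cases hl : l = i
    · subst hl; simp [upper, mul_div_assoc]
    · simp [upper, hl]
  have hne : ∀ k : ℤ, q * a i / bFull b q j ≠ q ^ k := fun k hk => h.a_div_b i j (k - 1) (by
    rw [zpow_sub_one₀ hq, ← hk]; field_simp)
  have hne1 : 1 - upper a b q j i ≠ 0 := by
    rw [sub_ne_zero]; simpa [upper] using (hne 0).symm
  have hane : 1 - a i ≠ 0 := by rw [sub_ne_zero]; simpa using (h.a_ne_zpow i 0).symm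
  have hreg := (h.update_a i).regular j
  rw [hup] at hreg
  have hconst : (1 - a i) * constB (Function.update a i (q * a i)) b q j =
      constB a b q j * (1 - q * a i / bFull b q j) := by
    unfold constB
    by_cases hj : j = 0
    · subst hj; simp [hq]
    · simp only [hj, if_false]
      rw [← Finset.mul_prod_erase _ _ (Finset.mem_univ i),
        ← Finset.mul_prod_erase _ _ (Finset.mem_univ i),
        Finset.prod_congr rfl fun l hl => by rw [Function.update_of_ne (Finset.ne_of_mem_erase hl)],
        Function.update_self,
        qPochInf_eq_mul hq h.norm_q_ne_one (x := a i) (by simpa using h.a_ne_zpow i 0)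
          (by simpa using h.a_ne_zpow i 1),
        qPochInf_eq_mul hq h.norm_q_ne_one (x := q * a i / bFull b q j) (by simpa using hne 0)
          (by simpa using hne 1), mul_div_assoc q (q * a i)]
      have := sub_ne_zero.2 (show q * a i / bFull b q j ≠ 1 by simpa using hne 0).symm
      set x := q * a i / bFull b q j
      field_simp
  filter_upwards [h.eventually_ne_zpow, (h.regular j).phi_update_upper i hreg hne1] with t ht hφ
  rw [sol_eq, sol_eq, sol_eq, h.prefactor_mul_q j ht.1 ht.2.1 (ht.2.2 j), hup]
  have e : upper a b q j i = q * a i / bFull b q j := rfl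
  rw [← e] at hconst
  have : constB a b q j * prefactor b q j t * phi (upper a b q j) (lower b q j) q t -
      a i * (constB a b q j * (q / bFull b q j * prefactor b q j t) *
        phi (upper a b q j) (lower b q j) q (q * t)) = constB a b q j * prefactor b q j t *
      (phi (upper a b q j) (lower b q j) q t -
        upper a b q j i * phi (upper a b q j) (lower b q j) q (q * t)) := by
    rw [e]; ring
  rw [this, ← hφ]
  linear_combination (-(prefactor b q j t *
    phi (Function.update (upper a b q j) i (q * upper a b q j i)) (lower b q j) q t)) * hconst

theorem bFull_update (i : Fin n) (x : ℂ) :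
    bFull (Function.update b i x) q = Function.update (bFull b q) i.succ x := by
  unfold bFull
  rw [Fin.cons_update]

/-- As `b_j` itself is fixed, only one lower parameter of `φ_j` moves, and `B_j` again exchanges `1
- q b_i / b_j` for `1 - b_i`. -/
theorem NonResonant.sol_update_b_of_ne (h : NonResonant a b q) (i : Fin n) (j : Fin (n + 1))
    (hij : j ≠ i.succ) : ∀ᶠ t in gen,
    sol a (Function.update b i (q * b i)) q j t - b i * sol a (Function.update b i (q * b i)) q j (q * t) =
      (1 - b i) * sol a b q j t := by
  have hq := h.q_ne_zero
  have hb := h.bFull_ne_zero j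
  have h' := h.update_b i
  set b' := Function.update b i (q * b i) with hb'
  have hfull : bFull b' q = Function.update (bFull b q) i.succ (q * b i) := bFull_update i _
  have hj : bFull b' q j = bFull b q j := by rw [hfull, Function.update_of_ne hij]
  have hlow : lower b' q j = Function.update (lower b q j) i.succ (q * lower b q j i.succ) := by
    ext l
    unfold lower
    rw [hj]
    by_cases hl : l = i.succ
    · subst hl; rw [Function.update_self, hfull, Function.update_self, bFull_succ, mul_div_assoc]
    · simp [hfull, hl]
  have hup : upper a b' q j = upper a b q j := by unfold upper; rw [hj]
  have hpre : ∀ t, prefactor b' q j t = prefactor b q j t := fun t => by unfold prefactor; rw [hj]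
  have hne : ∀ k : ℤ, q * b i / bFull b q j ≠ q ^ k := fun k hk =>
    h.b_div_b i.succ j (Ne.symm hij) (k - 1) (by
      rw [zpow_sub_one₀ hq, ← hk, bFull_succ]; field_simp)
  have hreg := h'.regular j
  rw [hlow, hup] at hreg
  have hconst : constB a b' q j * (1 - q * b i / bFull b q j) = (1 - b i) * constB a b q j := by
    unfold constB
    by_cases hj0 : j = 0
    · subst hj0; simp [hq, mul_comm]
    · simp only [hj0, if_false, hj]
      have hprod : (∏ l, (qPochInf (a l) q * qPochInf (q * bFull b q l / bFull b q j) q /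
          (qPochInf (q * a l / bFull b q j) q * qPochInf (bFull b q l) q))) * (1 - b i) =
          (∏ l, (qPochInf (a l) q * qPochInf (q * bFull b' q l / bFull b q j) q /
          (qPochInf (q * a l / bFull b q j) q * qPochInf (bFull b' q l) q))) *
            (1 - q * b i / bFull b q j) := by
        rw [← Finset.mul_prod_erase _ _ (Finset.mem_univ i.succ),
          ← Finset.mul_prod_erase _ _ (Finset.mem_univ i.succ)]
        conv_rhs => rw [Finset.prod_congr rfl fun l hl => by
          rw [hfull, Function.update_of_ne (Finset.ne_of_mem_erase hl)]]
        rw [hfull, Function.update_self, bFull_succ,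
          qPochInf_eq_mul hq h.norm_q_ne_one (x := b i) (by simpa using h.b_ne_zpow i 0)
            (by simpa using h.b_ne_zpow i 1),
          qPochInf_eq_mul hq h.norm_q_ne_one (x := q * b i / bFull b q j) (by simpa using hne 0)
            (by simpa using hne 1), mul_div_assoc q (q * b i)]
        have := sub_ne_zero.2 (show b i ≠ 1 by simpa using h.b_ne_zpow i 0).symm
        set x := q * b i / bFull b q j
        field_simp
      linear_combination (-(qPochInf q q ^ 3 / theta (q⁻¹ * bFull b q j) q)) * hprod
  filter_upwards [h.eventually_ne_zpow, (h.regular j).phi_update_lower i.succ hreg] with t ht hφ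
  rw [sol_eq, sol_eq, sol_eq, hup, hlow, hpre, hpre, h.prefactor_mul_q j ht.1 ht.2.1 (ht.2.2 j)]
  have e : lower b q j i.succ = q * b i / bFull b q j := rfl
  rw [e] at hφ ⊢
  linear_combination (-(constB a b' q j * prefactor b q j t)) * hφ +
    prefactor b q j t * phi (upper a b q j) (lower b q j) q t * hconst

/-- Here the exponent of the solution changes. After the shift the prefactor contributes `1 / b_i`
under `t ↦ q t`, so the left side is a plain `q`-difference of `φ`. This produces a factor `t`,
which the quasi-periodicity of theta removes. -/
theorem NonResonant.sol_update_b_self (h : NonResonant a b q) (i : Fin n) : ∀ᶠ t in gen,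
    sol a (Function.update b i (q * b i)) q i.succ t -
      b i * sol a (Function.update b i (q * b i)) q i.succ (q * t) =
      (1 - b i) * sol a b q i.succ t := by
  have hq := h.q_ne_zero
  have hbi := h.b_ne_zero i
  have h' := h.update_b i
  set b' := Function.update b i (q * b i) with hb'
  have hfull : bFull b' q = Function.update (bFull b q) i.succ (q * b i) := bFull_update i _
  have hj : bFull b' q i.succ = q * b i := by rw [hfull, Function.update_self]
  have hup : ∀ l, upper a b' q i.succ l = a l / b i := fun l => by
    unfold upper; rw [hj]; field_simp
  have hlow : ∀ l, l ≠ i.succ → lower b' q i.succ l = bFull b q l / b i := fun l hl => by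
    unfold lower; rw [hj, hfull, Function.update_of_ne hl]; field_simp
  have hself : ∀ b : Fin n → ℂ, b i ≠ 0 → lower b q i.succ i.succ = q := fun b hb => by
    unfold lower; rw [bFull_succ, mul_div_cancel_right₀ _ hb]
  have hane : ∀ l, ∀ k : ℤ, a l / b i ≠ q ^ k := fun l k => h.a_div_b l i.succ k
  have hbne : ∀ l, l ≠ i.succ → ∀ k : ℤ, bFull b q l / b i ≠ q ^ k := fun l hl k =>
    h.b_div_b l i.succ hl k
  set P : ℂ := ∏ l, (1 - upper a b' q i.succ l) /
    (if l = i.succ then 1 else 1 - lower b' q i.succ l) with hP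
  -- The constant `P` of the `q`-difference relation is absorbed by `B_j`, one index of the product
  -- at a time. The factor `-(b i)` comes from the theta function in the denominator of `B_j`.
  have hconst : constB a b' q i.succ * P = -(b i) * (1 - b i) * constB a b q i.succ := by
    unfold constB
    simp only [Fin.succ_ne_zero, if_false, hj, bFull_succ]
    have hθ : theta (q⁻¹ * (q * b i)) q = -(b i)⁻¹ * theta (q⁻¹ * b i) q := by
      have := theta_mul_q hq h.norm_q_ne_one (t := q⁻¹ * b i) (by positivity) fun k hk =>
        h.b_ne_zpow i (k + 1) (by rw [zpow_add_one₀ hq, ← hk]; field_simp)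
      rw [show q⁻¹ * (q * b i) = q * (q⁻¹ * b i) by ring, this]
      field_simp
    have hprod : (∏ l, (qPochInf (a l) q * qPochInf (q * bFull b' q l / (q * b i)) q /
          (qPochInf (q * a l / (q * b i)) q * qPochInf (bFull b' q l) q))) * P =
          (∏ l, (qPochInf (a l) q * qPochInf (q * bFull b q l / b i) q /
          (qPochInf (q * a l / b i) q * qPochInf (bFull b q l) q))) * (1 - b i) := by
      have hone : ∏ l, (if l = i.succ then (1 - b i) else 1) = 1 - b i := by simp
      rw [← hone, hP, ← Finset.prod_mul_distrib, ← Finset.prod_mul_distrib]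
      refine Finset.prod_congr rfl fun l _ => ?_
      rw [mul_div_mul_left _ _ hq, mul_div_mul_left _ _ hq, hup,
        qPochInf_eq_mul hq h.norm_q_ne_one (x := a l / b i) (by simpa using hane l 0)
          (by simpa using hane l 1)]
      have h1 := sub_ne_zero.2 (show a l / b i ≠ 1 by simpa using hane l 0).symm
      by_cases hl : l = i.succ
      · subst hl
        simp only [if_true, hj, bFull_succ]
        rw [mul_div_cancel_right₀ _ hbi,
          qPochInf_eq_mul hq h.norm_q_ne_one (x := b i) (by simpa using h.b_ne_zpow i 0)
            (by simpa using h.b_ne_zpow i 1)]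
        have h2 := sub_ne_zero.2 (show b i ≠ 1 by simpa using h.b_ne_zpow i 0).symm
        rw [mul_div_assoc q (a i.succ)]
        set x := a i.succ / b i
        field_simp
      · simp only [hl, if_false, hfull, Function.update_of_ne hl, hlow l hl]
        have hx := hbne l hl
        rw [qPochInf_eq_mul hq h.norm_q_ne_one (x := bFull b q l / b i) (by simpa using hx 0)
            (by simpa using hx 1), mul_div_assoc q (a l), mul_div_assoc q (bFull b q l)]
        have h2 := sub_ne_zero.2 (show bFull b q l / b i ≠ 1 by simpa using hx 0).symm
        set x := a l / b i
        set y := bFull b q l / b i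
        field_simp
    rw [hθ]
    have : qPochInf q q ^ 3 / (-(b i)⁻¹ * theta (q⁻¹ * b i) q) =
      -(b i) * (qPochInf q q ^ 3 / theta (q⁻¹ * b i) q) := by field_simp
    rw [this]
    linear_combination (-(b i) * (qPochInf q q ^ 3 / theta (q⁻¹ * b i) q)) * hprod
  have hφ := (h'.regular i.succ).phi_sub_phi_mul (h.regular i.succ) i.succ
    (hself _ (h'.b_ne_zero i)) (hself _ hbi)
    (fun l => by rw [hup]; unfold upper; rw [bFull_succ, mul_div_assoc])
    (fun l hl => by rw [hlow l hl]; unfold lower; rw [bFull_succ, mul_div_assoc])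
  filter_upwards [h.eventually_ne_zpow, h'.eventually_ne_zpow, hφ] with t ht ht' hφ
  have hpre : prefactor b' q i.succ t = -(b i * t)⁻¹ * prefactor b q i.succ t := by
    have ht0 := ht.1
    unfold prefactor
    rw [hj, bFull_succ]
    have := theta_mul_q hq h.norm_q_ne_one (t := q⁻¹ * b i * t) (by positivity) fun k hk =>
        ht.2.2 i.succ (k + 1) (by rw [zpow_add_one₀ hq, ← hk, bFull_succ]; field_simp)
    rw [show q⁻¹ * (q * b i) * t = q * (q⁻¹ * b i * t) by ring, this]
    field_simp
  rw [sol_eq, sol_eq, sol_eq, h'.prefactor_mul_q i.succ ht'.1 ht'.2.1 (ht'.2.2 _), hj]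
  have e1 : q / (q * b i) = (b i)⁻¹ := by field_simp
  have ht0 := ht.1
  have e3 : b i * (constB a b' q i.succ * ((b i)⁻¹ * prefactor b' q i.succ t) *
      phi (upper a b' q i.succ) (lower b' q i.succ) q (q * t)) =
      constB a b' q i.succ * prefactor b' q i.succ t *
      phi (upper a b' q i.succ) (lower b' q i.succ) q (q * t) := by
    field_simp
  rw [e1, e3, ← mul_sub, hφ, hpre]
  have e2 : constB a b' q i.succ * (-(b i * t)⁻¹ * prefactor b q i.succ t) *
      (t * (P * phi (upper a b q i.succ) (lower b q i.succ) q t)) =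
      -(b i)⁻¹ * (constB a b' q i.succ * P) * prefactor b q i.succ t *
        phi (upper a b q i.succ) (lower b q i.succ) q t := by
    field_simp
  rw [e2, hconst]
  field_simp

theorem NonResonant.sol_update_b (h : NonResonant a b q) (i : Fin n) : ∀ᶠ t in gen, ∀ j,
    sol a (Function.update b i (q * b i)) q j t - b i * sol a (Function.update b i (q * b i)) q j (q * t) =
      (1 - b i) * sol a b q j t := by
  rw [eventually_all]
  intro j
  by_cases hj : j = i.succ
  · subst hj; exact h.sol_update_b_self i
  · exact h.sol_update_b_of_ne i j hj

end Solutions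

/-! ### A partial fraction identity -/

/-- Up to sign this is the sum of the residues of `P(x) / ∏ (1 - c_j x)`; the degree bound says that
there is no residue at infinity. Algebraically, it is the vanishing top coefficient in the Lagrange
interpolation of `P` at the nodes `c_i⁻¹`. -/
theorem sum_eval_div_prod_one_sub {K ι : Type*} [Field K] [DecidableEq ι] (s : Finset ι) (c : ι → K)
    (hc : ∀ i ∈ s, c i ≠ 0) (hinj : Set.InjOn c s) (P : Polynomial K)
    (hP : P.natDegree + 2 ≤ s.card) :
    ∑ i ∈ s, (c i)⁻¹ * P.eval (c i)⁻¹ / ∏ j ∈ s.erase i, (1 - c j * (c i)⁻¹) = 0 := by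
  have hinj' : Set.InjOn (fun i => (c i)⁻¹) s := fun i hi j hj h => hinj hi hj (inv_injective h)
  have hdeg : P.degree < s.card :=
    (Polynomial.degree_le_natDegree).trans_lt (by exact_mod_cast (by omega : P.natDegree < s.card))
  have h := Lagrange.coeff_eq_sum hinj' hdeg
  rw [Polynomial.coeff_eq_zero_of_natDegree_lt (by omega)] at h
  have key : ∀ i ∈ s, (c i)⁻¹ * P.eval (c i)⁻¹ / ∏ j ∈ s.erase i, (1 - c j * (c i)⁻¹) =
      (-∏ i ∈ s, (-(c i)⁻¹)) * (P.eval (c i)⁻¹ / ∏ j ∈ s.erase i, ((c i)⁻¹ - (c j)⁻¹)) := by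
    intro i hi
    have h1 : ∏ j ∈ s.erase i, ((c i)⁻¹ - (c j)⁻¹) =
        (∏ j ∈ s.erase i, (-(c j)⁻¹)) * ∏ j ∈ s.erase i, (1 - c j * (c i)⁻¹) := by
      rw [← Finset.prod_mul_distrib]
      refine Finset.prod_congr rfl fun j hj => ?_
      have := hc j (Finset.mem_of_mem_erase hj)
      have := hc i hi
      field_simp
      ring
    have h2 : ∏ j ∈ s.erase i, (-(c j)⁻¹) ≠ 0 :=
      Finset.prod_ne_zero_iff.2 fun j hj =>
        neg_ne_zero.2 (inv_ne_zero (hc j (Finset.mem_of_mem_erase hj)))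
    rw [h1, ← Finset.mul_prod_erase _ _ hi]
    generalize (∏ j ∈ s.erase i, (-(c j)⁻¹)) = u at h2 ⊢
    rw [show -(-(c i)⁻¹ * u) = (c i)⁻¹ * u by ring, mul_assoc, mul_div_assoc]
    congr 1
    rw [← mul_div_assoc, mul_div_mul_left _ _ h2]
  rw [Finset.sum_congr rfl key, ← Finset.mul_sum, ← h, mul_zero]

/-- The first `l` factors, read backwards, form a symbol in base `q⁻¹`. This is how coefficients of
the series at `q⁻¹` arise from residues. -/
theorem qPoch_split {q : ℂ} (hq : q ≠ 0) (x : ℂ) (l k : ℕ) :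
    qPoch (x * q⁻¹ ^ l) q (l + k) = qPoch (q⁻¹ * x) q⁻¹ l * qPoch x q k := by
  unfold qPoch
  rw [Finset.prod_range_add]
  congr 1
  · rw [← Finset.prod_range_reflect]
    refine Finset.prod_congr rfl fun e he => ?_
    obtain ⟨f, rfl⟩ := Nat.exists_eq_add_of_lt (Finset.mem_range.1 he)
    rw [show e + f + 1 - 1 - e = f by omega, inv_pow, inv_pow, pow_add, pow_add]
    field_simp
  · refine Finset.prod_congr rfl fun e _ => ?_
    rw [pow_add, inv_pow]
    field_simp

/-- The same splitting within one geometric progression of poles, the omitted factor being the pole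
at which the residue is taken. -/
theorem prod_ite_one_sub_pow {q : ℂ} (hq : q ≠ 0) (l k : ℕ) :
    ∏ f ∈ Finset.range (l + k + 1), (if f = l then 1 else 1 - q ^ f * q⁻¹ ^ l) =
      qPoch q⁻¹ q⁻¹ l * qPoch q q k := by
  rw [add_assoc, Finset.prod_range_add, Finset.prod_range_succ', add_zero, if_pos rfl, mul_one]
  unfold qPoch
  congr 1
  · rw [← Finset.prod_range_reflect]
    refine Finset.prod_congr rfl fun e he => ?_
    obtain ⟨f, rfl⟩ := Nat.exists_eq_add_of_lt (Finset.mem_range.1 he)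
    rw [if_neg (by omega), show e + f + 1 - 1 - e = f by omega, inv_pow, inv_pow, pow_add, pow_add]
    field_simp
  · refine Finset.prod_congr rfl fun e _ => ?_
    rw [if_neg (by omega), pow_add, inv_pow]
    field_simp
    ring

/-- When `k` and `l` are both positive, the two symbols share the factor `1 - x`, which therefore
appears once outside the combined symbol. -/
theorem qPoch_mul_qPoch_inv {q : ℂ} (hq : q ≠ 0) (x : ℂ) (k l : ℕ) (hkl : 1 ≤ k + l) :
    qPoch x q k * qPoch x q⁻¹ l = (1 - x) * qPoch (x * q * q⁻¹ ^ l) q (k + l - 1) := by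
  cases k with
  | succ k =>
    rw [show k + 1 + l - 1 = l + k by omega, qPoch_split hq, qPoch_succ', mul_comm x q,
      inv_mul_cancel_left₀ hq]
    ring
  | zero =>
    obtain ⟨l, rfl⟩ : ∃ l', l = l' + 1 := ⟨l - 1, by omega⟩
    have := qPoch_split hq x l 0
    rw [show x * q * q⁻¹ ^ (l + 1) = x * q⁻¹ ^ l by rw [pow_succ]; field_simp,
      show 0 + (l + 1) - 1 = l + 0 by omega, this, qPoch_zero, qPoch_succ']
    ring

/-! ### The quadratic relation between solutions at `q` and at `q⁻¹` -/

section Pairing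

variable {n : ℕ} {a : Fin (n + 1) → ℂ} {b : Fin n → ℂ} {q : ℂ}

/-- The list `(1, b₁, …, b_n)`. -/
def bOne (b : Fin n → ℂ) : Fin (n + 1) → ℂ := Fin.cons 1 b

@[simp] theorem bOne_zero : bOne b 0 = 1 := rfl

@[simp] theorem bOne_succ (j : Fin n) : bOne b j.succ = b j := rfl

/-- The constants in the quadratic relation between the solutions at `q` and at `q⁻¹`. -/
def pairC (a : Fin (n + 1) → ℂ) (b : Fin n → ℂ) (q : ℂ) (i : Fin n) : ℂ :=
  (∏ l, (1 - a l)) /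
    ((1 - q / b i) * ∏ l, (if l = i.succ then 1 else 1 - bOne b l / b i))

theorem NonResonant.bOne_ne_zero (h : NonResonant a b q) (j : Fin (n + 1)) : bOne b j ≠ 0 := by
  refine Fin.cases one_ne_zero (fun j => h.b_ne_zero j) j

theorem NonResonant.bOne_div_bOne (h : NonResonant a b q) {i j : Fin (n + 1)} (hij : i ≠ j)
    (k : ℤ) : bOne b i / bOne b j ≠ q ^ k := by
  have hq := h.q_ne_zero
  revert hij
  refine Fin.cases ?_ (fun i => ?_) i <;> refine Fin.cases ?_ (fun j => ?_) j
  · exact fun h => absurd rfl h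
  · intro _ hk
    apply h.b_ne_zpow j (-k)
    rw [bOne_zero, bOne_succ, one_div] at hk
    rw [_root_.zpow_neg, ← hk, inv_inv]
  · intro _ hk
    apply h.b_ne_zpow i k
    rw [← hk, bOne_zero, bOne_succ, div_one]
  · exact fun hij => h.b_div_b i.succ j.succ hij k

/-- The common index set for the poles: `N + 1` for the first parameter, `N` for the others. -/
def poleCount (N : ℕ) (j : Fin (n + 1)) : ℕ := if j = 0 then N + 1 else N

/-- Seen from the pole with index `(j, l)`, each progression splits at position `l` into a part in
base `q⁻¹` and a part in base `q`. -/
theorem NonResonant.prod_poles (h : NonResonant a b q) (N : ℕ) (j : Fin (n + 1)) (l : ℕ)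
    (hl : l < poleCount N j) :
    ∏ x ∈ (Finset.univ.sigma fun j : Fin (n + 1) => Finset.range (poleCount N j)).erase ⟨j, l⟩,
      (1 - bOne b x.1 * q ^ x.2 * (bOne b j * q ^ l)⁻¹) =
    ∏ i, if i = j then qPoch q⁻¹ q⁻¹ l * qPoch q q (poleCount N j - 1 - l) else
      qPoch (q⁻¹ * (bOne b i / bOne b j)) q⁻¹ l *
        qPoch (bOne b i / bOne b j) q (poleCount N i - l) := by
  have hq := h.q_ne_zero
  have hmem : (⟨j, l⟩ : Σ _ : Fin (n + 1), ℕ) ∈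
      (Finset.univ.sigma fun j : Fin (n + 1) => Finset.range (poleCount N j)) := by
    simpa using hl
  have hle : ∀ i : Fin (n + 1), l ≤ poleCount N i := by
    intro i
    unfold poleCount at hl ⊢
    split_ifs at hl ⊢ <;> omega
  have h1 : ∏ x ∈ (Finset.univ.sigma fun j : Fin (n + 1) => Finset.range (poleCount N j)).erase ⟨j, l⟩,
      (1 - bOne b x.1 * q ^ x.2 * (bOne b j * q ^ l)⁻¹) =
      ∏ x ∈ (Finset.univ.sigma fun j : Fin (n + 1) => Finset.range (poleCount N j)),
        (if x = ⟨j, l⟩ then 1 else 1 - bOne b x.1 * q ^ x.2 * (bOne b j * q ^ l)⁻¹) := by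
    rw [← Finset.mul_prod_erase _ _ hmem, if_pos rfl, one_mul]
    exact Finset.prod_congr rfl fun x hx => by rw [if_neg (Finset.ne_of_mem_erase hx)]
  rw [h1, Finset.prod_sigma]
  refine Finset.prod_congr rfl fun i _ => ?_
  have hj := h.bOne_ne_zero j
  by_cases hij : i = j
  · subst hij
    rw [if_pos rfl, ← prod_ite_one_sub_pow hq, show l + (poleCount N i - 1 - l) + 1 = poleCount N i by omega]
    refine Finset.prod_congr rfl fun f _ => ?_
    by_cases hf : f = l
    · subst hf; simp
    · rw [if_neg (by simpa using hf), if_neg hf, inv_pow]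
      field_simp
  · rw [if_neg hij, ← qPoch_split hq, show l + (poleCount N i - l) = poleCount N i from
      Nat.add_sub_cancel' (hle i)]
    refine Finset.prod_congr rfl fun f _ => ?_
    rw [if_neg (by simp [hij]), inv_pow]
    field_simp

/-- The numerator of the rational function whose residues give the quadratic relation. -/
def numerator (a : Fin (n + 1) → ℂ) (q : ℂ) (m N : ℕ) : Polynomial ℂ :=
  Polynomial.X ^ m * ∏ i, ∏ e ∈ Finset.range N, (1 - Polynomial.C (a i * q * q ^ e) * Polynomial.X)

theorem eval_numerator (m N : ℕ) (x : ℂ) :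
    (numerator a q m N).eval x = x ^ m * ∏ i, qPoch (a i * q * x) q N := by
  simp only [numerator, qPoch, Polynomial.eval_mul, Polynomial.eval_pow, Polynomial.eval_X,
    Polynomial.eval_prod, Polynomial.eval_sub, Polynomial.eval_one, Polynomial.eval_C]
  congr 1
  exact Finset.prod_congr rfl fun i _ => Finset.prod_congr rfl fun e _ => by ring

theorem natDegree_numerator_le (m N : ℕ) : (numerator a q m N).natDegree ≤ m + (n + 1) * N := by
  unfold numerator
  refine Polynomial.natDegree_mul_le.trans (add_le_add (by simp) ?_)
  refine (Polynomial.natDegree_prod_le _ _).trans ?_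
  have : ∀ i ∈ (Finset.univ : Finset (Fin (n + 1))), (∏ e ∈ Finset.range N,
      (1 - Polynomial.C (a i * q * q ^ e) * Polynomial.X)).natDegree ≤ N := by
    intro i _
    refine (Polynomial.natDegree_prod_le _ _).trans ?_
    refine (Finset.sum_le_card_nsmul _ _ 1 fun e _ => ?_).trans (by simp)
    refine (Polynomial.natDegree_sub_le _ _).trans ?_
    refine max_le (by simp) ((Polynomial.natDegree_C_mul_le _ _).trans Polynomial.natDegree_X_le)
  simpa using Finset.sum_le_card_nsmul _ _ N this

/-- The coefficients of the series at `q⁻¹`, with `b` replaced by `q⁻¹ b`. -/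
abbrev coefW (a : Fin (n + 1) → ℂ) (b : Fin n → ℂ) (q : ℂ) (j : Fin (n + 1)) : ℕ → ℂ :=
  coefPhi (upper a (fun i => q⁻¹ * b i) q⁻¹ j) (lower (fun i => q⁻¹ * b i) q⁻¹ j) q⁻¹

/-- The residues in the progression of `bOne b 0 = 1` are products of a coefficient of the first
series at `q⁻¹` and one at `q`. The factor `∏ (1 - a_i)` makes up for the factors that the two
numerators have in common. -/
theorem NonResonant.term_zero (h : NonResonant a b q) (N m l : ℕ) (hN : 1 ≤ N) (hl : l < N + 1) :
    (∏ i, (1 - a i)) * ((bOne b 0 * q ^ l)⁻¹ * (numerator a q m (N - 1)).eval (bOne b 0 * q ^ l)⁻¹ /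
      ∏ i, if i = (0 : Fin (n + 1)) then qPoch q⁻¹ q⁻¹ l * qPoch q q (poleCount N (0 : Fin (n + 1)) - 1 - l) else
        qPoch (q⁻¹ * (bOne b i / bOne b 0)) q⁻¹ l *
          qPoch (bOne b i / bOne b 0) q (poleCount N i - l)) =
    (q⁻¹ ^ l) ^ (m + 1) * (coefW a b q 0 l * coefPhi (upper a b q 0) (lower b q 0) q (N - l)) := by
  have hq := h.q_ne_zero
  rw [eval_numerator]
  have hden : (∏ i, if i = (0 : Fin (n + 1)) then qPoch q⁻¹ q⁻¹ l * qPoch q q (poleCount N (0 : Fin (n + 1)) - 1 - l) else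
        qPoch (q⁻¹ * (bOne b i / bOne b 0)) q⁻¹ l *
          qPoch (bOne b i / bOne b 0) q (poleCount N i - l)) =
      ∏ i, qPoch (lower (fun i => q⁻¹ * b i) q⁻¹ 0 i) q⁻¹ l * qPoch (lower b q 0 i) q (N - l) := by
    refine Finset.prod_congr rfl fun i _ => ?_
    refine Fin.cases ?_ (fun i => ?_) i
    · simp [poleCount, lower, hq]
    · rw [if_neg (Fin.succ_ne_zero i)]
      have e : q⁻¹ * (q⁻¹ * b i) / q⁻¹ = q⁻¹ * b i := by field_simp
      simp only [poleCount, lower, bOne_succ, bOne_zero, div_one, bFull_succ, bFull_zero, e,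
        mul_div_cancel_left₀ _ hq, if_neg (Fin.succ_ne_zero i)]
  have hnum : (∏ i, (1 - a i)) * ∏ i, qPoch (a i * q * (bOne b 0 * q ^ l)⁻¹) q (N - 1) =
      ∏ i, qPoch (upper a (fun i => q⁻¹ * b i) q⁻¹ 0 i) q⁻¹ l * qPoch (upper a b q 0 i) q (N - l) := by
    rw [← Finset.prod_mul_distrib]
    refine Finset.prod_congr rfl fun i _ => ?_
    have := qPoch_mul_qPoch_inv hq (a i) (N - l) l (by omega)
    rw [show N - l + l - 1 = N - 1 by omega] at this
    simp only [upper, bOne_zero, one_mul, bFull_zero]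
    rw [mul_div_cancel_left₀ _ hq, mul_div_cancel_left₀ _ (inv_ne_zero hq)]
    rw [inv_pow] at this
    linear_combination -this
  rw [hden]
  simp only [coefW, coefPhi]
  rw [← Finset.prod_mul_distrib]
  simp only [div_mul_div_comm]
  rw [Finset.prod_div_distrib, ← hnum]
  simp only [bOne_zero, one_mul, inv_pow]
  ring

/-- In the other progressions the numerators split without overlap. The denominators leave the extra
factors `1 - q / b_j` and `1 - b_i / b_j`, which make up `pairC`. The indices of the two
coefficients add up to `N - 1` instead of `N`, whence the factor `t` in the quadratic relation. -/
theorem NonResonant.term_succ (h : NonResonant a b q) (N m l : ℕ) (j : Fin n) (hl : l < N) :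
    (∏ i, (1 - a i)) * ((bOne b j.succ * q ^ l)⁻¹ *
      (numerator a q m (N - 1)).eval (bOne b j.succ * q ^ l)⁻¹ /
      ∏ i, if i = j.succ then qPoch q⁻¹ q⁻¹ l * qPoch q q (poleCount N j.succ - 1 - l) else
        qPoch (q⁻¹ * (bOne b i / bOne b j.succ)) q⁻¹ l *
          qPoch (bOne b i / bOne b j.succ) q (poleCount N i - l)) =
    pairC a b q j * (b j)⁻¹ ^ (m + 1) * (q⁻¹ ^ l) ^ (m + 1) *
      (coefW a b q j.succ l * coefPhi (upper a b q j.succ) (lower b q j.succ) q (N - 1 - l)) := by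
  have hq := h.q_ne_zero
  have hbj := h.b_ne_zero j
  obtain ⟨k, rfl⟩ : ∃ k, N = l + k + 1 := ⟨N - 1 - l, by omega⟩
  rw [eval_numerator]
  have hden : (∏ i, if i = j.succ then
        qPoch q⁻¹ q⁻¹ l * qPoch q q (poleCount (l + k + 1) j.succ - 1 - l) else
        qPoch (q⁻¹ * (bOne b i / bOne b j.succ)) q⁻¹ l *
          qPoch (bOne b i / bOne b j.succ) q (poleCount (l + k + 1) i - l)) =
      ((1 - q / b j) * ∏ i, (if i = j.succ then 1 else 1 - bOne b i / b j)) *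
      ∏ i, qPoch (lower (fun i => q⁻¹ * b i) q⁻¹ j.succ i) q⁻¹ l * qPoch (lower b q j.succ i) q k := by
    have hone : ∏ i, (if i = (0 : Fin (n + 1)) then (1 - q / b j) else 1) = 1 - q / b j := by simp
    rw [← hone, ← Finset.prod_mul_distrib, ← Finset.prod_mul_distrib]
    refine Finset.prod_congr rfl fun i _ => ?_
    by_cases hij : i = j.succ
    · subst hij
      have h0 : j.succ ≠ 0 := Fin.succ_ne_zero j
      simp only [if_true, if_neg h0, one_mul, poleCount, lower, bFull_succ]
      rw [mul_div_cancel_right₀ _ hbj, mul_div_cancel_right₀ _ (mul_ne_zero (inv_ne_zero hq) hbj),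
        show l + k + 1 - 1 - l = k by omega]
    · rw [if_neg hij, if_neg hij]
      revert hij
      refine Fin.cases ?_ (fun i => ?_) i
      · intro _
        simp only [if_true, poleCount, lower, bFull_succ, bFull_zero, bOne_zero, bOne_succ]
        rw [show l + k + 1 + 1 - l = k + 1 + 1 by omega, qPoch_succ', qPoch_succ']
        have e1 : q⁻¹ * q⁻¹ / (q⁻¹ * b j) = q⁻¹ * (1 / b j) := by field_simp
        have e2 : q * q / b j = q * (q * (1 / b j)) := by ring
        rw [e1, e2]
        ring
      · intro hij
        have h0 : i.succ ≠ 0 := Fin.succ_ne_zero i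
        simp only [if_neg h0, poleCount, lower, bFull_succ, bOne_succ]
        rw [show l + k + 1 - l = k + 1 by omega, qPoch_succ']
        have e1 : q⁻¹ * (q⁻¹ * b i) / (q⁻¹ * b j) = q⁻¹ * (b i / b j) := by field_simp
        have e2 : q * b i / b j = q * (b i / b j) := by ring
        rw [e1, e2]
        ring
  have hnum : ∏ i, qPoch (a i * q * (bOne b j.succ * q ^ l)⁻¹) q (l + k + 1 - 1) =
      ∏ i, qPoch (upper a (fun i => q⁻¹ * b i) q⁻¹ j.succ i) q⁻¹ l * qPoch (upper a b q j.succ i) q k := by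
    refine Finset.prod_congr rfl fun i _ => ?_
    have := qPoch_split hq (q * a i / b j) l k
    simp only [upper, bOne_succ, bFull_succ]
    rw [show q⁻¹ * a i / (q⁻¹ * b j) = q⁻¹ * (q * a i / b j) by field_simp, ← this,
      show l + k + 1 - 1 = l + k by omega, inv_pow]
    congr 1
    field_simp
  rw [hden, hnum, show l + k + 1 - 1 - l = k by omega]
  simp only [coefW, coefPhi, pairC]
  rw [← Finset.prod_mul_distrib]
  simp only [div_mul_div_comm]
  rw [Finset.prod_div_distrib]
  simp only [bOne_succ]
  generalize (∏ i, qPoch (upper a (fun i => q⁻¹ * b i) q⁻¹ j.succ i) q⁻¹ l *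
    qPoch (upper a b q j.succ i) q k) = X
  generalize (∏ i, qPoch (lower (fun i => q⁻¹ * b i) q⁻¹ j.succ i) q⁻¹ l *
    qPoch (lower b q j.succ i) q k) = Y
  generalize ((1 - q / b j) * ∏ i, (if i = j.succ then 1 else 1 - bOne b i / b j)) = Z
  generalize (∏ i, (1 - a i)) = W
  rw [inv_pow q, mul_inv]
  generalize (q ^ l)⁻¹ = u
  generalize (b j)⁻¹ = v
  ring

/-- The residue theorem for `x^m ∏_i (a_i q x; q)_N / ∏ (1 - c x)`, where `c` runs through `q^l` for
`l ≤ N + 1` and `b_j q^l` for `l ≤ N`. -/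
theorem NonResonant.coef_relation (h : NonResonant a b q) (m N : ℕ) (hm : m ≤ n) :
    ∑ l ∈ Finset.range (N + 2), coefW a b q 0 l *
        (coefPhi (upper a b q 0) (lower b q 0) q (N + 1 - l) * (q ^ (m + 1)) ^ (N + 1 - l)) +
      ∑ j : Fin n, pairC a b q j * (q / b j) ^ (m + 1) *
        ∑ l ∈ Finset.range (N + 1), coefW a b q j.succ l *
          (coefPhi (upper a b q j.succ) (lower b q j.succ) q (N - l) * (q ^ (m + 1)) ^ (N - l)) = 0 := by
  have hq := h.q_ne_zero
  set s : Finset (Σ _ : Fin (n + 1), ℕ) :=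
    Finset.univ.sigma fun j : Fin (n + 1) => Finset.range (poleCount (N + 1) j) with hs
  have hinj : Set.InjOn (fun x : Σ _ : Fin (n + 1), ℕ => bOne b x.1 * q ^ x.2) s := by
    rintro ⟨i, e⟩ _ ⟨j, f⟩ _ hx
    simp only at hx
    have hi := h.bOne_ne_zero i
    have hj := h.bOne_ne_zero j
    by_cases hij : i = j
    · subst hij
      have hx' := mul_left_cancel₀ hi hx
      have : e = f := by
        by_contra hne
        apply zpow_ne_one_of_norm h.norm_q_ne_one (k := (e : ℤ) - f) (by omega)
        rw [zpow_sub₀ hq, zpow_natCast, zpow_natCast, hx', div_self (pow_ne_zero _ hq)]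
      rw [this]
    · exfalso
      apply h.bOne_div_bOne hij ((f : ℤ) - e)
      rw [zpow_sub₀ hq, zpow_natCast, zpow_natCast, div_eq_div_iff hj (pow_ne_zero _ hq), hx]
      ring
  have hcard : s.card = (N + 2) + n * (N + 1) := by
    rw [hs, Finset.card_sigma, Fin.sum_univ_succ]
    simp [poleCount]
  -- There are `(n + 1) (N + 1) + 1` poles and the numerator has degree at most `m + (n + 1) N`, so
  -- the degree condition amounts to `m ≤ n`.
  have hdeg : (numerator a q m (N + 1 - 1)).natDegree + 2 ≤ s.card := by
    have := natDegree_numerator_le (a := a) (q := q) m (N + 1 - 1)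
    rw [hcard]
    rw [Nat.add_sub_cancel] at this ⊢
    nlinarith
  have key := sum_eval_div_prod_one_sub s (fun x => bOne b x.1 * q ^ x.2)
    (fun x _ => mul_ne_zero (h.bOne_ne_zero _) (pow_ne_zero _ hq)) hinj _ hdeg
  rw [hs, Finset.sum_sigma, Fin.sum_univ_succ] at key
  -- The factor `(q ^ (N + 1)) ^ (m + 1)` changes the powers of `q⁻¹ ^ l` in the residues into the
  -- powers of `q ^ (m + 1)` that come from the argument `q ^ (m + 1) * t`.
  have key2 := congrArg (fun z => (q ^ (N + 1)) ^ (m + 1) * ((∏ i, (1 - a i)) * z)) key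
  simp only [mul_zero, mul_add, Finset.mul_sum] at key2
  rw [← key2]
  congr 1
  · have hp : poleCount (N + 1) (0 : Fin (n + 1)) = N + 2 := by simp [poleCount]
    rw [hp]
    refine Finset.sum_congr rfl fun l hl => ?_
    have hl' := Finset.mem_range.1 hl
    rw [h.prod_poles (N + 1) 0 l (by rw [hp]; exact hl'), h.term_zero (N + 1) m l (by omega) hl']
    obtain ⟨k, hk⟩ : ∃ k, N + 1 = l + k := ⟨N + 1 - l, by omega⟩
    have h1 : (q ^ (l + k)) ^ (m + 1) = (q ^ (m + 1)) ^ k * (q ^ l) ^ (m + 1) := by ring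
    have := pow_ne_zero (m + 1) (pow_ne_zero l hq)
    rw [hk, Nat.add_sub_cancel_left, h1, inv_pow q, inv_pow (q ^ l), mul_assoc ((q ^ (m + 1)) ^ k),
      mul_inv_cancel_left₀ this]
    ring
  · refine Finset.sum_congr rfl fun j _ => ?_
    have hp : poleCount (N + 1) j.succ = N + 1 := by simp [poleCount]
    rw [hp, Finset.mul_sum]
    refine Finset.sum_congr rfl fun l hl => ?_
    have hl' := Finset.mem_range.1 hl
    rw [h.prod_poles (N + 1) j.succ l (by rw [hp]; exact hl'), h.term_succ (N + 1) m l j hl']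
    obtain ⟨k, hk⟩ : ∃ k, N = l + k := ⟨N - l, by omega⟩
    subst hk
    rw [show l + k + 1 - 1 - l = k by omega, show l + k - l = k by omega, div_eq_mul_inv, mul_pow q]
    have h1 : (q ^ (l + k + 1)) ^ (m + 1) = q ^ (m + 1) * (q ^ (m + 1)) ^ k * (q ^ l) ^ (m + 1) := by ring
    rw [h1, inv_pow q]
    have := pow_ne_zero (m + 1) (pow_ne_zero l hq)
    rw [inv_pow (q ^ l)]
    field_simp

/-- Inverting the base inverts theta, so the two quotients cancel up to monomials. Replacing `b` by
`q⁻¹ b` at `q⁻¹` makes the arguments `b_j t` and `q⁻¹ b_j t` differ by one quasi-period; the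
remaining monomial is `-t`. -/
theorem NonResonant.prefactor_mul_prefactor (h : NonResonant a b q) (j : Fin n) {t : ℂ} (ht : t ≠ 0)
    (h1 : ∀ k : ℤ, t ≠ q ^ k) (h2 : ∀ k : ℤ, b j * t ≠ q ^ k) :
    prefactor (fun i => q⁻¹ * b i) q⁻¹ j.succ t * prefactor b q j.succ t = -t := by
  have hq := h.q_ne_zero
  have hb := h.b_ne_zero j
  have h3 : ∀ k : ℤ, q⁻¹ * b j * t ≠ q ^ k := fun k hk => h2 (k + 1) (by
    rw [zpow_add_one₀ hq, ← hk]; field_simp)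
  have h4 : ∀ k : ℤ, q⁻¹⁻¹ * (q⁻¹ * b j) * t ≠ q ^ k := fun k hk => h2 k (by
    rw [← hk, inv_inv, mul_inv_cancel_left₀ hq])
  have e1 := theta_ne_zero hq h.norm_q_ne_one h1
  have e2 := theta_ne_zero hq h.norm_q_ne_one h3
  unfold prefactor
  rw [bFull_succ, bFull_succ, theta_inv_right hq h.norm_q_ne_one h1,
    theta_inv_right hq h.norm_q_ne_one h4, theta_inv_left hq h.norm_q_ne_one ht h1, inv_inv,
    mul_inv_cancel_left₀ hq, theta_inv_left hq h.norm_q_ne_one (mul_ne_zero hb ht) h2,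
    show b j * t = q * (q⁻¹ * b j * t) by field_simp,
    theta_mul_q hq h.norm_q_ne_one (by positivity) h3]
  generalize theta (q⁻¹ * b j * t) q = x at e2 ⊢
  generalize theta t q = y at e1 ⊢
  field_simp

/-- Infinite symbols in base `q⁻¹` and `q` cancel in pairs up to finitely many factors, and the
theta functions in the two denominators multiply to `1`. -/
theorem NonResonant.constB_mul_constB (h : NonResonant a b q) (j : Fin n) :
    constB a (fun i => q⁻¹ * b i) q⁻¹ j.succ * constB a b q j.succ = pairC a b q j := by
  have hq := h.q_ne_zero
  have hq1 := h.norm_q_ne_one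
  have hb := h.b_ne_zero j
  have hbj := h.b_ne_zpow j
  have hbq : ∀ k : ℤ, q⁻¹ * b j ≠ q ^ k := fun k hk => hbj (k + 1) (by
    rw [zpow_add_one₀ hq, ← hk]; field_simp)
  have hqq := qPochInf_self_ne_zero hq hq1
  have hθ : theta (q⁻¹⁻¹ * (q⁻¹ * b j)) q⁻¹ * theta (q⁻¹ * b j) q = 1 := by
    have e := theta_ne_zero hq hq1 hbq
    rw [inv_inv, mul_inv_cancel_left₀ hq, theta_inv_right hq hq1 hbj, theta_inv_left hq hq1 hb hbj]
    have : theta (b j) q = theta (q * (q⁻¹ * b j)) q := by rw [mul_inv_cancel_left₀ hq]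
    rw [this, theta_mul_q hq hq1 (by positivity) hbq]
    generalize theta (q⁻¹ * b j) q = x at e ⊢
    field_simp
  have hprod : (∏ i, qPochInf (a i) q⁻¹ * qPochInf (q⁻¹ * bFull (fun i => q⁻¹ * b i) q⁻¹ i / (q⁻¹ * b j)) q⁻¹ /
      (qPochInf (q⁻¹ * a i / (q⁻¹ * b j)) q⁻¹ * qPochInf (bFull (fun i => q⁻¹ * b i) q⁻¹ i) q⁻¹)) *
      (∏ i, qPochInf (a i) q * qPochInf (q * bFull b q i / b j) q /
      (qPochInf (q * a i / b j) q * qPochInf (bFull b q i) q)) = pairC a b q j := by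
    -- The index `0` contributes one factor more than the others: between base `q` and base `q⁻¹`
    -- the parameter `b₀` goes from `q` to `q⁻¹`, two steps, while the other `b_i` move by one.
    have hone : ∏ i, (if i = (0 : Fin (n + 1)) then (1 - q / b j) else 1) = 1 - q / b j := by simp
    unfold pairC
    rw [← hone, ← Finset.prod_mul_distrib, ← Finset.prod_mul_distrib, ← Finset.prod_div_distrib]
    refine Finset.prod_congr rfl fun i _ => ?_
    have ha0 : a i ≠ 1 := by simpa using h.a_ne_zpow i 0
    have ha1 : a i ≠ q := by simpa using h.a_ne_zpow i 1
    have ha2 : a i ≠ q⁻¹ := by simpa using h.a_ne_zpow i (-1)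
    have hab := h.a_div_b i j.succ
    rw [bFull_succ] at hab
    have hqa : qPochInf (q * a i) q ≠ 0 := qPochInf_ne_zero hq hq1 fun k hk =>
      h.a_ne_zpow i (k - 1) (by rw [zpow_sub_one₀ hq, ← hk]; field_simp)
    have hqab : qPochInf (q * (a i / b j)) q ≠ 0 := qPochInf_ne_zero hq hq1 fun k hk =>
      hab (k - 1) (by rw [zpow_sub_one₀ hq, ← hk]; field_simp)
    have hua : qPochInf (a i) q⁻¹ * qPochInf (a i) q = 1 - a i := by
      rw [qPochInf_inv_right hq hq1 ha0 ha2, qPochInf_eq_mul hq hq1 ha0 ha1]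
      field_simp
    have hub : qPochInf (q⁻¹ * a i / (q⁻¹ * b j)) q⁻¹ * qPochInf (q * a i / b j) q = 1 := by
      rw [mul_div_mul_left _ _ (inv_ne_zero hq), qPochInf_inv_right hq hq1 (by simpa using hab 0)
        (by simpa using hab (-1)), mul_div_assoc, inv_mul_cancel₀ hqab]
    have hlow : qPochInf (q⁻¹ * bFull (fun i => q⁻¹ * b i) q⁻¹ i / (q⁻¹ * b j)) q⁻¹ *
        qPochInf (q * bFull b q i / b j) q *
        ((if i = 0 then (1 - q / b j) else 1) * (if i = j.succ then 1 else 1 - bOne b i / b j)) =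
        qPochInf (bFull (fun i => q⁻¹ * b i) q⁻¹ i) q⁻¹ * qPochInf (bFull b q i) q := by
      rw [mul_div_mul_left _ _ (inv_ne_zero hq)]
      refine Fin.cases ?_ (fun i => ?_) i
      · rw [bFull_zero, bFull_zero, if_pos rfl, if_neg (Fin.succ_ne_zero j).symm, bOne_zero,
          qPochInf_inv_inv hq hq1, inv_mul_cancel₀ hqq]
        have hx : ∀ k : ℤ, 1 / b j ≠ q ^ k := h.bOne_div_bOne (Fin.succ_ne_zero j).symm
        have hqx : ∀ k : ℤ, q / b j ≠ q ^ k := h.b_div_b 0 j.succ (Fin.succ_ne_zero j).symm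
        have h1 : q⁻¹ / b j ≠ 1 := fun h' => by
          apply hx 1; rw [zpow_one]; field_simp at h' ⊢; linear_combination h'
        have h2 : q⁻¹ / b j ≠ q⁻¹ := fun h' => by
          apply hx 0; rw [zpow_zero]; field_simp at h' ⊢; exact h'
        rw [qPochInf_inv_right hq hq1 h1 h2, show q * (q⁻¹ / b j) = 1 / b j by field_simp,
          qPochInf_eq_mul hq hq1 (x := 1 / b j) (by simpa using hx 0) (by simpa using hx 1),
          show q * (1 / b j) = q / b j by ring,
          qPochInf_eq_mul hq hq1 (x := q / b j) (by simpa using hqx 0) (by simpa using hqx 1),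
          mul_div_assoc]
        have e1 : qPochInf (q * (q / b j)) q ≠ 0 := qPochInf_ne_zero hq hq1 fun k hk =>
          hqx (k - 1) (by rw [zpow_sub_one₀ hq, ← hk]; field_simp)
        have e2 := sub_ne_zero.2 (show 1 / b j ≠ 1 by simpa using hx 0).symm
        have e3 := sub_ne_zero.2 (show q / b j ≠ 1 by simpa using hqx 0).symm
        generalize qPochInf (q * (q / b j)) q = z at e1 ⊢
        generalize 1 / b j = x at e2 ⊢
        generalize q / b j = y at e3 ⊢
        field_simp
      · rw [bFull_succ, bFull_succ, if_neg (Fin.succ_ne_zero i), one_mul, bOne_succ]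
        have hbi := h.b_ne_zpow i
        have e1 : qPochInf (b i) q ≠ 0 := qPochInf_ne_zero hq hq1 hbi
        have e2 : qPochInf (q⁻¹ * b i) q⁻¹ * qPochInf (b i) q = 1 := by
          rw [qPochInf_inv_right hq hq1, mul_inv_cancel_left₀ hq, inv_mul_cancel₀ e1]
          · intro h'; apply hbi 1; rw [zpow_one]; field_simp at h'; exact h'
          · intro h'; apply hbi 0; rw [zpow_zero]; field_simp at h'; exact h'
        rw [e2]
        by_cases hij : i = j
        · subst hij
          rw [if_pos rfl, mul_one, mul_div_cancel_right₀ _ hb, mul_div_cancel_right₀ _ hb,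
            qPochInf_inv_inv hq hq1, inv_mul_cancel₀ hqq]
        · have hij' : i.succ ≠ j.succ := fun h' => hij (Fin.succ_injective _ h')
          rw [if_neg hij']
          have hx : ∀ k : ℤ, b i / b j ≠ q ^ k := h.b_div_b i.succ j.succ hij'
          have h1 : q⁻¹ * b i / b j ≠ 1 := fun h' => by
            apply hx 1; rw [zpow_one]; field_simp at h' ⊢; exact h'
          have h2 : q⁻¹ * b i / b j ≠ q⁻¹ := fun h' => by
            apply hx 0; rw [zpow_zero]; field_simp at h' ⊢; exact h'
          rw [qPochInf_inv_right hq hq1 h1 h2, show q * (q⁻¹ * b i / b j) = b i / b j by field_simp,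
            qPochInf_eq_mul hq hq1 (x := b i / b j) (by simpa using hx 0) (by simpa using hx 1),
            mul_div_assoc]
          have e3 : qPochInf (q * (b i / b j)) q ≠ 0 := qPochInf_ne_zero hq hq1 fun k hk =>
            hx (k - 1) (by rw [zpow_sub_one₀ hq, ← hk]; field_simp)
          have e4 := sub_ne_zero.2 (show b i / b j ≠ 1 by simpa using hx 0).symm
          generalize qPochInf (q * (b i / b j)) q = z at e3 ⊢
          generalize b i / b j = x at e4 ⊢
          field_simp
    have hne : qPochInf (bFull (fun i => q⁻¹ * b i) q⁻¹ i) q⁻¹ * qPochInf (bFull b q i) q ≠ 0 := by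
      refine Fin.cases ?_ (fun i => ?_) i
      · rw [bFull_zero, bFull_zero, qPochInf_inv_inv hq hq1, inv_mul_cancel₀ hqq]
        exact one_ne_zero
      · have hbi := h.b_ne_zpow i
        refine mul_ne_zero (qPochInf_ne_zero (inv_ne_zero hq) (by rw [norm_inv]; simpa using hq1) ?_)
          (qPochInf_ne_zero hq hq1 hbi)
        intro k hk
        apply hbi (1 - k)
        rw [bFull_succ, _root_.inv_zpow'] at hk
        rw [sub_eq_add_neg, zpow_add₀ hq, zpow_one, ← hk, mul_inv_cancel_left₀ hq]
    have hfac : ((if i = 0 then (1 - q / b j) else 1) *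
        (if i = j.succ then 1 else 1 - bOne b i / b j)) ≠ 0 := by
      intro h0
      rw [h0, mul_zero] at hlow
      exact hne hlow.symm
    rw [div_mul_div_comm, div_eq_div_iff ?_ hfac]
    · linear_combination (qPochInf (a i) q⁻¹ * qPochInf (a i) q) * hlow +
        (qPochInf (bFull (fun i => q⁻¹ * b i) q⁻¹ i) q⁻¹ * qPochInf (bFull b q i) q) * hua -
        (1 - a i) * (qPochInf (bFull (fun i => q⁻¹ * b i) q⁻¹ i) q⁻¹ * qPochInf (bFull b q i) q) * hub
    · have : qPochInf (q⁻¹ * a i / (q⁻¹ * b j)) q⁻¹ *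
          qPochInf (bFull (fun i => q⁻¹ * b i) q⁻¹ i) q⁻¹ *
          (qPochInf (q * a i / b j) q * qPochInf (bFull b q i) q) =
          (qPochInf (q⁻¹ * a i / (q⁻¹ * b j)) q⁻¹ * qPochInf (q * a i / b j) q) *
          (qPochInf (bFull (fun i => q⁻¹ * b i) q⁻¹ i) q⁻¹ * qPochInf (bFull b q i) q) := by ring
      rw [this, hub, one_mul]
      exact hne
  unfold constB
  rw [if_neg (Fin.succ_ne_zero j), if_neg (Fin.succ_ne_zero j)]
  simp only [bFull_succ]
  rw [mul_mul_mul_comm, hprod, div_mul_div_comm, hθ, qPochInf_inv_inv hq hq1, ← mul_pow,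
    inv_mul_cancel₀ hqq]
  simp

/-- The signs `(1, -1, …, -1)`. -/
def sgn (j : Fin (n + 1)) : ℂ := if j = 0 then 1 else -1

theorem hasSum_mul_of_hasSum {c d : ℕ → ℂ} {u : ℂ} {t x y : ℂ} (hc : HasSum (fun k => c k * t ^ k) x)
    (hd : HasSum (fun k => d k * (u * t) ^ k) y) :
    HasSum (fun N => (∑ l ∈ Finset.range (N + 1), c l * (d (N - l) * u ^ (N - l))) * t ^ N) (x * y) := by
  have h1 := hc.summable.norm
  have h2 := hd.summable.norm
  have h3 := summable_norm_sum_mul_antidiagonal_of_summable_norm h1 h2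
  have h4 := tsum_mul_tsum_eq_tsum_sum_antidiagonal_of_summable_norm h1 h2
  rw [hc.tsum_eq, hd.tsum_eq] at h4
  rw [h4]
  refine h3.of_norm.hasSum.congr_fun fun N => ?_
  rw [Finset.Nat.sum_antidiagonal_eq_sum_range_succ_mk, Finset.sum_mul]
  refine Finset.sum_congr rfl fun l hl => ?_
  obtain ⟨k, rfl⟩ := Nat.exists_eq_add_of_le (Finset.mem_range_succ_iff.1 hl)
  simp only [Nat.add_sub_cancel_left]
  ring

/-- As power series, the term with `j = 0` begins with `1`, and the other terms carry the factor
`-t` from the theta quotients. All higher coefficients cancel by `NonResonant.coef_relation`. -/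
theorem NonResonant.sol_pairing (h : NonResonant a b q) (m : ℕ) (hm : m ≤ n) : ∀ᶠ t in gen,
    ∑ j, sgn j * sol a (fun i => q⁻¹ * b i) q⁻¹ j t * sol a b q j (q ^ (m + 1) * t) = 1 := by
  have hq := h.q_ne_zero
  have hw : NonResonant a (fun i => q⁻¹ * b i) q⁻¹ := by
    have := h.inv.shift 0 (fun _ => 1)
    simpa using this
  set φ : Fin (n + 1) → ℂ → ℂ := fun j => phi (upper a b q j) (lower b q j) q with hφ
  set ψ : Fin (n + 1) → ℂ → ℂ := fun j =>
    phi (upper a (fun i => q⁻¹ * b i) q⁻¹ j) (lower (fun i => q⁻¹ * b i) q⁻¹ j) q⁻¹ with hψ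
  have hmer : ∀ j, Meromorphic fun t => ψ j t * φ j (q ^ (m + 1) * t) := fun j =>
    (hw.regular j).meromorphic_phi.fun_mul ((h.regular j).meromorphic_phi_mul _)
  have hgen : ∀ᶠ t in gen, ψ 0 t * φ 0 (q ^ (m + 1) * t) =
      1 - t * ∑ j : Fin n, pairC a b q j * (q / b j) ^ (m + 1) *
        (ψ j.succ t * φ j.succ (q ^ (m + 1) * t)) := by
    refine eventually_gen_eq (hmer 0) ((Meromorphic.const 1).fun_sub
      (Meromorphic.fun_mul (f := fun t : ℂ => t) (fun t => analyticAt_id.meromorphicAt)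
        (Meromorphic.fun_sum fun j _ => (Meromorphic.const _).fun_mul (hmer j.succ)))) ?_
    have hev : ∀ᶠ t in 𝓝 (0 : ℂ), ∀ j, HasSum (fun N => (∑ l ∈ Finset.range (N + 1),
        coefW a b q j l * (coefPhi (upper a b q j) (lower b q j) q (N - l) *
          (q ^ (m + 1)) ^ (N - l))) * t ^ N) (ψ j t * φ j (q ^ (m + 1) * t)) := by
      rw [eventually_all]
      intro j
      filter_upwards [(hw.regular j).hasSum_phi 1, (h.regular j).hasSum_phi (q ^ (m + 1))] with t h1 h2
      rw [one_mul] at h1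
      exact hasSum_mul_of_hasSum h1 h2
    filter_upwards [hev] with t ht
    -- The constant term `1` is split off, so that the coefficient of `t ^ (N + 1)` here faces the
    -- coefficients of `t ^ N` in the products with `j > 0`.
    have h0 := (hasSum_nat_add_iff (f := fun N => (∑ l ∈ Finset.range (N + 1),
        coefW a b q 0 l * (coefPhi (upper a b q 0) (lower b q 0) q (N - l) *
          (q ^ (m + 1)) ^ (N - l))) * t ^ N) (g := ψ 0 t * φ 0 (q ^ (m + 1) * t) - 1) 1).2 (by
            simpa [coefPhi_zero] using ht 0)
    have h1 := (hasSum_sum (s := (Finset.univ : Finset (Fin n))) fun j _ => (ht j.succ).mul_left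
      (pairC a b q j * (q / b j) ^ (m + 1))).mul_left (-t)
    have h2 := h0.unique (h1.congr_fun fun N => ?_)
    · linear_combination h2
    · have := h.coef_relation m N hm
      rw [add_eq_zero_iff_eq_neg] at this
      rw [show N + 1 + 1 = N + 2 from rfl, this, neg_mul, neg_mul, Finset.sum_mul, Finset.mul_sum]
      congr 1
      refine Finset.sum_congr rfl fun j _ => ?_
      ring
  filter_upwards [hgen, h.eventually_ne_zpow] with t ht hne
  have hz : sol a (fun i => q⁻¹ * b i) q⁻¹ 0 t * sol a b q 0 (q ^ (m + 1) * t) =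
      ψ 0 t * φ 0 (q ^ (m + 1) * t) := by
    rw [sol_eq, sol_eq, h.prefactor_pow_mul 0 hne.1 hne.2.1 (hne.2.2 0)]
    have e1 : prefactor b q 0 t = 1 := by
      unfold prefactor
      rw [bFull_zero, inv_mul_cancel₀ hq, one_mul]
      exact div_self (theta_ne_zero hq h.norm_q_ne_one hne.2.1)
    have e2 : prefactor (fun i => q⁻¹ * b i) q⁻¹ 0 t = 1 := by
      unfold prefactor
      rw [bFull_zero, inv_mul_cancel₀ (inv_ne_zero hq), one_mul]
      refine div_self (theta_ne_zero (inv_ne_zero hq) hw.norm_q_ne_one fun k hk => ?_)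
      rw [_root_.inv_zpow'] at hk
      exact hne.2.1 _ hk
    rw [e1, e2, bFull_zero, div_self hq]
    simp [constB, hφ, hψ]
  have hs : ∀ j : Fin n, sol a (fun i => q⁻¹ * b i) q⁻¹ j.succ t * sol a b q j.succ (q ^ (m + 1) * t) =
      -t * (pairC a b q j * (q / b j) ^ (m + 1) * (ψ j.succ t * φ j.succ (q ^ (m + 1) * t))) := by
    intro j
    have e1 := h.prefactor_mul_prefactor j hne.1 hne.2.1 (hne.2.2 j.succ)
    have e2 := h.constB_mul_constB j
    rw [sol_eq, sol_eq, h.prefactor_pow_mul j.succ hne.1 hne.2.1 (hne.2.2 j.succ), ← e1, ← e2, bFull_succ]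
    ring
  rw [Fin.sum_univ_succ]
  have e0 : sgn (0 : Fin (n + 1)) = 1 := rfl
  have es : ∀ j : Fin n, sgn j.succ = -1 := fun j => if_neg (Fin.succ_ne_zero j)
  simp only [e0, es, one_mul, neg_mul]
  rw [hz, ht]
  simp only [hs]
  rw [Finset.mul_sum, sub_add_eq_add_sub, sub_eq_iff_eq_add, add_right_inj]
  refine Finset.sum_congr rfl fun j _ => by ring

end Pairing

/-! ### Evaluation of rational functions -/

section Values

variable {n : ℕ} {q : ℂ} {x : Var n → ℂ}

/-- The value of the Laurent monomial with exponent `m`. -/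
def monomialValue (q : ℂ) (x : Var n → ℂ) (m : Expo n) : ℂ := q ^ m.1 * ∏ v, x v ^ m.2 v

theorem monomialValue_zero : monomialValue q x (0 : Expo n) = 1 := by simp [monomialValue]

theorem monomialValue_add (hq : q ≠ 0) (hx : ∀ v, x v ≠ 0) (m m' : Expo n) :
    monomialValue q x (m + m') = monomialValue q x m * monomialValue q x m' := by
  simp only [monomialValue, Prod.fst_add, Prod.snd_add, Pi.add_apply, zpow_add₀ hq,
    zpow_add₀ (hx _), Finset.prod_mul_distrib]
  ring

/-- Evaluation of Laurent polynomials at nonzero complex numbers. -/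
def evalHom (hq : q ≠ 0) (hx : ∀ v, x v ≠ 0) : Laurent n →+* ℂ :=
  (AddMonoidAlgebra.lift ℚ ℂ (Expo n)
    { toFun := fun m => monomialValue q x m.toAdd
      map_one' := monomialValue_zero
      map_mul' := fun m m' => monomialValue_add hq hx m.toAdd m'.toAdd }).toRingHom

theorem evalHom_apply (hq : q ≠ 0) (hx : ∀ v, x v ≠ 0) (f : Laurent n) :
    evalHom hq hx f = evalLaurent q x f := by
  change AddMonoidAlgebra.lift ℚ ℂ (Expo n) _ f = _
  rw [AddMonoidAlgebra.lift_apply']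
  rfl

theorem evalHom_single (hq : q ≠ 0) (hx : ∀ v, x v ≠ 0) (m : Expo n) (c : ℚ) :
    evalHom hq hx (AddMonoidAlgebra.single m c) = c * monomialValue q x m := by
  change AddMonoidAlgebra.lift ℚ ℂ (Expo n) _ _ = _
  rw [AddMonoidAlgebra.lift_single, Algebra.smul_def]
  rfl

theorem laurent_hom_ext {f g : Laurent n →+* ℂ}
    (h : ∀ m, f (AddMonoidAlgebra.single m 1) = g (AddMonoidAlgebra.single m 1)) : f = g := by
  refine AddMonoidAlgebra.ringHom_ext (fun r => ?_) h
  exact DFunLike.congr_fun (Subsingleton.elim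
    (f.comp AddMonoidAlgebra.singleZeroRingHom) (g.comp AddMonoidAlgebra.singleZeroRingHom)) r

theorem evalLaurent_ne_zero {f : Laurent n} (h : evalLaurent q x f ≠ 0) :
    algebraMap (Laurent n) (RatField n) f ≠ 0 := by
  intro h0
  rw [FaithfulSMul.algebraMap_eq_zero_iff] at h0
  apply h
  simp [h0, evalLaurent]

/-- The pairs `(y, z)` such that `y` has value `z` at a given point. -/
def valueRing (hq : q ≠ 0) (hx : ∀ v, x v ≠ 0) : Subring (RatField n × ℂ) where
  carrier := {p | HasValue q x p.1 p.2}
  one_mem' := ⟨1, 1, by rw [← evalHom_apply hq hx, map_one]; exact one_ne_zero, by simp,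
    by rw [← evalHom_apply hq hx]; simp⟩
  zero_mem' := ⟨0, 1, by rw [← evalHom_apply hq hx, map_one]; exact one_ne_zero, by simp,
    by rw [← evalHom_apply hq hx]; simp⟩
  neg_mem' := by
    rintro p ⟨N, D, h0, h1, h2⟩
    refine ⟨-N, D, h0, ?_, ?_⟩
    · rw [Prod.fst_neg, h1, map_neg, neg_div]
    · rw [Prod.snd_neg, h2, ← evalHom_apply hq hx (-N), map_neg, neg_div, evalHom_apply]
  add_mem' := by
    rintro p p' ⟨N, D, h0, h1, h2⟩ ⟨N', D', h0', h1', h2'⟩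
    refine ⟨N * D' + D * N', D * D', ?_, ?_, ?_⟩
    · rw [← evalHom_apply hq hx, map_mul, evalHom_apply, evalHom_apply]
      exact mul_ne_zero h0 h0'
    · rw [Prod.fst_add, h1, h1', div_add_div _ _ (evalLaurent_ne_zero h0) (evalLaurent_ne_zero h0')]
      simp only [map_add, map_mul]
    · rw [Prod.snd_add, h2, h2', div_add_div _ _ h0 h0']
      simp only [← evalHom_apply hq hx, map_add, map_mul]
  mul_mem' := by
    rintro p p' ⟨N, D, h0, h1, h2⟩ ⟨N', D', h0', h1', h2'⟩
    refine ⟨N * N', D * D', ?_, ?_, ?_⟩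
    · rw [← evalHom_apply hq hx, map_mul, evalHom_apply, evalHom_apply]
      exact mul_ne_zero h0 h0'
    · rw [Prod.fst_mul, h1, h1', div_mul_div_comm]
      simp only [map_mul]
    · rw [Prod.snd_mul, h2, h2', div_mul_div_comm]
      simp only [← evalHom_apply hq hx, map_mul]

theorem mem_valueRing (hq : q ≠ 0) (hx : ∀ v, x v ≠ 0) {y : RatField n} {z : ℂ} :
    (y, z) ∈ valueRing hq hx ↔ HasValue q x y z := Iff.rfl

theorem HasValue.ne_zero {y : RatField n} {z : ℂ} (h : HasValue q x y z) (hz : z ≠ 0) : y ≠ 0 := by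
  obtain ⟨N, D, h0, h1, h2⟩ := h
  have hN : evalLaurent q x N ≠ 0 := by
    intro h'
    rw [h', zero_div] at h2
    exact hz h2
  rw [h1]
  exact div_ne_zero (evalLaurent_ne_zero hN) (evalLaurent_ne_zero h0)

theorem HasValue.inv {y : RatField n} {z : ℂ} (h : HasValue q x y z) (hz : z ≠ 0) :
    HasValue q x y⁻¹ z⁻¹ := by
  obtain ⟨N, D, h0, h1, h2⟩ := h
  have hN : evalLaurent q x N ≠ 0 := by
    intro h'
    rw [h', zero_div] at h2
    exact hz h2
  exact ⟨D, N, hN, by rw [h1, inv_div], by rw [h2, inv_div]⟩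

theorem hasValue_algebraMap (hq : q ≠ 0) (hx : ∀ v, x v ≠ 0) (f : Laurent n) :
    HasValue q x (algebraMap (Laurent n) (RatField n) f) (evalLaurent q x f) :=
  ⟨f, 1, by rw [← evalHom_apply hq hx, map_one]; exact one_ne_zero, by simp,
    by rw [← evalHom_apply hq hx 1]; simp⟩

theorem hasValue_qq (hq : q ≠ 0) (hx : ∀ v, x v ≠ 0) : HasValue q x (qq n) q := by
  have := hasValue_algebraMap hq hx (AddMonoidAlgebra.single (1, 0) 1)
  rwa [← evalHom_apply hq hx, evalHom_single, show monomialValue q x (1, 0) = q by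
    simp [monomialValue], Rat.cast_one, one_mul] at this

theorem hasValue_xx (hq : q ≠ 0) (hx : ∀ v, x v ≠ 0) (v : Var n) : HasValue q x (xx v) (x v) := by
  have := hasValue_algebraMap hq hx (AddMonoidAlgebra.single (0, Pi.single v 1) 1)
  rwa [← evalHom_apply hq hx, evalHom_single, show monomialValue q x (0, Pi.single v 1) = x v by
    simp only [monomialValue, zpow_zero, one_mul]
    rw [Finset.prod_eq_single v]
    · simp
    · intro w _ hw; simp [hw]
    · simp, Rat.cast_one, one_mul] at this

theorem evalLaurent_domCongr (hq : q ≠ 0) (hx : ∀ v, x v ≠ 0) {q' : ℂ} {x' : Var n → ℂ}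
    (hq' : q' ≠ 0) (hx' : ∀ v, x' v ≠ 0) (e : Expo n ≃+ Expo n)
    (he : ∀ m, monomialValue q x (e m) = monomialValue q' x' m) (f : Laurent n) :
    evalLaurent q x (AddMonoidAlgebra.domCongr ℚ ℚ e f) = evalLaurent q' x' f := by
  rw [← evalHom_apply hq hx, ← evalHom_apply hq' hx']
  have : (evalHom hq hx).comp (AddMonoidAlgebra.domCongr ℚ ℚ e).toAlgHom.toRingHom =
      evalHom hq' hx' := by
    apply laurent_hom_ext
    intro m
    change evalHom hq hx (AddMonoidAlgebra.domCongr ℚ ℚ e (AddMonoidAlgebra.single m 1)) = _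
    rw [AddMonoidAlgebra.domCongr_single, evalHom_single, evalHom_single, he]
  exact DFunLike.congr_fun this f

theorem monomialAut_algebraMap (e : Expo n ≃+ Expo n) (f : Laurent n) :
    monomialAut e (algebraMap (Laurent n) (RatField n) f) =
      algebraMap (Laurent n) (RatField n) (AddMonoidAlgebra.domCongr ℚ ℚ e f) := by
  unfold monomialAut
  rw [IsFractionRing.ringEquivOfRingEquiv_algebraMap]
  rfl

theorem HasValue.monomialAut {y : RatField n} {z q' : ℂ} {x' : Var n → ℂ}
    (h : HasValue q' x' y z) (hq : q ≠ 0) (hx : ∀ v, x v ≠ 0)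
    (hq' : q' ≠ 0) (hx' : ∀ v, x' v ≠ 0) (e : Expo n ≃+ Expo n)
    (he : ∀ m, monomialValue q x (e m) = monomialValue q' x' m) :
    HasValue q x (monomialAut e y) z := by
  obtain ⟨N, D, h0, h1, h2⟩ := h
  refine ⟨AddMonoidAlgebra.domCongr ℚ ℚ e N, AddMonoidAlgebra.domCongr ℚ ℚ e D, ?_, ?_, ?_⟩
  · rwa [evalLaurent_domCongr hq hx hq' hx' e he]
  · rw [h1, map_div₀, monomialAut_algebraMap, monomialAut_algebraMap]
  · rw [h2, evalLaurent_domCongr hq hx hq' hx' e he, evalLaurent_domCongr hq hx hq' hx' e he]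

/-- The point `x` moved by a `q`-shift. -/
def shiftPoint (q : ℂ) (g : Shift n) (x : Var n → ℂ) : Var n → ℂ :=
  fun v => q ^ (g.toAdd v) * x v

theorem shiftPoint_ne_zero (hq : q ≠ 0) (hx : ∀ v, x v ≠ 0) (g : Shift n) (v : Var n) :
    shiftPoint q g x v ≠ 0 := mul_ne_zero (zpow_ne_zero _ hq) (hx v)

theorem monomialValue_shiftExpo (hq : q ≠ 0) (g : Shift n) (m : Expo n) :
    monomialValue q x (shiftExpo g.toAdd m) = monomialValue q (shiftPoint q g x) m := by
  have : ∀ (s : Finset (Var n)) (f : Var n → ℤ), q ^ (∑ v ∈ s, f v) = ∏ v ∈ s, q ^ f v := by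
    intro s f
    induction s using Finset.cons_induction with
    | empty => simp
    | cons a s ha ih => rw [Finset.sum_cons, Finset.prod_cons, zpow_add₀ hq, ih]
  change q ^ (m.1 + ∑ v, g.toAdd v * m.2 v) * ∏ v, x v ^ m.2 v = _
  rw [zpow_add₀ hq, this, mul_assoc, ← Finset.prod_mul_distrib]
  unfold monomialValue shiftPoint
  simp only [mul_zpow, _root_.zpow_mul]

theorem monomialValue_invExpo (m : Expo n) :
    monomialValue q x (invExpo n m) = monomialValue q⁻¹ x m := by
  change q ^ (-m.1) * _ = q⁻¹ ^ m.1 * _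
  rw [_root_.inv_zpow']
  rfl

theorem HasValue.smul {y : RatField n} {z : ℂ} {g : Shift n} (hq : q ≠ 0) (hx : ∀ v, x v ≠ 0)
    (h : HasValue q (shiftPoint q g x) y z) : HasValue q x (g • y) z :=
  h.monomialAut hq hx hq (shiftPoint_ne_zero hq hx g) _ (monomialValue_shiftExpo hq g)

theorem HasValue.qInv {y : RatField n} {z : ℂ} (hq : q ≠ 0) (hx : ∀ v, x v ≠ 0)
    (h : HasValue q⁻¹ x y z) : HasValue q x (qInv n y) z :=
  h.monomialAut hq hx (inv_ne_zero hq) hx _ monomialValue_invExpo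

/-- Lifting to the subring of `RatField n × ℂ` lets symmetric functions be computed once and read
off through both projections. -/
theorem HasValue.exists_lift (hq : q ≠ 0) (hx : ∀ v, x v ≠ 0) {ι : Type*} {y : ι → RatField n}
    {z : ι → ℂ} (h : ∀ i, HasValue q x (y i) (z i)) :
    ∃ w : ι → valueRing hq hx, (∀ i, ((RingHom.fst _ _).comp (valueRing hq hx).subtype) (w i) = y i) ∧
      ∀ i, ((RingHom.snd _ _).comp (valueRing hq hx).subtype) (w i) = z i :=
  ⟨fun i => ⟨(y i, z i), h i⟩, fun _ => rfl, fun _ => rfl⟩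

theorem hasValue_coe (hq : q ≠ 0) (hx : ∀ v, x v ≠ 0) (w : valueRing hq hx) :
    HasValue q x (((RingHom.fst _ _).comp (valueRing hq hx).subtype) w)
      (((RingHom.snd _ _).comp (valueRing hq hx).subtype) w) := w.2

theorem HasValue.elemSymm (hq : q ≠ 0) (hx : ∀ v, x v ≠ 0) {m : ℕ} (k : ℕ) {y : Fin m → RatField n}
    {z : Fin m → ℂ} (h : ∀ i, HasValue q x (y i) (z i)) :
    HasValue q x (elemSymm k y) (elemSymm k z) := by
  obtain ⟨w, h1, h2⟩ := HasValue.exists_lift hq hx h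
  have := hasValue_coe hq hx (Heine.elemSymm k w)
  rw [map_elemSymm, map_elemSymm] at this
  simpa only [h1, h2] using this

theorem HasValue.matrix_inv (hq : q ≠ 0) (hx : ∀ v, x v ≠ 0) {m : ℕ}
    {Y : Matrix (Fin m) (Fin m) (RatField n)} {Z : Matrix (Fin m) (Fin m) ℂ}
    (h : ∀ i j, HasValue q x (Y i j) (Z i j)) (hZ : Z.det ≠ 0) :
    IsUnit Y.det ∧ ∀ i j, HasValue q x (Y⁻¹ i j) (Z⁻¹ i j) := by
  -- Determinant and adjugate of `W` project to those of `Y` and of `Z`, which gives the values of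
  -- the entries of the inverse.
  let W : Matrix (Fin m) (Fin m) (valueRing hq hx) := fun i j => ⟨(Y i j, Z i j), h i j⟩
  have h1 := RingHom.map_det ((RingHom.fst _ _).comp (valueRing hq hx).subtype) W
  have h2 := RingHom.map_det ((RingHom.snd _ _).comp (valueRing hq hx).subtype) W
  have h3 := RingHom.map_adjugate ((RingHom.fst _ _).comp (valueRing hq hx).subtype) W
  have h4 := RingHom.map_adjugate ((RingHom.snd _ _).comp (valueRing hq hx).subtype) W
  have e1 : ((RingHom.fst _ _).comp (valueRing hq hx).subtype).mapMatrix W = Y := rfl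
  have e2 : ((RingHom.snd _ _).comp (valueRing hq hx).subtype).mapMatrix W = Z := rfl
  rw [e1] at h1 h3
  rw [e2] at h2 h4
  have hdet : HasValue q x Y.det Z.det := by
    rw [← h1, ← h2]; exact hasValue_coe hq hx _
  have hadj : ∀ i j, HasValue q x (Y.adjugate i j) (Z.adjugate i j) := by
    intro i j
    rw [← h3, ← h4]; exact hasValue_coe hq hx (W.adjugate i j)
  refine ⟨isUnit_iff_ne_zero.2 (hdet.ne_zero hZ), fun i j => ?_⟩
  rw [Matrix.inv_def, Matrix.inv_def, Matrix.smul_apply, Matrix.smul_apply, Ring.inverse_eq_inv',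
    Ring.inverse_eq_inv', smul_eq_mul, smul_eq_mul]
  exact (valueRing hq hx).mul_mem ((mem_valueRing hq hx).2 (hdet.inv hZ))
    ((mem_valueRing hq hx).2 (hadj i j))

end Values

/-! ### The fundamental matrix is generically invertible -/

section Wronskian

/-- The chosen continuation equals the sum of the series on a full neighbourhood of `0`, the point
`0` included. This permits evaluating the Wronskian there. -/
theorem Regular.continuousAt_phi {m : ℕ} {α β : Fin m → ℂ} {q : ℂ} (h : Regular α β q) :
    ContinuousAt (phi α β q) 0 := by
  obtain ⟨φ, ρ, hρ, han, hsum⟩ := h.exists_analytic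
  refine ((han 0 (Metric.mem_ball_self hρ)).congr ?_).continuousAt
  filter_upwards [h.isPhi_phi.2, Metric.ball_mem_nhds (0 : ℂ) hρ] with t ht ht'
  exact (hsum t ht').unique ht

theorem Regular.phi_apply_zero {m : ℕ} {α β : Fin m → ℂ} {q : ℂ} (h : Regular α β q) :
    phi α β q 0 = 1 := by
  refine h.isPhi_phi.2.self_of_nhds.unique ?_
  have := hasSum_single (f := fun k : ℕ => coefPhi α β q k * 0 ^ k) 0 (fun k hk => by simp [hk])
  rwa [coefPhi_zero, pow_zero, one_mul] at this

variable {n : ℕ} {a : Fin (n + 1) → ℂ} {b : Fin n → ℂ} {q : ℂ}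

theorem NonResonant.constB_ne_zero (h : NonResonant a b q) (j : Fin (n + 1)) :
    constB a b q j ≠ 0 := by
  have hq := h.q_ne_zero
  have hq1 := h.norm_q_ne_one
  have hself := qPochInf_self_ne_zero hq hq1
  have hmul : ∀ y : ℂ, (∀ k : ℤ, y ≠ q ^ k) → qPochInf (q * y) q ≠ 0 := fun y hy =>
    qPochInf_ne_zero hq hq1 fun k hk => hy (k - 1) (by rw [zpow_sub_one₀ hq, ← hk]; field_simp)
  unfold constB
  split_ifs with hj
  · exact one_ne_zero
  · refine mul_ne_zero (Finset.prod_ne_zero_iff.2 fun i _ => div_ne_zero (mul_ne_zero ?_ ?_)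
      (mul_ne_zero ?_ ?_)) (div_ne_zero (pow_ne_zero _ hself) ?_)
    · exact qPochInf_ne_zero hq hq1 (h.a_ne_zpow i)
    · by_cases hij : i = j
      · rw [hij, mul_div_cancel_right₀ _ (h.bFull_ne_zero j)]
        exact hself
      · rw [mul_div_assoc]
        exact hmul _ (h.b_div_b i j hij)
    · rw [mul_div_assoc]
      exact hmul _ (h.a_div_b i j)
    · refine Fin.cases ?_ (fun i => ?_) i
      · exact hself
      · exact qPochInf_ne_zero hq hq1 (h.b_ne_zpow i)
    · obtain ⟨i, rfl⟩ := Fin.exists_succ_eq.2 hj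
      refine theta_ne_zero hq hq1 fun k hk => h.b_ne_zpow i (k + 1) ?_
      rw [zpow_add_one₀ hq, ← hk, bFull_succ]
      field_simp

/-- Constants and prefactors come out of the columns. The remaining matrix is meromorphic and at `t
= 0` is the Vandermonde matrix of the numbers `q / b_j`, distinct because no `b_i / b_j` is `q ^ 0`.
-/
theorem NonResonant.eventually_det_ne_zero (h : NonResonant a b q) :
    ∀ᶠ t in gen, (matU t a b q).det ≠ 0 := by
  have hq := h.q_ne_zero
  let Φ : ℂ → Matrix (Fin (n + 1)) (Fin (n + 1)) ℂ := fun t =>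
    Matrix.of fun i j => (q / bFull b q j) ^ i.val * phi (upper a b q j) (lower b q j) q (q ^ i.val * t)
  have hmer : Meromorphic fun t => (Φ t).det := by
    simp only [Matrix.det_apply']
    exact Meromorphic.fun_sum fun σ _ => (Meromorphic.const _).fun_mul
      (Meromorphic.fun_prod fun i _ => (Meromorphic.const _).fun_mul ((h.regular _).meromorphic_phi_mul _))
  have hcont : ContinuousAt (fun t => (Φ t).det) 0 := by
    simp only [Matrix.det_apply']
    refine tendsto_finsetSum _ fun σ _ => tendsto_const_nhds.mul (tendsto_finsetProd _ fun i _ =>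
      tendsto_const_nhds.mul ?_)
    have h1 : ContinuousAt (fun t : ℂ => q ^ (σ i).val * t) 0 := by fun_prop
    have h2 := (h.regular i).continuousAt_phi
    rw [← mul_zero (q ^ (σ i).val)] at h2
    exact ContinuousAt.comp (f := fun t : ℂ => q ^ (σ i).val * t) h2 h1
  have h0 : (Φ 0).det ≠ 0 := by
    have : Φ 0 = (Matrix.vandermonde fun j => q / bFull b q j)ᵀ := by
      ext i j
      simp [Φ, (h.regular j).phi_apply_zero, Matrix.vandermonde]
    rw [this, Matrix.det_transpose, Matrix.det_vandermonde_ne_zero_iff]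
    intro i j hij
    by_contra hne
    apply h.b_div_b i j hne 0
    simp only at hij
    have hi := h.bFull_ne_zero i
    have hj := h.bFull_ne_zero j
    rw [div_eq_div_iff hi hj] at hij
    rw [zpow_zero, div_eq_one_iff_eq hj]
    exact (mul_left_cancel₀ hq hij).symm
  filter_upwards [h.eventually_ne_zpow, eventually_gen_ne hmer (hcont.eventually_ne h0)] with t ht hdet
  have : matU t a b q = Matrix.of fun i j =>
      (constB a b q j * prefactor b q j t) * Φ t i j := by
    ext i j
    change sol a b q j (q ^ i.val * t) = (constB a b q j * prefactor b q j t) *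
      ((q / bFull b q j) ^ i.val * phi (upper a b q j) (lower b q j) q (q ^ i.val * t))
    rw [sol_eq, h.prefactor_pow_mul j ht.1 ht.2.1 (ht.2.2 j)]
    ring
  rw [this, Matrix.det_mul_row]
  exact mul_ne_zero (Finset.prod_ne_zero_iff.2 fun j _ => mul_ne_zero (h.constB_ne_zero j)
    (h.prefactor_ne_zero j ht.2.1 (ht.2.2 j))) hdet

end Wronskian

/-! ### Functions with rational values at admissible parameters -/

section Rational

variable {n : ℕ} {a : Fin (n + 1) → ℂ} {b : Fin n → ℂ} {q : ℂ}

theorem point_ne_zero {t : ℂ} (ht : t ≠ 0) (ha : ∀ i, a i ≠ 0) (hb : ∀ j, b j ≠ 0) (v : Var n) :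
    point t a b v ≠ 0 := by
  rcases v with _ | i | j
  · exact ht
  · exact ha i
  · exact hb j

theorem NonResonant.point_ne_zero (h : NonResonant a b q) {t : ℂ} (ht : t ≠ 0) (v : Var n) :
    point t a b v ≠ 0 := Heine.point_ne_zero ht h.a_ne_zero h.b_ne_zero v

theorem hasValue_bAll_div {t : ℂ} (hq : q ≠ 0) (hx : ∀ v, point t a b v ≠ 0) (j : Fin (n + 1)) :
    HasValue q (point t a b) (bAll n j / qq n) (bFull b q j / q) := by
  have h1 := hasValue_qq hq hx
  have h2 : HasValue q (point t a b) (bAll n j) (bFull b q j) :=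
    Fin.cases h1 (fun j => hasValue_xx hq hx (vB j)) j
  rw [div_eq_mul_inv, div_eq_mul_inv]
  exact (valueRing hq hx).mul_mem ((mem_valueRing hq hx).2 h2) ((mem_valueRing hq hx).2 (h1.inv hq))

theorem hasValue_coefE {t : ℂ} (hq : q ≠ 0) (hx : ∀ v, point t a b v ≠ 0) (k : ℕ) :
    HasValue q (point t a b) (coefE n k)
      (elemSymm k (fun i => bFull b q i / q) - t * elemSymm k a) :=
  (valueRing hq hx).sub_mem
    ((mem_valueRing hq hx).2 (HasValue.elemSymm hq hx k fun j => hasValue_bAll_div hq hx j))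
    ((valueRing hq hx).mul_mem ((mem_valueRing hq hx).2 (hasValue_xx hq hx (vT n)))
      ((mem_valueRing hq hx).2 (HasValue.elemSymm hq hx k fun i => hasValue_xx hq hx (vA i))))

/-- The function `Φ` of `a, b, q, t` is given by a rational function, for admissible parameters
and generic `t`. -/
def IsRat (Φ : (Fin (n + 1) → ℂ) → (Fin n → ℂ) → ℂ → ℂ → ℂ) : Prop :=
  ∃ y : RatField n, ∀ a b q, NonResonant a b q → ∀ᶠ t in gen,
    HasValue q (point t a b) y (Φ a b q t)

variable {Φ Ψ : (Fin (n + 1) → ℂ) → (Fin n → ℂ) → ℂ → ℂ → ℂ}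

theorem IsRat.congr (hΦ : IsRat Φ)
    (h : ∀ a b q, NonResonant a b q → ∀ᶠ t in gen, Ψ a b q t = Φ a b q t) : IsRat Ψ := by
  obtain ⟨y, hy⟩ := hΦ
  refine ⟨y, fun a b q hab => ?_⟩
  filter_upwards [hy a b q hab, h a b q hab] with t h1 h2
  rwa [h2]

theorem isRat_of_hasValue (y : RatField n)
    (h : ∀ a b q, NonResonant a b q → ∀ t ≠ 0, HasValue q (point t a b) y (Φ a b q t)) :
    IsRat Φ := by
  refine ⟨y, fun a b q hab => ?_⟩
  filter_upwards [eventually_gen_ne_zero] with t ht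
  exact h a b q hab t ht

theorem isRat_intCast (m : ℤ) : IsRat (n := n) fun _ _ _ _ => (m : ℂ) :=
  isRat_of_hasValue (m : RatField n) fun _ _ _ h _ ht =>
    (mem_valueRing h.q_ne_zero (h.point_ne_zero ht)).1 (intCast_mem _ m)

theorem isRat_b (j : Fin n) : IsRat (n := n) fun _ b _ _ => b j :=
  isRat_of_hasValue (xx (vB j)) fun _ _ _ h _ ht => hasValue_xx h.q_ne_zero (h.point_ne_zero ht) (vB j)

theorem isRat_coefE (k : ℕ) : IsRat (n := n) fun a b q t =>
    elemSymm k (fun i => bFull b q i / q) - t * elemSymm k a :=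
  isRat_of_hasValue (coefE n k) fun _ _ _ h _ ht =>
    hasValue_coefE h.q_ne_zero (h.point_ne_zero ht) k

theorem IsRat.sub (hΦ : IsRat Φ) (hΨ : IsRat Ψ) : IsRat fun a b q t => Φ a b q t - Ψ a b q t := by
  obtain ⟨y, hy⟩ := hΦ
  obtain ⟨y', hy'⟩ := hΨ
  refine ⟨y - y', fun a b q h => ?_⟩
  filter_upwards [hy a b q h, hy' a b q h, eventually_gen_ne_zero] with t h1 h2 ht
  exact (valueRing h.q_ne_zero (h.point_ne_zero ht)).sub_mem
    ((mem_valueRing _ _).2 h1) ((mem_valueRing _ _).2 h2)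

theorem IsRat.add (hΦ : IsRat Φ) (hΨ : IsRat Ψ) : IsRat fun a b q t => Φ a b q t + Ψ a b q t := by
  obtain ⟨y, hy⟩ := hΦ
  obtain ⟨y', hy'⟩ := hΨ
  refine ⟨y + y', fun a b q h => ?_⟩
  filter_upwards [hy a b q h, hy' a b q h, eventually_gen_ne_zero] with t h1 h2 ht
  exact (valueRing h.q_ne_zero (h.point_ne_zero ht)).add_mem
    ((mem_valueRing _ _).2 h1) ((mem_valueRing _ _).2 h2)

theorem IsRat.mul (hΦ : IsRat Φ) (hΨ : IsRat Ψ) : IsRat fun a b q t => Φ a b q t * Ψ a b q t := by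
  obtain ⟨y, hy⟩ := hΦ
  obtain ⟨y', hy'⟩ := hΨ
  refine ⟨y * y', fun a b q h => ?_⟩
  filter_upwards [hy a b q h, hy' a b q h, eventually_gen_ne_zero] with t h1 h2 ht
  exact (valueRing h.q_ne_zero (h.point_ne_zero ht)).mul_mem
    ((mem_valueRing _ _).2 h1) ((mem_valueRing _ _).2 h2)

theorem IsRat.div (hΦ : IsRat Φ) (hΨ : IsRat Ψ)
    (h0 : ∀ a b q, NonResonant a b q → ∀ᶠ t in gen, Ψ a b q t ≠ 0) :
    IsRat fun a b q t => Φ a b q t / Ψ a b q t := by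
  obtain ⟨y, hy⟩ := hΦ
  obtain ⟨y', hy'⟩ := hΨ
  refine ⟨y * y'⁻¹, fun a b q h => ?_⟩
  filter_upwards [hy a b q h, hy' a b q h, h0 a b q h, eventually_gen_ne_zero] with t h1 h2 h3 ht
  rw [div_eq_mul_inv]
  exact (valueRing h.q_ne_zero (h.point_ne_zero ht)).mul_mem
    ((mem_valueRing _ _).2 h1) ((mem_valueRing _ _).2 (h2.inv h3))

theorem isRat_sum {ι : Type*} (s : Finset ι)
    {Φ : ι → (Fin (n + 1) → ℂ) → (Fin n → ℂ) → ℂ → ℂ → ℂ} (h : ∀ i ∈ s, IsRat (Φ i)) :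
    IsRat fun a b q t => ∑ i ∈ s, Φ i a b q t := by
  induction s using Finset.cons_induction with
  | empty => simpa using isRat_intCast (n := n) 0
  | cons i s hi ih =>
    simp only [Finset.sum_cons]
    exact (h i (Finset.mem_cons_self i s)).add (ih fun j hj => h j (Finset.mem_cons_of_mem hj))

theorem shiftPoint_point (g : Shift n) (t : ℂ) : shiftPoint q g (point t a b) =
    point (q ^ (g.toAdd (vT n)) * t) (fun i => q ^ (g.toAdd (vA i)) * a i)
      (fun j => q ^ (g.toAdd (vB j)) * b j) := by
  ext v
  rcases v with _ | i | j <;> rfl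

theorem IsRat.comp_mul (hΦ : IsRat Φ) (k : ℤ) : IsRat fun a b q t => Φ a b q (q ^ k * t) := by
  obtain ⟨y, hy⟩ := hΦ
  refine ⟨(Multiplicative.ofAdd (Pi.single (vT n) k) : Shift n) • y, fun a b q h => ?_⟩
  filter_upwards [(tendsto_mul_gen (zpow_ne_zero k h.q_ne_zero)).eventually (hy a b q h),
    eventually_gen_ne_zero] with t h1 ht
  refine HasValue.smul h.q_ne_zero (h.point_ne_zero ht) ?_
  rw [shiftPoint_point]
  convert h1 using 2
  · simp
  · simp
  · simp

end Rational

/-! ### Rationality of the pairing between the solutions at `q` and at `q⁻¹` -/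

section PairSum

variable {n : ℕ} {a : Fin (n + 1) → ℂ} {b : Fin n → ℂ} {q : ℂ}

/-- The parameters `b_j` for `j ∈ s` and `q⁻¹ b_j` for `j ∉ s`. -/
def bPart (s : Finset (Fin n)) (b : Fin n → ℂ) (q : ℂ) : Fin n → ℂ :=
  fun j => if j ∈ s then b j else q⁻¹ * b j

/-- The pairing between the solutions at `q⁻¹` with some of the `b_j` shifted, and the solutions
at `q` with shifted `t`. -/
def pairSum (s : Finset (Fin n)) (k : ℕ) (a : Fin (n + 1) → ℂ) (b : Fin n → ℂ) (q t : ℂ) : ℂ :=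
  ∑ j, sgn j * sol a (bPart s b q) q⁻¹ j t * sol a b q j (q ^ k * t)

theorem NonResonant.bPart (h : NonResonant a b q) (s : Finset (Fin n)) :
    NonResonant a (bPart s b q) q⁻¹ := by
  have := h.inv.shift 0 (fun j => if j ∈ s then 0 else 1)
  convert this using 1
  · ext i; simp
  · ext j
    unfold Heine.bPart
    split_ifs <;> simp

theorem eventually_gen_sub_mul_ne_zero {x : ℂ} (y : ℂ) (hx : x ≠ 0) :
    ∀ᶠ t in gen, x - t * y ≠ 0 := by
  refine eventually_gen_ne (meromorphic_poly x y) ?_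
  have : ContinuousAt (fun t : ℂ => x - t * y) 0 := by fun_prop
  exact this.eventually_ne (by simpa using hx)

/-- Only the second factor is moved by `k`, so the pairing inherits the recurrence of the solutions
at `q`. -/
theorem NonResonant.pairSum_recurrence (h : NonResonant a b q) (s : Finset (Fin n)) (K : ℕ) :
    ∀ᶠ t in gen, ∑ k ∈ Finset.range (n + 2), (-1) ^ k *
      (elemSymm k (fun i => bFull b q i / q) - q ^ (K : ℤ) * t * elemSymm k a) *
        pairSum s (K + k) a b q t = 0 := by
  filter_upwards [(tendsto_mul_gen (zpow_ne_zero (K : ℤ) h.q_ne_zero)).eventually h.sol_recurrence]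
    with t ht
  simp only [pairSum, Finset.mul_sum]
  rw [Finset.sum_comm]
  refine Finset.sum_eq_zero fun j _ => ?_
  rw [← mul_zero (sgn j * sol a (Heine.bPart s b q) q⁻¹ j t), ← ht j, Finset.mul_sum]
  refine Finset.sum_congr rfl fun k _ => ?_
  rw [zpow_natCast, ← mul_assoc (q ^ k), ← pow_add, add_comm k K]
  ring

theorem bPart_empty : bPart ∅ b q = fun j => q⁻¹ * b j := by
  ext j; simp [bPart]

theorem bPart_univ : bPart Finset.univ b q = b := by
  ext j; simp [bPart]

/-- For `1 ≤ k ≤ n + 1` the value is `1`. The recurrence of order `n + 1` extends this downwards to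
`k = 0` and upwards to all larger `k`. -/
theorem isRat_pairSum_empty (k : ℕ) : IsRat (n := n) (pairSum ∅ k) := by
  have hsmall : ∀ k, k ≤ n → IsRat (n := n) (pairSum ∅ (k + 1)) := fun k hk =>
    (isRat_intCast 1).congr fun a b q h => by
      filter_upwards [h.sol_pairing k hk] with t ht
      rw [pairSum, bPart_empty, ht, Int.cast_one]
  have hc : ∀ (k : ℕ) (K : ℕ), IsRat (n := n) fun a b q t => (-1) ^ k *
      (elemSymm k (fun i => bFull b q i / q) - q ^ (K : ℤ) * t * elemSymm k a) := by
    intro k K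
    have := (isRat_intCast (n := n) ((-1) ^ k)).mul ((isRat_coefE (n := n) k).comp_mul K)
    exact_mod_cast this
  induction k using Nat.strong_induction_on with
  | _ k ih =>
    rcases Nat.eq_zero_or_pos k with rfl | hk
    · refine (((isRat_intCast 0).sub (isRat_sum (Finset.range (n + 1)) fun k hk =>
        (hc (k + 1) 0).mul (hsmall k (Finset.mem_range_succ_iff.1 hk)))).div (hc 0 0) ?_).congr ?_
      · intro a b q h
        filter_upwards [eventually_gen_sub_mul_ne_zero 1 one_ne_zero] with t ht
        simpa [elemSymm_zero] using ht
      · intro a b q h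
        filter_upwards [eventually_gen_sub_mul_ne_zero 1 one_ne_zero, h.pairSum_recurrence ∅ 0]
          with t ht hrec
        rw [eq_div_iff (by simpa [elemSymm_zero] using ht)]
        rw [Finset.sum_range_succ'] at hrec
        simp only [zero_add] at hrec
        rw [Int.cast_zero]
        linear_combination hrec
    · obtain hk' | hk' := Nat.lt_or_ge k (n + 2)
      · obtain ⟨k, rfl⟩ : ∃ k', k = k' + 1 := ⟨k - 1, by omega⟩
        exact hsmall k (by omega)
      -- The recurrence is solved for its highest term, whose coefficient does not vanish
      -- generically because the `b_i` are nonzero.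
      · obtain ⟨K, rfl⟩ : ∃ K, k = K + (n + 1) := ⟨k - (n + 1), by omega⟩
        have hne : ∀ (a : Fin (n + 1) → ℂ) (b : Fin n → ℂ) (q : ℂ), NonResonant a b q →
            ∀ᶠ t in gen, (-1) ^ (n + 1) * (elemSymm (n + 1) (fun i => bFull b q i / q) -
              q ^ (K : ℤ) * t * elemSymm (n + 1) a) ≠ 0 := by
          intro a b q h
          have h0 : elemSymm (n + 1) (fun i => bFull b q i / q) ≠ 0 := by
            rw [elemSymm_self]
            exact Finset.prod_ne_zero_iff.2 fun i _ => div_ne_zero (h.bFull_ne_zero i) h.q_ne_zero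
          filter_upwards [eventually_gen_sub_mul_ne_zero (q ^ (K : ℤ) * elemSymm (n + 1) a) h0]
            with t ht
          refine mul_ne_zero (by simp) ?_
          rwa [mul_assoc, mul_left_comm]
        refine (((isRat_intCast 0).sub (isRat_sum (Finset.range (n + 1)) fun k hk =>
          (hc k K).mul (ih (K + k) (by have := Finset.mem_range.1 hk; omega)))).div
            (hc (n + 1) K) hne).congr ?_
        intro a b q h
        filter_upwards [hne a b q h, h.pairSum_recurrence ∅ K] with t ht hrec
        rw [eq_div_iff ht]
        rw [Finset.sum_range_succ] at hrec
        rw [Int.cast_zero]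
        linear_combination hrec

/-- The contiguity relation in `b_i`, in base `q⁻¹`, expresses a solution at `b_i` by solutions at
`q⁻¹ b_i` with arguments `t` and `q⁻¹ t`. In the second term, passing from `k` to `k + 1` keeps the
argument of the other factor unchanged. -/
theorem isRat_pairSum (s : Finset (Fin n)) (k : ℕ) : IsRat (n := n) (pairSum s k) := by
  induction s using Finset.induction_on generalizing k with
  | empty => exact isRat_pairSum_empty k
  | insert i s hi ih =>
    refine (((ih k).sub ((isRat_b i).mul ((ih (k + 1)).comp_mul (-1)))).div
      ((isRat_intCast 1).sub (isRat_b i)) ?_).congr ?_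
    · intro a b q h
      refine Eventually.of_forall fun t => ?_
      rw [Int.cast_one]
      exact sub_ne_zero.2 (by simpa using (h.b_ne_zpow i 0).symm)
    · intro a b q h
      have hq := h.q_ne_zero
      have hupd : Function.update (bPart (insert i s) b q) i (q⁻¹ * bPart (insert i s) b q i) =
          bPart s b q := by
        ext j
        by_cases hj : j = i
        · subst hj; simp [bPart, hi]
        · simp [bPart, hj]
      have hbi : bPart (insert i s) b q i = b i := by simp [bPart]
      have hrel := (h.bPart (insert i s)).sol_update_b i
      rw [hupd, hbi] at hrel
      filter_upwards [hrel] with t ht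
      rw [Int.cast_one, eq_div_iff (sub_ne_zero.2 (by simpa using (h.b_ne_zpow i 0).symm))]
      simp only [pairSum, Finset.sum_mul, Finset.mul_sum]
      rw [← Finset.sum_sub_distrib]
      refine Finset.sum_congr rfl fun j _ => ?_
      rw [_root_.zpow_neg_one, pow_succ, mul_assoc (q ^ k) q, mul_inv_cancel_left₀ hq]
      linear_combination (-sgn j * sol a b q j (q ^ k * t)) * ht j

theorem exists_pairing_matrix (n : ℕ) :
    ∃ Y : Matrix (Fin (n + 1)) (Fin (n + 1)) (RatField n),
      ∀ (a : Fin (n + 1) → ℂ) (b : Fin n → ℂ) (q : ℂ), NonResonant a b q →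
      ∀ᶠ t in gen, ∀ i k, HasValue q (point t a b) (Y i k)
        ((matU t a b q⁻¹ * Matrix.diagonal sgn * (matU t a b q)ᵀ :
          Matrix (Fin (n + 1)) (Fin (n + 1)) ℂ) i k) := by
  have : ∀ i k : Fin (n + 1), IsRat fun (a : Fin (n + 1) → ℂ) (b : Fin n → ℂ) q t =>
      (matU t a b q⁻¹ * Matrix.diagonal sgn * (matU t a b q)ᵀ :
          Matrix (Fin (n + 1)) (Fin (n + 1)) ℂ) i k := by
    intro i k
    -- Row `i` carries the argument `q⁻¹ ^ i * t`. Relative to it, the second factor in column `k`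
    -- is shifted by `q ^ (i + k)`.
    refine ((isRat_pairSum Finset.univ (i.val + k.val)).comp_mul (-(i.val : ℤ))).congr
      fun a b q h => Eventually.of_forall fun t => ?_
    have hq := pow_ne_zero i.val h.q_ne_zero
    rw [Matrix.mul_apply, pairSum, bPart_univ]
    refine Finset.sum_congr rfl fun j _ => ?_
    rw [Matrix.mul_diagonal, Matrix.transpose_apply, _root_.zpow_neg, zpow_natCast, pow_add, mul_comm (q ^ i.val), mul_assoc (q ^ k.val),
      mul_inv_cancel_left₀ hq]
    simp only [matU, inv_pow]
    ring
  choose Y hY using this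
  refine ⟨Y, fun a b q h => ?_⟩
  rw [eventually_all]
  intro i
  rw [eventually_all]
  exact fun k => hY i k a b q h

end PairSum

/-! ### Generic points -/

section Generic

/-- The algebra generated by finitely many numbers over `ℚ` is countable, so only countably many
numbers are algebraic over it. -/
theorem countable_not_algebraicIndependent {ι : Type*} [Finite ι] {x : ι → ℂ}
    (hx : AlgebraicIndependent ℚ x) :
    {z : ℂ | ¬ AlgebraicIndependent ℚ fun o : Option ι => o.elim z x}.Countable := by
  have hc : Countable (Algebra.adjoin ℚ (Set.range x)) := by
    refine Cardinal.mk_le_aleph0_iff.1 ((Algebra.cardinalMk_adjoin_le ℚ (Set.range x)).trans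
      (max_le (max_le Cardinal.mk_le_aleph0 ?_) le_rfl))
    exact (Set.countable_range x).le_aleph0
  refine (Algebraic.countable (Algebra.adjoin ℚ (Set.range x)) ℂ).mono fun z hz => ?_
  rw [Set.mem_ofPred_eq, hx.option_iff_transcendental, Transcendental, not_not] at hz
  exact hz

theorem exists_algebraicIndependent (ι : Type) [Finite ι] :
    ∃ x : ι → ℂ, AlgebraicIndependent ℚ x := by
  induction ι using Finite.induction_empty_option with
  | of_equiv e ih =>
    obtain ⟨x, hx⟩ := ih
    exact ⟨x ∘ e.symm, hx.comp _ e.symm.injective⟩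
  | h_empty =>
    refine ⟨PEmpty.elim, ?_⟩
    exact algebraicIndependent_empty_type
  | h_option ih =>
    obtain ⟨x, hx⟩ := ih
    have h := countable_not_algebraicIndependent hx
    obtain ⟨z, hz⟩ : ∃ z, z ∉ {z : ℂ | ¬ AlgebraicIndependent ℚ fun o : Option _ => o.elim z x} := by
      by_contra! hall
      exact not_countable_complex (h.mono fun z _ => hall z)
    exact ⟨_, not_not.1 hz⟩

variable {n : ℕ} {a : Fin (n + 1) → ℂ} {b : Fin n → ℂ} {q : ℂ} {x : Var n → ℂ}

/-- No nonzero Laurent polynomial over `ℚ` vanishes at the point `(q, x)`. -/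
def IsGenericPoint (q : ℂ) (x : Var n → ℂ) : Prop := ∀ f : Laurent n, evalLaurent q x f = 0 → f = 0

theorem isGenericPoint_of_algebraicIndependent
    (h : AlgebraicIndependent ℚ fun o : Option (Var n) => o.elim q x) : IsGenericPoint q x := by
  have hq : q ≠ 0 := h.ne_zero none
  have hx : ∀ v, x v ≠ 0 := fun v => h.ne_zero (some v)
  intro f hf
  -- `M` bounds all exponents of `f` in absolute value. Multiplication by the monomial with all
  -- exponents `M` turns `f` into a polynomial, to which algebraic independence applies.
  let M : ℕ := ∑ m ∈ f.coeff.support, (m.1.natAbs + ∑ v, (m.2 v).natAbs)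
  have hM : ∀ m ∈ f.coeff.support, 0 ≤ m.1 + M ∧ ∀ v, 0 ≤ m.2 v + M := by
    intro m hm
    have h1 : m.1.natAbs + ∑ v, (m.2 v).natAbs ≤ M :=
      Finset.single_le_sum (f := fun m : Expo n => m.1.natAbs + ∑ v, (m.2 v).natAbs)
        (fun _ _ => Nat.zero_le _) hm
    refine ⟨by omega, fun v => ?_⟩
    have h2 : (m.2 v).natAbs ≤ ∑ v, (m.2 v).natAbs :=
      Finset.single_le_sum (f := fun v => (m.2 v).natAbs) (fun _ _ => Nat.zero_le _)
        (Finset.mem_univ v)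
    omega
  let e : Expo n → (Option (Var n) →₀ ℕ) := fun m =>
    Finsupp.equivFunOnFinite.symm fun o : Option (Var n) => (o.elim m.1 m.2 + (M : ℤ)).toNat
  have he : Set.InjOn e f.coeff.support := by
    intro m hm m' hm' hmm
    have h1 : ∀ o : Option (Var n), (o.elim m.1 m.2 + (M : ℤ)).toNat = (o.elim m'.1 m'.2 + (M : ℤ)).toNat :=
      fun o => DFunLike.congr_fun hmm o
    ext v
    · have := h1 none
      have := (hM m hm).1
      have := (hM m' hm').1
      simp only [Option.elim] at *
      omega
    · have := h1 (some v)
      have := (hM m hm).2 v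
      have := (hM m' hm').2 v
      simp only [Option.elim] at *
      omega
  let P : MvPolynomial (Option (Var n)) ℚ :=
    ∑ m ∈ f.coeff.support, MvPolynomial.monomial (e m) (f.coeff m)
  have hP : MvPolynomial.aeval (fun o : Option (Var n) => o.elim q x) P = 0 := by
    have key : ∀ m ∈ f.coeff.support,
        MvPolynomial.aeval (fun o : Option (Var n) => o.elim q x)
          (MvPolynomial.monomial (e m) (f.coeff m)) =
        (q ^ M * ∏ v, x v ^ M) * ((f.coeff m : ℂ) * monomialValue q x m) := by
      intro m hm
      rw [MvPolynomial.aeval_monomial, Finsupp.prod_fintype _ _ (fun _ => pow_zero _),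
        Fintype.prod_option]
      have h1 : q ^ (m.1 + M).toNat = q ^ M * q ^ m.1 := by
        rw [← zpow_natCast, Int.toNat_of_nonneg (hM m hm).1, zpow_add₀ hq, zpow_natCast, mul_comm]
      have h2 : ∀ v, x v ^ (m.2 v + M).toNat = x v ^ M * x v ^ m.2 v := fun v => by
        rw [← zpow_natCast, Int.toNat_of_nonneg ((hM m hm).2 v), zpow_add₀ (hx v), zpow_natCast,
          mul_comm]
      change (f.coeff m : ℂ) * (q ^ (m.1 + M).toNat * ∏ v, x v ^ (m.2 v + M).toNat) = _
      rw [h1]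
      simp only [h2, Finset.prod_mul_distrib, monomialValue]
      ring
    rw [map_sum, Finset.sum_congr rfl key, ← Finset.mul_sum]
    change _ * evalLaurent q x f = 0
    rw [hf, mul_zero]
  have hP0 : P = 0 := (injective_iff_map_eq_zero _).1 h P hP
  ext m
  by_contra hm
  have hm' : m ∈ f.coeff.support := Finsupp.mem_support_iff.2 hm
  have : P.coeff (e m) = f.coeff m := by
    simp only [P, MvPolynomial.coeff_sum, MvPolynomial.coeff_monomial]
    rw [Finset.sum_eq_single m]
    · simp
    · intro m' hm1 hne
      rw [if_neg fun h' => hne (he hm1 hm' h')]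
    · exact fun h' => absurd hm' h'
  rw [hP0, MvPolynomial.coeff_zero] at this
  exact hm this.symm

theorem IsGenericPoint.monomialValue_ne (h : IsGenericPoint q x) (hq : q ≠ 0) (hx : ∀ v, x v ≠ 0)
    {m m' : Expo n} (hm : m ≠ m') : monomialValue q x m ≠ monomialValue q x m' := by
  intro heq
  have h0 := h (AddMonoidAlgebra.single m 1 - AddMonoidAlgebra.single m' 1) (by
    rw [← evalHom_apply hq hx, map_sub, evalHom_single, evalHom_single, heq, sub_self])
  have := congrArg (fun f : Laurent n => f.coeff m) (sub_eq_zero.1 h0)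
  simp [hm.symm] at this

theorem monomialValue_single (k : ℤ) (v : Var n) :
    monomialValue q x (k, Pi.single v 1) = q ^ k * x v := by
  simp only [monomialValue]
  rw [Finset.prod_eq_single v]
  · simp
  · intro w _ hw; simp [hw]
  · simp

/-- A resonance would be an equality between the values of two distinct Laurent monomials. -/
theorem IsGenericPoint.nonResonant {t : ℂ} (h : IsGenericPoint q (point t a b)) (hq : q ≠ 0)
    (hq1 : ‖q‖ ≠ 1) (hx : ∀ v, point t a b v ≠ 0) : NonResonant a b q := by
  have h0 : ∀ (k : ℤ) (v : Var n), point t a b v ≠ q ^ k := by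
    intro k v
    have := h.monomialValue_ne hq hx (m := (0, Pi.single v 1)) (m' := (k, 0)) fun h' => by
      have := congrFun (congrArg Prod.snd h') v
      simp at this
    rw [monomialValue_single] at this
    simpa [monomialValue] using this
  have h1 : ∀ (k : ℤ) (v w : Var n), v ≠ w → point t a b v ≠ q ^ k * point t a b w := by
    intro k v w hvw
    have := h.monomialValue_ne hq hx (m := (0, Pi.single v 1)) (m' := (k, Pi.single w 1))
      fun h' => by
        have := congrFun (congrArg Prod.snd h') v
        simp [hvw] at this
    rw [monomialValue_single, monomialValue_single] at this
    simpa using this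
  refine nonResonant_of hq hq1 (fun i => hx (vA i)) (fun j => hx (vB j)) (fun j k => h0 k (vB j))
    (fun i k => h0 k (vA i)) (fun i j hij k hk => ?_) (fun i j k hk => ?_)
  · rw [div_eq_iff (show b j ≠ 0 from hx (vB j))] at hk
    exact h1 k (vB i) (vB j) (by simpa using hij) hk
  · rw [div_eq_iff (show b j ≠ 0 from hx (vB j))] at hk
    exact h1 k (vA i) (vB j) (by simp) hk

/-- The parameters `a, b, q` are fixed once, and `t` stays free outside a countable set. The
analytic identities, known for fixed parameters and generic `t`, can then be imposed as well. -/
theorem exists_generic_parameters (n : ℕ) :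
    ∃ (a : Fin (n + 1) → ℂ) (b : Fin n → ℂ) (q : ℂ), NonResonant a b q ∧
      {t : ℂ | ¬ IsGenericPoint q (point t a b)}.Countable := by
  obtain ⟨z, hz⟩ := exists_algebraicIndependent (Fin (n + 1) ⊕ Fin n)
  obtain ⟨q, hq, hq1⟩ : ∃ q : ℂ, (AlgebraicIndependent ℚ fun o : Option _ => o.elim q z) ∧ ‖q‖ ≠ 1 := by
    -- A set with countable complement is dense, so it meets the open unit disc; this secures `‖q‖ ≠
    -- 1`.
    obtain ⟨q, hq, hq1⟩ := ((countable_not_algebraicIndependent hz).dense_compl ℂ).inter_open_nonempty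
      (Metric.ball 0 1) Metric.isOpen_ball ⟨0, by simp⟩
    exact ⟨q, not_not.1 hq1, (mem_ball_zero_iff.1 hq).ne⟩
  have hc := countable_not_algebraicIndependent hq
  have hgen : ∀ t : ℂ, (AlgebraicIndependent ℚ fun o : Option (Option _) => o.elim t
      fun o => o.elim q z) →
      (∀ v, point t (z ∘ Sum.inl) (z ∘ Sum.inr) v ≠ 0) ∧
      IsGenericPoint q (point t (z ∘ Sum.inl) (z ∘ Sum.inr)) := by
    intro t ht
    let e : Option (Var n) → Option (Option (Fin (n + 1) ⊕ Fin n)) := fun o =>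
      o.elim (some none) (Sum.elim (fun _ => none) fun w => some (some w))
    have he : Function.Injective e := by
      rintro (_ | _ | w) (_ | _ | w') h <;> simp_all [e]
    have h1 := ht.comp e he
    have h2 : (fun o : Option (Var n) => o.elim q (point t (z ∘ Sum.inl) (z ∘ Sum.inr))) =
        (fun o : Option (Option _) => o.elim t fun o => o.elim q z) ∘ e := by
      ext o
      rcases o with _ | _ | _ | _ <;> rfl
    rw [← h2] at h1
    exact ⟨fun v => h1.ne_zero (some v), isGenericPoint_of_algebraicIndependent h1⟩
  have hc' : {t : ℂ | ¬ IsGenericPoint q (point t (z ∘ Sum.inl) (z ∘ Sum.inr))}.Countable :=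
    hc.mono fun t ht h => ht (hgen t h).2
  obtain ⟨t, ht⟩ : ∃ t, t ∉ {t : ℂ | ¬ AlgebraicIndependent ℚ fun o : Option (Option _) =>
      o.elim t fun o => o.elim q z} := by
    by_contra! hall
    exact not_countable_complex (hc.mono fun z _ => hall z)
  obtain ⟨hx, hg⟩ := hgen t (not_not.1 ht)
  exact ⟨z ∘ Sum.inl, z ∘ Sum.inr, q, hg.nonResonant (hq.ne_zero none) hq1 hx, hc'⟩

/-- Evaluation of rational functions at a generic point. -/
def evalField (hq : q ≠ 0) (hx : ∀ v, x v ≠ 0) (h : IsGenericPoint q x) : RatField n →+* ℂ :=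
  IsFractionRing.lift (g := evalHom hq hx) ((injective_iff_map_eq_zero _).2 fun f hf =>
    h f (by rwa [evalHom_apply] at hf))

theorem HasValue.evalField_eq (hq : q ≠ 0) (hx : ∀ v, x v ≠ 0) (h : IsGenericPoint q x)
    {y : RatField n} {z : ℂ} (hy : HasValue q x y z) : evalField hq hx h y = z := by
  obtain ⟨N, D, -, h1, h2⟩ := hy
  rw [h1, h2, map_div₀, evalField, IsFractionRing.lift_algebraMap, IsFractionRing.lift_algebraMap,
    evalHom_apply, evalHom_apply]

end Generic

/-! ### The connection matrix -/

section Connection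

variable {n : ℕ} {a : Fin (n + 1) → ℂ} {b : Fin n → ℂ} {q : ℂ}

/-- The value of `e_k(b/q) - t e_k(a)`. -/
def coefEValue (t : ℂ) (a : Fin (n + 1) → ℂ) (b : Fin n → ℂ) (q : ℂ) (k : ℕ) : ℂ :=
  elemSymm k (fun i => bFull b q i / q) - t * elemSymm k a

/-- The value of the companion matrix. -/
def compAValue (t : ℂ) (a : Fin (n + 1) → ℂ) (b : Fin n → ℂ) (q : ℂ) :
    Matrix (Fin (n + 1)) (Fin (n + 1)) ℂ := fun i j =>
  if i = Fin.last n then (-1) ^ (n + j.val) * coefEValue t a b q j.val / coefEValue t a b q (n + 1)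
  else if j.val = i.val + 1 then 1 else 0

theorem NonResonant.eventually_coefEValue_ne_zero (h : NonResonant a b q) :
    ∀ᶠ t in gen, coefEValue t a b q (n + 1) ≠ 0 := by
  refine eventually_gen_sub_mul_ne_zero _ ?_
  rw [elemSymm_self]
  exact Finset.prod_ne_zero_iff.2 fun i _ => div_ne_zero (h.bFull_ne_zero i) h.q_ne_zero

theorem hasValue_compA {t : ℂ} (hq : q ≠ 0) (hx : ∀ v, point t a b v ≠ 0)
    (h0 : coefEValue t a b q (n + 1) ≠ 0) (i j : Fin (n + 1)) :
    HasValue q (point t a b) (compA n i j) (compAValue t a b q i j) := by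
  have h1 : ∀ k, (coefE n k, coefEValue t a b q k) ∈ valueRing hq hx := fun k =>
    hasValue_coefE hq hx k
  have h2 : ((coefE n (n + 1))⁻¹, (coefEValue t a b q (n + 1))⁻¹) ∈ valueRing hq hx :=
    HasValue.inv (hasValue_coefE hq hx (n + 1)) h0
  unfold compA compAValue
  split_ifs
  · rw [div_eq_mul_inv, div_eq_mul_inv]
    exact (valueRing hq hx).mul_mem ((valueRing hq hx).mul_mem
      ((valueRing hq hx).pow_mem ((valueRing hq hx).neg_mem (one_mem _)) (n + j.val)) (h1 j)) h2
  · exact one_mem (valueRing hq hx)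
  · exact zero_mem (valueRing hq hx)

theorem NonResonant.matU_mul_q (h : NonResonant a b q) :
    ∀ᶠ t in gen, matU (q * t) a b q = compAValue t a b q * matU t a b q := by
  filter_upwards [h.sol_recurrence, h.eventually_coefEValue_ne_zero] with t ht h0
  ext i j
  rw [Matrix.mul_apply]
  simp only [matU, compAValue]
  rw [← mul_assoc, ← pow_succ]
  split_ifs with hi
  · have := ht j
    rw [Finset.sum_range_succ, ← Fin.sum_univ_eq_sum_range (fun k => (-1) ^ k *
      (elemSymm k (fun i => bFull b q i / q) - t * elemSymm k a) * sol a b q j (q ^ k * t))] at this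
    subst hi
    simp only [Fin.val_last]
    have e : ∀ k : Fin (n + 1), (-1) ^ (n + k.val) * coefEValue t a b q k.val /
        coefEValue t a b q (n + 1) * sol a b q j (q ^ k.val * t) =
        ((-1) ^ n / coefEValue t a b q (n + 1)) * ((-1) ^ k.val *
          (elemSymm k.val (fun i => bFull b q i / q) - t * elemSymm k.val a) *
            sol a b q j (q ^ k.val * t)) := fun k => by
      rw [pow_add, coefEValue]
      ring
    simp only [e]
    rw [← Finset.mul_sum, eq_neg_of_add_eq_zero_left this]
    change _ = _ * -(_ * coefEValue t a b q (n + 1) * _)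
    have e2 : ((-1 : ℂ) ^ n) * (-1) ^ (n + 1) = -1 := by
      rw [pow_succ, ← mul_assoc, ← mul_pow]; simp
    field_simp
    linear_combination sol a b q j (q ^ (n + 1) * t) * e2
  · have hi' : i.val + 1 < n + 1 := by
      have := i.2
      have : i.val ≠ n := fun h' => hi (Fin.ext h')
      omega
    rw [Finset.sum_eq_single ⟨i.val + 1, hi'⟩]
    · simp
    · intro k _ hk
      rw [if_neg fun h' => hk (Fin.ext h'), zero_mul]
    · simp

theorem diagonal_sgn_mul_self :
    (Matrix.diagonal sgn * Matrix.diagonal sgn : Matrix (Fin (n + 1)) (Fin (n + 1)) ℂ) = 1 := by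
  rw [Matrix.diagonal_mul_diagonal, ← Matrix.diagonal_one]
  congr 1
  ext i
  unfold sgn
  split_ifs <;> simp

theorem det_diagonal_sgn_ne_zero :
    (Matrix.diagonal sgn : Matrix (Fin (n + 1)) (Fin (n + 1)) ℂ).det ≠ 0 := by
  intro h
  have := congrArg Matrix.det (diagonal_sgn_mul_self (n := n))
  rw [Matrix.det_mul, h, zero_mul, Matrix.det_one] at this
  exact zero_ne_one this

/-- The product of the fundamental matrices at `q⁻¹` and at `q`. -/
def pairingValue (t : ℂ) (a : Fin (n + 1) → ℂ) (b : Fin n → ℂ) (q : ℂ) :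
    Matrix (Fin (n + 1)) (Fin (n + 1)) ℂ :=
  matU t a b q⁻¹ * Matrix.diagonal sgn * (matU t a b q)ᵀ

theorem NonResonant.eventually_det_pairingValue_ne_zero (h : NonResonant a b q) :
    ∀ᶠ t in gen, (pairingValue t a b q).det ≠ 0 := by
  filter_upwards [h.eventually_det_ne_zero, h.inv.eventually_det_ne_zero] with t h1 h2
  rw [pairingValue, Matrix.det_mul, Matrix.det_mul, Matrix.det_transpose]
  exact mul_ne_zero (mul_ne_zero h2 det_diagonal_sgn_ne_zero) h1

/-- In base `q⁻¹` the equation in `t` leads from `q t` back to `t`, so the companion matrix at `q⁻¹`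
is taken at `q t`. -/
theorem NonResonant.pairingValue_relation (h : NonResonant a b q) :
    ∀ᶠ t in gen, compAValue (q * t) a b q⁻¹ * pairingValue (q * t) a b q =
      pairingValue t a b q * (compAValue t a b q)ᵀ := by
  filter_upwards [h.matU_mul_q, (tendsto_mul_gen h.q_ne_zero).eventually h.inv.matU_mul_q]
    with t h1 h2
  rw [inv_mul_cancel_left₀ h.q_ne_zero] at h2
  rw [pairingValue, pairingValue, h1, h2, Matrix.transpose_mul]
  simp only [Matrix.mul_assoc]

theorem exists_of_countable_of_eventually_gen {p r : ℂ → Prop} (hp : {t | ¬ p t}.Countable)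
    (hr : ∀ᶠ t in gen, r t) : ∃ t, p t ∧ r t := by
  by_contra! hcon
  refine not_countable_complex ((hp.union (countable_of_mem_gen hr)).mono fun t _ => ?_)
  by_cases h : p t
  · exact Or.inr (hcon t h)
  · exact Or.inl h

/-- `Q` is the inverse of the rational matrix `Y` that represents the pairing of the two fundamental
matrices. -/
theorem exists_connection_matrix (n : ℕ) :
    ∃ Q : Matrix.GeneralLinearGroup (Fin (n + 1)) (RatField n),
      (Q.1.map fun y => shiftOf (vT n) • y) *
          ((compA n).map fun y => shiftOf (vT n) • qInv n y)⁻¹ =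
        ((compA n)⁻¹)ᵀ * Q.1 ∧
      ∀ (a : Fin (n + 1) → ℂ) (b : Fin n → ℂ) (q : ℂ), NonResonant a b q →
        ∀ᶠ t in gen, IsUnit (matU t a b q).det ∧
          ∃ Qt : Matrix (Fin (n + 1)) (Fin (n + 1)) ℂ,
            (∀ i j, HasValue q (point t a b) (Q.1 i j) (Qt i j)) ∧
            ((matU t a b q)⁻¹)ᵀ = Qt * matU t a b q⁻¹ * Matrix.diagonal sgn := by
  obtain ⟨Y, hY⟩ := exists_pairing_matrix n
  obtain ⟨a, b, q, h, hgen⟩ := exists_generic_parameters n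
  have hq := h.q_ne_zero
  have hT := tendsto_mul_gen hq
  have hall : ∀ᶠ t in gen, t ≠ 0 ∧
      (∀ i k, HasValue q (point t a b) (Y i k) (pairingValue t a b q i k)) ∧
      (∀ i k, HasValue q (point (q * t) a b) (Y i k) (pairingValue (q * t) a b q i k)) ∧
      (pairingValue t a b q).det ≠ 0 ∧ (pairingValue (q * t) a b q).det ≠ 0 ∧
      coefEValue t a b q (n + 1) ≠ 0 ∧ coefEValue (q * t) a b q⁻¹ (n + 1) ≠ 0 ∧
      compAValue (q * t) a b q⁻¹ * pairingValue (q * t) a b q =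
        pairingValue t a b q * (compAValue t a b q)ᵀ ∧
      (compAValue t a b q).det ≠ 0 := by
    filter_upwards [eventually_gen_ne_zero, hY a b q h, hT.eventually (hY a b q h),
      h.eventually_det_pairingValue_ne_zero, hT.eventually h.eventually_det_pairingValue_ne_zero,
      h.eventually_coefEValue_ne_zero, hT.eventually h.inv.eventually_coefEValue_ne_zero,
      h.pairingValue_relation, h.matU_mul_q, hT.eventually h.eventually_det_ne_zero]
      with t h1 h2 h3 h4 h5 h6 h7 h8 h9 h10
    refine ⟨h1, h2, h3, h4, h5, h6, h7, h8, fun h' => h10 ?_⟩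
    rw [h9, Matrix.det_mul, h', zero_mul]
  obtain ⟨t, hg, ht0, hY1, hY2, hd1, hd2, hE1, hE2, hrel, hdA⟩ :=
    exists_of_countable_of_eventually_gen hgen hall
  have hx := h.point_ne_zero ht0
  have hx' := h.point_ne_zero (mul_ne_zero hq ht0)
  have hshift : shiftPoint q (shiftOf (vT n)) (point t a b) = point (q * t) a b := by
    rw [shiftPoint_point]
    simp [shiftOf]
  set ev := evalField hq hx hg
  let s : RatField n →+* RatField n := MulSemiringAction.toRingHom (Shift n) (RatField n) (shiftOf (vT n))
  have eY : Y.map ev = pairingValue t a b q := by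
    ext i k; exact (hY1 i k).evalField_eq hq hx hg
  have eY' : (Y.map s).map ev = pairingValue (q * t) a b q := by
    ext i k
    refine HasValue.evalField_eq hq hx hg (HasValue.smul hq hx ?_)
    rw [hshift]
    exact hY2 i k
  have eA : (compA n).map ev = compAValue t a b q := by
    ext i k; exact (hasValue_compA hq hx hE1 i k).evalField_eq hq hx hg
  set A' := (compA n).map fun y => shiftOf (vT n) • qInv n y
  have eA' : A'.map ev = compAValue (q * t) a b q⁻¹ := by
    ext i k
    refine HasValue.evalField_eq hq hx hg (HasValue.smul hq hx ?_)
    rw [hshift]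
    exact HasValue.qInv hq hx' (hasValue_compA (inv_ne_zero hq) hx' hE2 i k)
  -- Evaluation at a generic point is injective, so the relation over `ℚ(t,a,b,q)` follows from the
  -- complex one at this single point.
  have key : A' * Y.map s = Y * (compA n)ᵀ := by
    have hinj : Function.Injective (fun M : Matrix (Fin (n + 1)) (Fin (n + 1)) (RatField n) => M.map ev) :=
      Matrix.map_injective ev.injective
    apply hinj
    simp only [Matrix.map_mul]
    rw [eA', eY', eY, Matrix.transpose_map, eA, hrel]
  have hYdet : IsUnit Y.det := (HasValue.matrix_inv hq hx hY1 hd1).1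
  have hAdet : IsUnit (compA n).det :=
    (HasValue.matrix_inv hq hx (hasValue_compA hq hx hE1) hdA).1
  refine ⟨Matrix.nonsingInvUnit Y⁻¹ (Matrix.isUnit_nonsing_inv_det Y hYdet), ?_, ?_⟩
  · change (Y⁻¹).map s * A'⁻¹ = ((compA n)⁻¹)ᵀ * Y⁻¹
    have hs : (Y⁻¹).map s = (Y.map s)⁻¹ := by
      refine (Matrix.inv_eq_right_inv ?_).symm
      rw [← Matrix.map_mul, Matrix.mul_nonsing_inv Y hYdet]
      simp
    rw [hs, ← Matrix.mul_inv_rev, key, Matrix.mul_inv_rev, Matrix.transpose_nonsing_inv]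
  · intro a b q h
    filter_upwards [hY a b q h, h.eventually_det_pairingValue_ne_zero, h.eventually_det_ne_zero,
      h.inv.eventually_det_ne_zero, eventually_gen_ne_zero] with t h1 h2 h3 h4 h5
    refine ⟨isUnit_iff_ne_zero.2 h3, (pairingValue t a b q)⁻¹,
      (HasValue.matrix_inv h.q_ne_zero (h.point_ne_zero h5) h1 h2).2, ?_⟩
    have hU' := isUnit_iff_ne_zero.2 h4
    have hD : (Matrix.diagonal sgn : Matrix (Fin (n + 1)) (Fin (n + 1)) ℂ)⁻¹ =
      Matrix.diagonal sgn := Matrix.inv_eq_right_inv diagonal_sgn_mul_self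
    rw [pairingValue, Matrix.mul_inv_rev, Matrix.mul_inv_rev, hD, Matrix.mul_assoc,
      Matrix.mul_assoc, Matrix.mul_assoc, Matrix.nonsing_inv_mul_cancel_left _ _ hU',
      diagonal_sgn_mul_self, Matrix.mul_one, Matrix.transpose_nonsing_inv]

end Connection

/-! ### The relations of the system -/

section Relations

variable {n : ℕ}

theorem smul_qq (g : Shift n) : g • qq n = qq n := by
  rw [smul_ratField_def, qq, monomialAut_single]
  congr 2
  ext <;> simp [shiftExpo]

theorem smul_xx_self (v : Var n) : shiftOf v • xx v = qq n * xx v := by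
  rw [smul_ratField_def, qq, xx, monomialAut_single, ← map_mul, AddMonoidAlgebra.single_mul_single]
  congr 2
  · ext w
    · change (0 : ℤ) + ∑ u, (Pi.single v 1 : Var n → ℤ) u * (Pi.single v 1 : Var n → ℤ) u = 1 + 0
      rw [Finset.sum_eq_single v (fun u _ hu => by simp [hu]) (by simp)]
      simp
    · simp [shiftExpo]
  · simp

theorem smul_xx_of_ne {v w : Var n} (h : w ≠ v) : shiftOf w • xx v = xx v := by
  rw [smul_ratField_def, xx, monomialAut_single]
  congr 2
  ext u
  · simp only [shiftExpo, shiftOf, toAdd_ofAdd, AddEquiv.coe_mk, Equiv.coe_fn_mk]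
    rw [zero_add]
    refine Finset.sum_eq_zero fun u _ => ?_
    by_cases hu : u = w
    · subst hu; simp [h]
    · simp [hu]
  · simp [shiftExpo]

theorem qq_ne_zero : qq n ≠ 0 := by
  rw [qq, Ne, FaithfulSMul.algebraMap_eq_zero_iff]
  exact fun h => one_ne_zero (AddMonoidAlgebra.single_eq_zero.1 h)

theorem qInv_qInv (y : RatField n) : qInv n (qInv n y) = y := by
  unfold qInv
  rw [← monomialAut_comp (invExpo n) (invExpo n) (AddEquiv.refl _) (fun m => by simp [invExpo])]
  exact monomialAut_id _ (fun m => rfl) y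

/-- Coefficients fixed by `h` commute with `oper h`. The product is thus the image of a polynomial
over the commutative subring of fixed elements, where the generating identity for `elemSymm`
applies. -/
theorem prod_one_sub_scal_mul_oper {m : ℕ} (h : Shift n) (y : Fin m → RatField n)
    (hy : ∀ i, h • y i = y i) :
    (List.ofFn fun i => 1 - scal (y i) * oper h).prod =
      ∑ k ∈ Finset.range (m + 1), scal ((-1) ^ k * elemSymm k y) * oper h ^ k := by
  let R : Subring (RatField n) :=
    RingHom.eqLocus (MulSemiringAction.toRingHom (Shift n) (RatField n) h) (RingHom.id _)
  let f : Polynomial R →+* QWeyl n := Polynomial.eval₂RingHom' (scal.comp R.subtype) (oper h)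
    (fun r => by
      have h1 := oper_mul_scal h r.1
      have h2 : h • r.1 = r.1 := r.2
      rw [h2] at h1
      exact h1.symm)
  have hC : ∀ r : R, f (Polynomial.C r) = scal r.1 := fun r => by simp [f]
  have hX : f Polynomial.X = oper h := by simp [f]
  let x : Fin m → R := fun i => ⟨y i, hy i⟩
  have key := congrArg f (sum_elemSymm (fun i => Polynomial.C (x i)) Polynomial.X)
  have hl : (List.ofFn fun i => 1 - scal (y i) * oper h).prod =
      f (∏ i, (1 - Polynomial.C (x i) * Polynomial.X)) := by
    rw [← List.prod_ofFn, map_list_prod, List.map_ofFn]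
    congr 2
    ext1 i
    simp only [Function.comp_apply, map_sub, map_one, map_mul, hC, hX, x]
  rw [hl, ← key, map_sum]
  refine Finset.sum_congr rfl fun k _ => ?_
  have e1 : elemSymm k (fun i => Polynomial.C (x i)) = Polynomial.C (elemSymm k x) :=
    (map_elemSymm Polynomial.C k x).symm
  have e2 : ((elemSymm k x : R) : RatField n) = elemSymm k y := map_elemSymm R.subtype k x
  rw [e1, map_mul, map_mul, map_pow, map_pow, hX, hC, e2, map_mul, map_pow]
  simp only [map_neg, map_one]

theorem relT_eq : relT n = ∑ k ∈ Finset.range (n + 2),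
    scal ((-1) ^ k * coefE n k) * oper (shiftOf (vT n)) ^ k := by
  unfold relT
  rw [prod_one_sub_scal_mul_oper (shiftOf (vT n)) (fun j => (qq n)⁻¹ * bAll n j),
    prod_one_sub_scal_mul_oper (shiftOf (vT n)) (fun j => xx (vA j)), Finset.mul_sum,
    ← Finset.sum_sub_distrib]
  · refine Finset.sum_congr rfl fun k _ => ?_
    rw [← mul_assoc, ← map_mul, ← sub_mul, ← map_sub, coefE]
    simp only [div_eq_inv_mul]
    congr 2
    ring
  · exact fun j => smul_xx_of_ne (by simp)
  · intro j
    rw [smul_mul', smul_inv₀', smul_qq]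
    congr 1
    refine Fin.cases ?_ (fun j => ?_) j
    · exact smul_qq _
    · exact smul_xx_of_ne (by simp)

end Relations

/-! ### Powers of `σ_t` span the module -/

section Span

/-- The preimage of `S` under a semilinear bijection has the same dimension as `S` and contains `S`,
hence equals `S`. The relations control each shift in one direction only; this supplies the inverse.
-/
theorem symm_mem_of_forall_mem {K V : Type*} [Field K] [AddCommGroup V] [Module K V] (σ : K ≃+* K)
    (f : V ≃+ V) (hf : ∀ c v, f (c • v) = σ c • f v) (S : Submodule K V) [FiniteDimensional K S]
    (h : ∀ v ∈ S, f v ∈ S) {v : V} (hv : v ∈ S) : f.symm v ∈ S := by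
  let S' : Submodule K V :=
    { carrier := {v | f v ∈ S}
      add_mem' := fun {u v} hu hv => by
        rw [Set.mem_ofPred_eq, map_add]; exact S.add_mem hu hv
      zero_mem' := by rw [Set.mem_ofPred_eq, map_zero]; exact S.zero_mem
      smul_mem' := fun c v hv => by
        rw [Set.mem_ofPred_eq, hf]; exact S.smul_mem _ hv }
  let e : S' ≃+ S :=
    { toFun := fun v => ⟨f v.1, v.2⟩
      invFun := fun v => ⟨f.symm v.1, show f (f.symm v.1) ∈ S by rw [f.apply_symm_apply]; exact v.2⟩
      left_inv := fun v => by simp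
      right_inv := fun v => by simp
      map_add' := fun u v => by ext; simp }
  have hr : Module.rank K S' = Module.rank K S :=
    rank_eq_of_equiv_equiv σ e σ.bijective fun c v => by ext; exact hf c v.1
  have hfin : FiniteDimensional K S' := by
    rw [FiniteDimensional, ← Module.rank_lt_aleph0_iff, hr]
    exact Module.rank_lt_aleph0_iff.2 inferInstance
  have hle : S ≤ S' := fun v hv => h v hv
  have heq : S = S' := Submodule.eq_of_le_of_finrank_eq hle (by
    rw [Module.finrank, Module.finrank, hr])
  have : f.symm v ∈ S' := show f (f.symm v) ∈ S by rw [f.apply_symm_apply]; exact hv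
  rwa [heq]

variable {n : ℕ} {M : Type*} [AddCommGroup M] [Module (QWeyl n) M]

theorem scal_smul_smul (x y : RatField n) (m : M) :
    (scal x : QWeyl n) • (scal y : QWeyl n) • m = (scal (x * y) : QWeyl n) • m := by
  rw [map_mul, mul_smul]

theorem oper_smul_scal_smul (h : Shift n) (y : RatField n) (m : M) :
    (oper h : QWeyl n) • (scal y : QWeyl n) • m =
      (scal (h • y) : QWeyl n) • (oper h : QWeyl n) • m := by
  rw [← mul_smul, oper_mul_scal, mul_smul]

theorem oper_smul_smul (h h' : Shift n) (m : M) :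
    (oper h : QWeyl n) • (oper h' : QWeyl n) • m = (oper (h * h') : QWeyl n) • m := by
  rw [map_mul, mul_smul]

theorem shift_eq_prod (h : Shift n) : h = ∏ v, shiftOf v ^ (h.toAdd v) := by
  apply Multiplicative.toAdd.injective
  rw [toAdd_prod]
  ext w
  simp [shiftOf, Finset.sum_apply, Pi.single_apply]

theorem shift_mem_of_shiftOf_mem (H : Subgroup (Shift n)) (h : ∀ v, shiftOf v ∈ H) (g : Shift n) :
    g ∈ H := by
  rw [shift_eq_prod g]
  exact H.prod_mem fun v _ => H.zpow_mem (h v) _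

theorem coefE_last_ne_zero : coefE n (n + 1) ≠ 0 := by
  obtain ⟨a, b, q, h, -⟩ := exists_generic_parameters n
  obtain ⟨t, -, ht, h0⟩ := exists_of_countable_of_eventually_gen (p := fun _ => True) (by simp)
    (eventually_gen_ne_zero.and h.eventually_coefEValue_ne_zero)
  exact (hasValue_coefE h.q_ne_zero (h.point_ne_zero ht) (n + 1)).ne_zero h0

theorem one_sub_qq_inv_mul_xx_ne_zero (v : Var n) : 1 - (qq n)⁻¹ * xx v ≠ 0 := by
  intro h
  have h1 : xx v = qq n := by
    have hq := qq_ne_zero (n := n)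
    field_simp at h
    linear_combination -h
  have h2 := IsFractionRing.injective (Laurent n) (RatField n) h1
  have h3 := congrArg (fun f : Laurent n => f.coeff (1, 0)) h2
  simp at h3

/-- The additive subgroups stable under scalars that contain `n + 1` consecutive `σ_t`-powers of
the generator are everything. -/
theorem eq_top_of_consecutive (u : M) (hT : relT n • u = 0) (hA : ∀ i, relA (n := n) i • u = 0)
    (hB : ∀ j, relB (n := n) j • u = 0) (hu : ∀ m : M, ∃ P : QWeyl n, m = P • u)
    (N : AddSubgroup M) (hN : ∀ (y : RatField n), ∀ m ∈ N, (scal y : QWeyl n) • m ∈ N) (c : ℤ)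
    (hc : ∀ k ∈ Finset.range (n + 1), (oper (shiftOf (vT n) ^ (k + c)) : QWeyl n) • u ∈ N) :
    N = ⊤ := by
  classical
  let : Module (RatField n) M := Module.compHom M (scal (n := n))
  have hsm : ∀ (y : RatField n) (m : M), y • m = (scal y : QWeyl n) • m := fun _ _ => rfl
  let τ : Shift n := shiftOf (vT n)
  -- The plan is to show that `S` is stable under all shifts; as it contains the generator, it is
  -- then all of `M`.
  let S : Submodule (RatField n) M :=
    Submodule.span _ ((Finset.range (n + 1)).image fun k => (oper (τ ^ k) : QWeyl n) • u)
  have hfin : FiniteDimensional (RatField n) S := FiniteDimensional.span_finset _ _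
  have hmem : ∀ k ∈ Finset.range (n + 1), (oper (τ ^ k) : QWeyl n) • u ∈ S := fun k hk =>
    Submodule.subset_span (Finset.mem_coe.2 (Finset.mem_image_of_mem _ hk))
  have hu0 : u ∈ S := by
    have := hmem 0 (by simp)
    rwa [pow_zero, map_one, one_smul] at this
  have stable : ∀ h : Shift n,
      (∀ k ∈ Finset.range (n + 1), (oper h : QWeyl n) • (oper (τ ^ k) : QWeyl n) • u ∈ S) →
      ∀ m ∈ S, (oper h : QWeyl n) • m ∈ S := by
    intro h hk m hm
    induction hm using Submodule.span_induction with
    | mem x hx =>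
      obtain ⟨k, hk', rfl⟩ := Finset.mem_image.1 (Finset.mem_coe.1 hx)
      exact hk k hk'
    | zero => rw [smul_zero]; exact S.zero_mem
    | add x y _ _ hx hy => rw [smul_add]; exact S.add_mem hx hy
    | smul y x _ hx =>
      rw [hsm, oper_smul_scal_smul]
      exact S.smul_mem _ hx
  have hinv : ∀ h : Shift n, (∀ m ∈ S, (oper h : QWeyl n) • m ∈ S) →
      ∀ m ∈ S, (oper h⁻¹ : QWeyl n) • m ∈ S := by
    intro h hS m hm
    let f : M ≃+ M :=
      { toFun := fun m => (oper h : QWeyl n) • m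
        invFun := fun m => (oper h⁻¹ : QWeyl n) • m
        left_inv := fun m => by
          beta_reduce
          rw [oper_smul_smul, inv_mul_cancel, map_one, one_smul]
        right_inv := fun m => by
          beta_reduce
          rw [oper_smul_smul, mul_inv_cancel, map_one, one_smul]
        map_add' := fun m m' => smul_add _ _ _ }
    exact symm_mem_of_forall_mem (MulSemiringAction.toRingEquiv (Shift n) (RatField n) h) f
      (fun y m => oper_smul_scal_smul h y m) S hS hm
  -- The equation in `t` rewrites `σ_t^(n+1) u`, its leading coefficient `± (e_(n+1)(b/q) - t
  -- e_(n+1)(a))` being nonzero.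
  have hτ : ∀ m ∈ S, (oper τ : QWeyl n) • m ∈ S := by
    refine stable τ fun k hk => ?_
    rw [oper_smul_smul, ← pow_succ']
    obtain hk' | hk' := Nat.lt_or_ge (k + 1) (n + 1)
    · exact hmem _ (Finset.mem_range.2 hk')
    · have hkn : k + 1 = n + 1 := by have := Finset.mem_range.1 hk; omega
      rw [hkn]
      rw [relT_eq, Finset.sum_smul, Finset.sum_range_succ] at hT
      have h0 : (-1 : RatField n) ^ (n + 1) * coefE n (n + 1) ≠ 0 :=
        mul_ne_zero (by simp) coefE_last_ne_zero
      have h1 : (oper (τ ^ (n + 1)) : QWeyl n) • u =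
          ((-1 : RatField n) ^ (n + 1) * coefE n (n + 1))⁻¹ •
            -∑ k ∈ Finset.range (n + 1), ((-1) ^ k * coefE n k) • (oper (τ ^ k) : QWeyl n) • u := by
        rw [eq_inv_smul_iff₀ h0, eq_neg_iff_add_eq_zero, add_comm, ← hT]
        simp only [hsm, mul_smul, map_pow]
        rfl
      rw [h1]
      exact S.smul_mem _ (S.neg_mem (S.sum_mem fun k hk => S.smul_mem _ (hmem k hk)))
  -- Shifts commute, so it suffices to know where `h` sends the generator.
  have hcomm : ∀ h : Shift n, (oper h : QWeyl n) • u ∈ S → ∀ m ∈ S, (oper h : QWeyl n) • m ∈ S := by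
    intro h hh
    refine stable h fun k hk => ?_
    clear hk
    rw [oper_smul_smul, mul_comm, ← oper_smul_smul]
    induction k with
    | zero => simpa using hh
    | succ k ih => rw [pow_succ', ← oper_smul_smul]; exact hτ _ ih
  have hq := qq_ne_zero (n := n)
  let H : Subgroup (Shift n) :=
    { carrier := {h | (∀ m ∈ S, (oper h : QWeyl n) • m ∈ S) ∧
        ∀ m ∈ S, (oper h⁻¹ : QWeyl n) • m ∈ S}
      one_mem' := ⟨fun m hm => by rwa [map_one, one_smul],
        fun m hm => by rwa [inv_one, map_one, one_smul]⟩
      mul_mem' := fun {g h} hg hh => ⟨fun m hm => by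
          rw [← oper_smul_smul]; exact hg.1 _ (hh.1 _ hm), fun m hm => by
          rw [_root_.mul_inv, ← oper_smul_smul]; exact hg.2 _ (hh.2 _ hm)⟩
      inv_mem' := fun {h} hh => ⟨hh.2, by rw [inv_inv]; exact hh.1⟩ }
  have hH : ∀ v, shiftOf v ∈ H := by
    rintro (_ | i | j)
    · exact ⟨hτ, hinv τ hτ⟩
    -- Applying `σ_{a_i}` to its relation gives `(1 - a_i) σ_{a_i} u = u - a_i σ_t u`. For `b_j` the
    -- relation itself yields `σ_{b_j}⁻¹ u`.
    · have h1 : (oper (shiftOf (vA i)) : QWeyl n) • u ∈ S := by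
        have h2 := congrArg (fun m => (oper (shiftOf (vA i)) : QWeyl n) • m) (hA i)
        simp only [relA, sub_smul, mul_smul, smul_sub, smul_zero, oper_smul_scal_smul,
          oper_smul_smul] at h2
        rw [mul_inv_cancel, map_one, one_smul, mul_left_comm, mul_inv_cancel, mul_one] at h2
        have e1 : shiftOf (vA i) • ((qq n)⁻¹ * xx (vA i)) = xx (vA i) := by
          rw [smul_mul', smul_inv₀', smul_qq, smul_xx_self, inv_mul_cancel_left₀ hq]
        rw [e1, smul_one] at h2
        have h3 : (1 : RatField n) - xx (vA i) ≠ 0 := by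
          have h4 := one_sub_qq_inv_mul_xx_ne_zero (vA i)
          have h5 := smul_ne_zero_iff_ne (shiftOf (vA i)) |>.2 h4
          rwa [smul_sub, smul_one, e1] at h5
        have h6 : (oper (shiftOf (vA i)) : QWeyl n) • u =
            ((1 : RatField n) - xx (vA i))⁻¹ • (u - xx (vA i) • (oper τ : QWeyl n) • u) := by
          rw [eq_inv_smul_iff₀ h3]
          exact (sub_eq_zero.1 h2).symm
        rw [h6]
        exact S.smul_mem _ (S.sub_mem hu0 (S.smul_mem _ (hτ u hu0)))
      exact ⟨hcomm _ h1, hinv _ (hcomm _ h1)⟩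
    · have h1 : (oper (shiftOf (vB j))⁻¹ : QWeyl n) • u ∈ S := by
        have h2 := hB j
        simp only [relB, sub_smul, mul_smul, one_smul] at h2
        have h6 : (oper (shiftOf (vB j))⁻¹ : QWeyl n) • u =
            ((1 : RatField n) - (qq n)⁻¹ * xx (vB j))⁻¹ •
              (u - ((qq n)⁻¹ * xx (vB j)) • (oper τ : QWeyl n) • u) := by
          rw [eq_inv_smul_iff₀ (one_sub_qq_inv_mul_xx_ne_zero (vB j))]
          exact (sub_eq_zero.1 h2).symm
        rw [h6]
        exact S.smul_mem _ (S.sub_mem hu0 (S.smul_mem _ (hτ u hu0)))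
      have h2 := hinv _ (hcomm _ h1)
      rw [inv_inv] at h2
      exact ⟨h2, hcomm _ h1⟩
  have hall : ∀ (h : Shift n), ∀ m ∈ S, (oper h : QWeyl n) • m ∈ S := fun h =>
    (shift_mem_of_shiftOf_mem H hH h).1
  have hStop : ∀ m : M, m ∈ S := by
    intro m
    obtain ⟨P, rfl⟩ := hu m
    induction P using SkewMonoidAlgebra.induction_on with
    | zero => rw [zero_smul]; exact S.zero_mem
    | single g y =>
      have : (SkewMonoidAlgebra.single g y : QWeyl n) = scal y * oper g := by
        simp [SkewMonoidAlgebra.of_apply, SkewMonoidAlgebra.singleOneRingHom,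
          SkewMonoidAlgebra.single_mul_single]
      rw [this, mul_smul]
      exact S.smul_mem _ (hall g u hu0)
    | add P Q hP hQ => rw [add_smul]; exact S.add_mem hP hQ
  rw [eq_top_iff]
  intro m _
  -- `σ_t^c` maps `S` into `N`. Since `S` is everything and `σ_t^c` is bijective, so is `N`.
  have hm : ∀ m ∈ S, (oper (τ ^ c) : QWeyl n) • m ∈ N := by
    intro m hm
    induction hm using Submodule.span_induction with
    | mem x hx =>
      obtain ⟨k, hk, rfl⟩ := Finset.mem_image.1 (Finset.mem_coe.1 hx)
      have := hc k hk
      rwa [add_comm, _root_.zpow_add, ← oper_smul_smul, zpow_natCast] at this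
    | zero => rw [smul_zero]; exact N.zero_mem
    | add x y _ _ hx hy => rw [smul_add]; exact N.add_mem hx hy
    | smul y x _ hx =>
      rw [hsm, oper_smul_scal_smul]
      exact hN _ _ hx
  have := hm _ (hStop ((oper (τ ^ c)⁻¹ : QWeyl n) • m))
  rwa [oper_smul_smul, mul_inv_cancel, map_one, one_smul] at this

end Span

/-! ### Function spaces as modules over the `q`-Weyl algebra -/

/-- A family of evaluations of `ℚ(t,a,b,q)`, indexed by the group of shifts and compatible with it
through the endomorphism `move`. -/
structure EvalSystem (n : ℕ) where
  /-- The evaluations. -/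
  ev : Shift n → RatField n →+* ℂ
  /-- The effect of a shift on the index. -/
  move : Shift n →* Shift n
  /-- The value of `q`. -/
  q : ℂ
  /-- The values of `t`, `a`, `b`. -/
  x : Shift n → Var n → ℂ
  ev_move : ∀ g h y, ev (g * move h) y = ev g (h • y)
  ev_qq : ∀ g, ev g (qq n) = q
  ev_xx : ∀ g v, ev g (xx v) = x g v
  x_move : ∀ g h, x (g * move h) = shiftPoint q h (x g)

namespace EvalSystem

variable {n : ℕ} (E : EvalSystem n)

/-- The value of `t`. -/
abbrev t (g : Shift n) : ℂ := E.x g (vT n)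

/-- The values of the `aᵢ`. -/
abbrev a (g : Shift n) : Fin (n + 1) → ℂ := fun i => E.x g (vA i)

/-- The values of the `bⱼ`. -/
abbrev b (g : Shift n) : Fin n → ℂ := fun j => E.x g (vB j)

/-- Complex functions on the group of shifts. -/
def Space (_ : EvalSystem n) := Shift n → ℂ

instance : AddCommGroup E.Space := inferInstanceAs (AddCommGroup (Shift n → ℂ))

/-- The action of scalars on functions. -/
def scalHom : RatField n →+* AddMonoid.End E.Space where
  toFun y :=
    { toFun := fun φ => (fun g => E.ev g y * φ g : Shift n → ℂ)
      map_zero' := funext fun g => mul_zero (E.ev g y)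
      map_add' := fun φ ψ => funext fun g => mul_add (E.ev g y) (φ g) (ψ g) }
  map_one' := AddMonoidHom.ext fun φ => funext fun g => by
    change E.ev g 1 * φ g = φ g
    rw [map_one, one_mul]
  map_mul' y z := AddMonoidHom.ext fun φ => funext fun g => by
    change E.ev g (y * z) * φ g = E.ev g y * (E.ev g z * φ g)
    rw [map_mul, mul_assoc]
  map_zero' := AddMonoidHom.ext fun φ => funext fun g => by
    change E.ev g 0 * φ g = 0
    rw [map_zero, zero_mul]
  map_add' y z := AddMonoidHom.ext fun φ => funext fun g => by
    change E.ev g (y + z) * φ g = E.ev g y * φ g + E.ev g z * φ g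
    rw [map_add, add_mul]

/-- The action of shifts on functions. -/
def operHom : Shift n →* AddMonoid.End E.Space where
  toFun h :=
    { toFun := fun φ => (fun g => φ (g * E.move h) : Shift n → ℂ)
      map_zero' := rfl
      map_add' := fun φ ψ => rfl }
  map_one' := AddMonoidHom.ext fun φ => funext fun g => by
    change φ (g * E.move 1) = φ g
    rw [map_one, mul_one]
  map_mul' h h' := AddMonoidHom.ext fun φ => funext fun g => by
    change φ (g * E.move (h * h')) = φ (g * E.move h * E.move h')
    rw [map_mul, mul_assoc]

/-- The action of the `q`-Weyl algebra on functions. -/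
def weylHom : QWeyl n →+* AddMonoid.End E.Space :=
  SkewMonoidAlgebra.liftNCRingHom E.scalHom E.operHom (by
    intro y h
    refine AddMonoidHom.ext fun φ => funext fun g => ?_
    change E.ev g (h • y) * φ (g * E.move h) = E.ev (g * E.move h) y * φ (g * E.move h)
    rw [E.ev_move])

instance : Module (QWeyl n) E.Space := Module.compHom E.Space E.weylHom

theorem scal_smul_apply (y : RatField n) (φ : E.Space) (g : Shift n) :
    ((scal y : QWeyl n) • φ) g = E.ev g y * φ g := by
  change E.weylHom (scal y) φ g = _
  have : E.weylHom (scal y) = E.scalHom y := by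
    refine (SkewMonoidAlgebra.liftNC_single _ _ _ _).trans ?_
    rw [map_one]
    exact mul_one _
  rw [this]
  rfl

theorem oper_smul_apply (h : Shift n) (φ : E.Space) (g : Shift n) :
    ((oper h : QWeyl n) • φ) g = φ (g * E.move h) := by
  change E.weylHom (oper h) φ g = _
  have : E.weylHom (oper h) = E.operHom h := by
    refine (SkewMonoidAlgebra.liftNC_single _ _ _ _).trans ?_
    change E.scalHom 1 * _ = _
    rw [map_one, one_mul]
  rw [this]
  rfl

theorem add_apply (φ ψ : E.Space) (g : Shift n) : (φ + ψ) g = φ g + ψ g := rfl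

theorem sub_apply (φ ψ : E.Space) (g : Shift n) : (φ - ψ) g = φ g - ψ g := rfl

theorem zero_apply (g : Shift n) : (0 : E.Space) g = 0 := rfl

/-- The values of the solutions. -/
def sols (j : Fin (n + 1)) : E.Space := fun g => sol (E.a g) (E.b g) E.q j (E.t g)

/-- The parameters are admissible and the solutions satisfy the equations of the system at all the
points of the family. -/
structure Good : Prop where
  nonResonant : ∀ g, NonResonant (E.a g) (E.b g) E.q
  recurrence : ∀ g j, ∑ k ∈ Finset.range (n + 2), (-1) ^ k *
      (elemSymm k (fun i => bFull (E.b g) E.q i / E.q) - E.t g * elemSymm k (E.a g)) *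
        sol (E.a g) (E.b g) E.q j (E.q ^ k * E.t g) = 0
  update_a : ∀ g i j, sol (E.a g) (E.b g) E.q j (E.t g) -
      E.a g i * sol (E.a g) (E.b g) E.q j (E.q * E.t g) =
        (1 - E.a g i) * sol (Function.update (E.a g) i (E.q * E.a g i)) (E.b g) E.q j (E.t g)
  update_b : ∀ g i j, sol (E.a g) (Function.update (E.b g) i (E.q * E.b g i)) E.q j (E.t g) -
      E.b g i * sol (E.a g) (Function.update (E.b g) i (E.q * E.b g i)) E.q j (E.q * E.t g) =
        (1 - E.b g i) * sol (E.a g) (E.b g) E.q j (E.t g)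

theorem ev_coefE (g : Shift n) (k : ℕ) : E.ev g (coefE n k) =
    elemSymm k (fun i => bFull (E.b g) E.q i / E.q) - E.t g * elemSymm k (E.a g) := by
  have h : ∀ i, E.ev g (bAll n i) = bFull (E.b g) E.q i :=
    fun i => Fin.cases (E.ev_qq g) (fun j => E.ev_xx g (vB j)) i
  rw [coefE, map_sub, map_mul, map_elemSymm, map_elemSymm, E.ev_xx]
  simp only [map_div₀, h, E.ev_qq, E.ev_xx]

theorem sols_mul_move (g h : Shift n) (j : Fin (n + 1)) : E.sols j (g * E.move h) =
    sol (fun i => E.q ^ (h.toAdd (vA i)) * E.a g i) (fun i => E.q ^ (h.toAdd (vB i)) * E.b g i) E.q j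
      (E.q ^ (h.toAdd (vT n)) * E.t g) := by
  change sol (fun i => E.x (g * E.move h) (vA i)) (fun i => E.x (g * E.move h) (vB i)) E.q j
    (E.x (g * E.move h) (vT n)) = _
  rw [E.x_move]
  rfl

theorem sols_mul_move_pow (g : Shift n) (j : Fin (n + 1)) (k : ℕ) :
    E.sols j (g * E.move (shiftOf (vT n) ^ k)) =
      sol (E.a g) (E.b g) E.q j (E.q ^ k * E.t g) := by
  rw [sols_mul_move]
  simp [shiftOf]

theorem q_pow_single_mul {ι : Type*} [DecidableEq ι] (i : ι) (q : ℂ) (f : ι → ℂ) :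
    (fun l => q ^ (if l = i then (1 : ℤ) else 0) * f l) = Function.update f i (q * f i) := by
  ext l
  by_cases hl : l = i
  · subst hl; simp
  · simp [hl]

theorem sols_mul_move_a (g : Shift n) (i : Fin (n + 1)) (j : Fin (n + 1)) :
    E.sols j (g * E.move (shiftOf (vA i))) =
      sol (Function.update (E.a g) i (E.q * E.a g i)) (E.b g) E.q j (E.t g) := by
  rw [sols_mul_move, ← q_pow_single_mul]
  simp [shiftOf, Pi.single_apply]

theorem sols_mul_move_b (g : Shift n) (i : Fin n) (j : Fin (n + 1)) :
    E.sols j (g * E.move (shiftOf (vB i))) =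
      sol (E.a g) (Function.update (E.b g) i (E.q * E.b g i)) E.q j (E.t g) := by
  rw [sols_mul_move, ← q_pow_single_mul]
  simp [shiftOf, Pi.single_apply]

theorem sols_mul_move_b_t (g : Shift n) (i : Fin n) (j : Fin (n + 1)) :
    E.sols j (g * E.move (shiftOf (vB i) * shiftOf (vT n))) =
      sol (E.a g) (Function.update (E.b g) i (E.q * E.b g i)) E.q j (E.q * E.t g) := by
  rw [sols_mul_move, ← q_pow_single_mul]
  simp [shiftOf, Pi.single_apply]

variable {E}

theorem Good.relT_smul (hE : E.Good) (j : Fin (n + 1)) : relT n • E.sols j = 0 := by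
  rw [relT_eq, Finset.sum_smul]
  funext g
  have happ : ∀ (s : Finset ℕ) (f : ℕ → E.Space), (∑ k ∈ s, f k) g = ∑ k ∈ s, f k g := by
    intro s f
    exact Finset.sum_apply (M := fun _ => ℂ) g s f
  rw [happ, E.zero_apply, ← hE.recurrence g j]
  refine Finset.sum_congr rfl fun k _ => ?_
  rw [mul_smul, ← map_pow, E.scal_smul_apply, E.oper_smul_apply, sols_mul_move_pow, map_mul,
    E.ev_coefE, map_pow, map_neg, map_one]

theorem Good.relA_smul (hE : E.Good) (i j : Fin (n + 1)) : relA i • E.sols j = 0 := by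
  have hq := (hE.nonResonant 1).q_ne_zero
  funext g
  simp only [relA, sub_smul, mul_smul, one_smul, E.sub_apply, E.scal_smul_apply, E.oper_smul_apply,
    map_sub, map_one, map_mul, map_inv₀, E.ev_qq, E.ev_xx, E.zero_apply]
  -- The relation involves `σ_{a_i}⁻¹`, so at `g` it is the contiguity relation of the solutions at
  -- the preceding point `g'`.
  set g' := g * (E.move (shiftOf (vA i)))⁻¹ with hg'
  have hg : g = g' * E.move (shiftOf (vA i)) := by rw [hg', inv_mul_cancel_right]
  have h1 := hE.update_a g' i j
  have h2 := E.sols_mul_move_pow g' j 1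
  rw [pow_one, pow_one] at h2
  rw [← h2, ← E.sols_mul_move_a, ← hg] at h1
  have h3 : E.x g (vA i) = E.q * E.a g' i := by
    rw [hg, E.x_move]
    simp [shiftPoint, shiftOf]
  rw [h3, map_inv, mul_assoc E.q, inv_mul_cancel_left₀ hq, mul_assoc E.q, inv_mul_cancel_left₀ hq, show g * E.move (shiftOf (vT n)) * (E.move (shiftOf (vA i)))⁻¹ =
    g' * E.move (shiftOf (vT n)) by rw [hg']; exact mul_right_comm _ _ _]
  change E.sols j g' - _ = _ at h1
  linear_combination h1

theorem Good.relB_smul (hE : E.Good) (i : Fin n) (j : Fin (n + 1)) : relB i • E.sols j = 0 := by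
  have hq := (hE.nonResonant 1).q_ne_zero
  funext g
  simp only [relB, sub_smul, mul_smul, one_smul, E.sub_apply, E.scal_smul_apply, E.oper_smul_apply,
    map_sub, map_one, map_mul, map_inv₀, E.ev_qq, E.ev_xx, E.zero_apply]
  set g' := g * (E.move (shiftOf (vB i)))⁻¹ with hg'
  have hg : g = g' * E.move (shiftOf (vB i)) := by rw [hg', inv_mul_cancel_right]
  have h1 := hE.update_b g' i j
  rw [← E.sols_mul_move_b_t, ← E.sols_mul_move_b, map_mul, ← mul_assoc, ← hg] at h1
  have h3 : E.x g (vB i) = E.q * E.b g' i := by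
    rw [hg, E.x_move]
    simp [shiftPoint, shiftOf]
  rw [h3, map_inv, mul_assoc E.q, inv_mul_cancel_left₀ hq, mul_assoc E.q, inv_mul_cancel_left₀ hq]
  change _ = (1 - E.b g' i) * E.sols j g' at h1
  linear_combination h1

/-- The map from the module of the system to functions, given by a solution. -/
def Good.toSpace (hE : E.Good) (j : Fin (n + 1)) : heineModule n →ₗ[QWeyl n] E.Space :=
  Submodule.liftQ _ (LinearMap.toSpanSingleton (QWeyl n) E.Space (E.sols j)) (by
    rw [Submodule.span_le]
    rintro P ((hP | ⟨i, rfl⟩) | ⟨i, rfl⟩)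
    · rw [Set.mem_singleton_iff.1 hP]
      exact hE.relT_smul j
    · exact hE.relA_smul i j
    · exact hE.relB_smul i j)

/-- The generator of the module of the system. -/
def _root_.Heine.generator (n : ℕ) : heineModule n := Submodule.Quotient.mk 1

theorem Good.toSpace_generator (hE : E.Good) (j : Fin (n + 1)) :
    hE.toSpace j (generator n) = E.sols j := by
  change (LinearMap.toSpanSingleton (QWeyl n) E.Space (E.sols j)) 1 = _
  rw [LinearMap.toSpanSingleton_apply, one_smul]

end EvalSystem

theorem eq_smul_generator {n : ℕ} (m : heineModule n) : ∃ P : QWeyl n, m = P • generator n := by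
  obtain ⟨P, rfl⟩ := Submodule.Quotient.mk_surjective _ m
  refine ⟨P, ?_⟩
  rw [generator, ← Submodule.Quotient.mk_smul, smul_eq_mul, mul_one]

theorem smul_generator_eq_zero {n : ℕ} {P : QWeyl n}
    (hP : P ∈ ({relT n} ∪ Set.range (relA (n := n)) ∪ Set.range (relB (n := n)) : Set (QWeyl n))) :
    P • generator n = 0 := by
  rw [generator, ← Submodule.Quotient.mk_smul, smul_eq_mul, mul_one,
    Submodule.Quotient.mk_eq_zero]
  exact Submodule.subset_span hP

theorem eq_top_of_generator {n : ℕ} (N : AddSubgroup (heineModule n))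
    (hN : ∀ (y : RatField n), ∀ m ∈ N, (scal y : QWeyl n) • m ∈ N) (c : ℤ)
    (hc : ∀ k ∈ Finset.range (n + 1),
      (oper (shiftOf (vT n) ^ (k + c)) : QWeyl n) • generator n ∈ N) : N = ⊤ :=
  eq_top_of_consecutive (generator n) (smul_generator_eq_zero (Or.inl (Or.inl rfl)))
    (fun i => smul_generator_eq_zero (Or.inl (Or.inr ⟨i, rfl⟩)))
    (fun j => smul_generator_eq_zero (Or.inr ⟨j, rfl⟩)) eq_smul_generator N hN c hc

/-! ### Perfect pairings between `M^∧` and `M` -/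

section Duality

variable {n : ℕ}

theorem single_eq_scal_mul_oper (g : Shift n) (y : RatField n) :
    (SkewMonoidAlgebra.single g y : QWeyl n) = scal y * oper g := by
  simp [SkewMonoidAlgebra.of_apply, SkewMonoidAlgebra.singleOneRingHom,
    SkewMonoidAlgebra.single_mul_single]

theorem weylInv_single (g : Shift n) (y : RatField n) :
    weylInv n (SkewMonoidAlgebra.single g y) = scal (qInv n y) * oper g⁻¹ :=
  SkewMonoidAlgebra.liftNC_single _ _ _ _

theorem vee_single_smul_apply {M : Type*} [AddCommGroup M] [Module (QWeyl n) M] (g : Shift n)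
    (y : RatField n) (l : Vee n M) (m : M) :
    ((SkewMonoidAlgebra.single g y : QWeyl n) • l).1 m = y * g • l.1 ((oper g⁻¹ : QWeyl n) • m) := by
  change (veeHom n M (SkewMonoidAlgebra.single g y) l).1 m = _
  have : veeHom n M (SkewMonoidAlgebra.single g y) = veeScal n M y * veeShift n M g :=
    SkewMonoidAlgebra.liftNC_single _ _ _ _
  rw [this]
  rfl

theorem exists_sum_of_generator (m : heineModule n) : ∃ c : Fin (n + 1) → RatField n,
    m = ∑ i, (scal (c i) : QWeyl n) • (oper (shiftOf (vT n) ^ i.val) : QWeyl n) • generator n := by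
  let N : AddSubgroup (heineModule n) :=
    { carrier := {m | ∃ c : Fin (n + 1) → RatField n, m = ∑ i, (scal (c i) : QWeyl n) •
        (oper (shiftOf (vT n) ^ i.val) : QWeyl n) • generator n}
      zero_mem' := ⟨0, by simp only [Pi.zero_apply, map_zero, zero_smul, Finset.sum_const_zero]⟩
      add_mem' := by
        rintro _ _ ⟨c, rfl⟩ ⟨d, rfl⟩
        refine ⟨c + d, ?_⟩
        rw [← Finset.sum_add_distrib]
        exact Finset.sum_congr rfl fun i _ => by rw [Pi.add_apply, map_add, add_smul]
      neg_mem' := by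
        rintro _ ⟨c, rfl⟩
        refine ⟨-c, ?_⟩
        rw [← Finset.sum_neg_distrib]
        exact Finset.sum_congr rfl fun i _ => by rw [Pi.neg_apply, map_neg, neg_smul] }
  have hN : N = ⊤ := by
    refine eq_top_of_generator N ?_ 0 ?_
    · rintro y _ ⟨c, rfl⟩
      refine ⟨fun i => y * c i, ?_⟩
      rw [Finset.smul_sum]
      exact Finset.sum_congr rfl fun i _ => scal_smul_smul _ _ _
    · intro k hk
      refine ⟨Pi.single ⟨k, Finset.mem_range.1 hk⟩ 1, ?_⟩
      rw [Finset.sum_eq_single ⟨k, Finset.mem_range.1 hk⟩]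
      · rw [Pi.single_eq_same, map_one, one_smul, add_zero, zpow_natCast]
      · intro i _ hi
        rw [Pi.single_eq_of_ne hi, map_zero, zero_smul]
      · simp
  have : m ∈ N := by rw [hN]; trivial
  exact this

/-- The compatibilities make `m' ↦ B m' _` a morphism from `M^∧` to `M^∨`. The `n + 1` elements
`σ_t^i` applied to the generator span `M`, so an invertible Gram matrix gives bijectivity without
prior knowledge of the dimension of `M`. -/
theorem nonempty_equiv_of_pairing (B : heineModule n → heineModule n → RatField n)
    (hadd_left : ∀ m₁ m₂ m, B (m₁ + m₂) m = B m₁ m + B m₂ m)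
    (hadd_right : ∀ m' m₁ m₂, B m' (m₁ + m₂) = B m' m₁ + B m' m₂)
    (hscal_left : ∀ y m' m, B ((scal y : QWeyl n) • m') m = qInv n y * B m' m)
    (hscal_right : ∀ y m' m, B m' ((scal y : QWeyl n) • m) = y * B m' m)
    (hoper : ∀ h m' m, B ((oper h : QWeyl n) • m') m = h⁻¹ • B m' ((oper h : QWeyl n) • m))
    (hdet : (Matrix.of fun i k : Fin (n + 1) =>
      B ((oper (shiftOf (vT n) ^ i.val) : QWeyl n) • generator n)
        ((oper (shiftOf (vT n) ^ k.val) : QWeyl n) • generator n)).det ≠ 0) :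
    Nonempty (Vee n (heineModule n) ≃ₗ[QWeyl n] Wedge (heineModule n)) := by
  set G := Matrix.of fun i k : Fin (n + 1) =>
      B ((oper (shiftOf (vT n) ^ i.val) : QWeyl n) • generator n)
        ((oper (shiftOf (vT n) ^ k.val) : QWeyl n) • generator n) with hG
  let A : heineModule n →+ heineModule n →+ RatField n :=
    AddMonoidHom.mk' (fun m' => AddMonoidHom.mk' (B m') (hadd_right m'))
      (fun m₁ m₂ => AddMonoidHom.ext (hadd_left m₁ m₂))
  have hA : ∀ m' m, A m' m = B m' m := fun _ _ => rfl
  let L : heineModule n → Vee n (heineModule n) := fun m' => ⟨A m', fun y m => hscal_right y m' m⟩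
  have key : ∀ (P : QWeyl n) (m' m : heineModule n), A (weylInv n P • m') m = (P • L m').1 m := by
    intro P m' m
    induction P using SkewMonoidAlgebra.induction_on with
    | zero => rw [map_zero, zero_smul, zero_smul, map_zero]; rfl
    | single g y =>
      rw [vee_single_smul_apply, weylInv_single, mul_smul, hA, hscal_left, qInv_qInv, hoper,
        inv_inv]
      rfl
    | add P Q hP hQ =>
      rw [map_add, add_smul, add_smul, map_add, AddMonoidHom.add_apply, hP, hQ]
      rfl
  let Λ : Wedge (heineModule n) →ₗ[QWeyl n] Vee n (heineModule n) :=
    { toFun := L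
      map_add' := fun m₁ m₂ => Subtype.ext (A.map_add m₁ m₂)
      map_smul' := fun P m' => Subtype.ext (AddMonoidHom.ext fun m => key P m' m) }
  have hval : ∀ (c : Fin (n + 1) → RatField n) (k : Fin (n + 1)),
      A (∑ i, (scal (c i) : QWeyl n) • (oper (shiftOf (vT n) ^ i.val) : QWeyl n) • generator n)
        ((oper (shiftOf (vT n) ^ k.val) : QWeyl n) • generator n) =
      ((fun i => qInv n (c i)) ᵥ* G) k := by
    intro c k
    rw [map_sum, AddMonoidHom.finsetSum_apply]
    exact Finset.sum_congr rfl fun i _ => hscal_left _ _ _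
  refine ⟨(LinearEquiv.ofBijective Λ ⟨?_, ?_⟩).symm⟩
  · rw [injective_iff_map_eq_zero]
    intro m' hm'
    obtain ⟨c, hc⟩ := exists_sum_of_generator (show heineModule n from m')
    have h0 : (fun i => qInv n (c i)) ᵥ* G = 0 := by
      ext k
      rw [← hval, ← hc]
      exact DFunLike.congr_fun (congrArg Subtype.val hm') _
    have h1 := Matrix.eq_zero_of_vecMul_eq_zero hdet h0
    have h2 : ∀ i, c i = 0 := fun i => (map_eq_zero (qInv n)).1 (congrFun h1 i)
    refine hc.trans (Finset.sum_eq_zero fun i _ => ?_)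
    rw [h2, map_zero, zero_smul]
  · intro l
    let d : Fin (n + 1) → RatField n := fun k =>
      l.1 ((oper (shiftOf (vT n) ^ k.val) : QWeyl n) • generator n)
    -- The coefficients are found by inverting the Gram matrix; `qInv` compensates for the
    -- semilinearity in the first argument.
    let c : Fin (n + 1) → RatField n := fun i => qInv n ((d ᵥ* G⁻¹) i)
    let m' : heineModule n :=
      ∑ i, (scal (c i) : QWeyl n) • (oper (shiftOf (vT n) ^ i.val) : QWeyl n) • generator n
    refine ⟨m', Subtype.ext ?_⟩
    change A m' = l.1
    rw [← sub_eq_zero]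
    have hker : (A m' - l.1).ker = ⊤ := by
      refine eq_top_of_generator _ ?_ 0 ?_
      · intro y m hm
        rw [AddMonoidHom.mem_ker] at hm ⊢
        rw [AddMonoidHom.sub_apply] at hm ⊢
        rw [l.2 y m, hA, hscal_right, ← hA, ← mul_sub, hm, mul_zero]
      · intro k hk
        rw [AddMonoidHom.mem_ker, AddMonoidHom.sub_apply, sub_eq_zero, add_zero, zpow_natCast]
        refine (hval c ⟨k, Finset.mem_range.1 hk⟩).trans ?_
        have : (fun i => qInv n (c i)) = d ᵥ* G⁻¹ := funext fun i => qInv_qInv _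
        rw [this, Matrix.vecMul_vecMul, Matrix.nonsing_inv_mul _ (isUnit_iff_ne_zero.2 hdet),
          Matrix.vecMul_one]
    refine AddMonoidHom.ext fun m => ?_
    have : m ∈ (A m' - l.1).ker := by rw [hker]; trivial
    exact this

end Duality

/-! ### The evaluation systems of a generic point -/

section GenericSystems

variable {n : ℕ} {q : ℂ} {x : Var n → ℂ}

/-- The evaluations at the shifts of a generic point. -/
def evalSystem (hq : q ≠ 0) (hx : ∀ v, x v ≠ 0) (hg : IsGenericPoint q x) : EvalSystem n where
  ev g := (evalField hq hx hg).comp (MulSemiringAction.toRingHom (Shift n) (RatField n) g)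
  move := MonoidHom.id _
  q := q
  x g := shiftPoint q g x
  ev_move g h y := congrArg (evalField hq hx hg) (mul_smul g h y)
  ev_qq g := HasValue.evalField_eq hq hx hg
    (HasValue.smul hq hx (hasValue_qq hq (shiftPoint_ne_zero hq hx g)))
  ev_xx g v := HasValue.evalField_eq hq hx hg
    (HasValue.smul hq hx (hasValue_xx hq (shiftPoint_ne_zero hq hx g) v))
  x_move g h := by
    ext v
    change q ^ (g.toAdd v + h.toAdd v) * x v = q ^ h.toAdd v * (q ^ g.toAdd v * x v)
    rw [zpow_add₀ hq]
    ring

/-- The evaluations at the shifts of a generic point, preceded by `q ↦ q⁻¹`. -/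
def evalSystemInv (hq : q ≠ 0) (hx : ∀ v, x v ≠ 0) (hg : IsGenericPoint q x) : EvalSystem n where
  ev g := ((evalField hq hx hg).comp (MulSemiringAction.toRingHom (Shift n) (RatField n) g)).comp
    (qInv n).toRingHom
  move := invMonoidHom
  q := q⁻¹
  x g := shiftPoint q g x
  ev_move g h y := by
    change evalField hq hx hg ((g * h⁻¹) • qInv n y) = evalField hq hx hg (g • qInv n (h • y))
    rw [mul_smul, qInv_smul]
  ev_qq g := HasValue.evalField_eq hq hx hg (HasValue.smul hq hx
    (HasValue.qInv hq (shiftPoint_ne_zero hq hx g)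
      (hasValue_qq (inv_ne_zero hq) (shiftPoint_ne_zero hq hx g))))
  ev_xx g v := HasValue.evalField_eq hq hx hg (HasValue.smul hq hx
    (HasValue.qInv hq (shiftPoint_ne_zero hq hx g)
      (hasValue_xx (inv_ne_zero hq) (shiftPoint_ne_zero hq hx g) v)))
  x_move g h := by
    ext v
    change q ^ (g.toAdd v + -h.toAdd v) * x v = q⁻¹ ^ h.toAdd v * (q ^ g.toAdd v * x v)
    rw [zpow_add₀ hq, _root_.inv_zpow']
    ring

end GenericSystems

/-! ### Self-duality of the module of the system -/

section SelfDual

variable {n : ℕ}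

/-- The shift that multiplies every `bⱼ` by `q`. -/
def shiftB (n : ℕ) : Shift n := Multiplicative.ofAdd (Sum.elim 0 (Sum.elim 0 1))

theorem NonResonant.countable_not_forall {a : Fin (n + 1) → ℂ} {b : Fin n → ℂ} {q : ℂ}
    (h : NonResonant a b q) {p : (Var n → ℂ) → Prop}
    (hp : ∀ a b, NonResonant a b q → ∀ᶠ t in gen, p (point t a b)) :
    ∀ g : Shift n, {t | ¬ p (shiftPoint q g (point t a b))}.Countable := by
  intro g
  have h1 := (tendsto_mul_gen (zpow_ne_zero (g.toAdd (vT n)) h.q_ne_zero)).eventually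
    (hp _ _ (h.shift (fun i => g.toAdd (vA i)) (fun j => g.toAdd (vB j))))
  refine (countable_of_mem_gen h1).mono fun t ht => ?_
  rwa [Set.mem_ofPred_eq, shiftPoint_point] at ht

/-- The conditions on a point for the solutions to satisfy the equations of the system there. -/
def GoodAt (q : ℂ) (x : Var n → ℂ) : Prop :=
  let t := x (vT n)
  let a := fun i => x (vA i)
  let b := fun j => x (vB j)
  NonResonant a b q ∧
  (∀ j, ∑ k ∈ Finset.range (n + 2), (-1) ^ k *
      (elemSymm k (fun i => bFull b q i / q) - t * elemSymm k a) * sol a b q j (q ^ k * t) = 0) ∧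
  (∀ i j, sol a b q j t - a i * sol a b q j (q * t) =
      (1 - a i) * sol (Function.update a i (q * a i)) b q j t) ∧
  ∀ i j, sol a (Function.update b i (q * b i)) q j t -
      b i * sol a (Function.update b i (q * b i)) q j (q * t) = (1 - b i) * sol a b q j t

theorem NonResonant.eventually_goodAt {a : Fin (n + 1) → ℂ} {b : Fin n → ℂ} {q : ℂ}
    (h : NonResonant a b q) : ∀ᶠ t in gen, GoodAt q (point t a b) := by
  filter_upwards [h.sol_recurrence, eventually_all.2 h.sol_update_a,
    eventually_all.2 h.sol_update_b] with t h1 h2 h3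
  exact ⟨h, h1, h2, h3⟩

theorem EvalSystem.good_of_goodAt {E : EvalSystem n} (h : ∀ g, GoodAt E.q (E.x g)) : E.Good where
  nonResonant g := (h g).1
  recurrence g := (h g).2.1
  update_a g := (h g).2.2.1
  update_b g := (h g).2.2.2

/-- There are countably many shifts and each excludes countably many `t`, so one generic `t`
satisfies every equation along its whole orbit. -/
theorem exists_good_point (n : ℕ) : ∃ (q : ℂ) (x : Var n → ℂ) (hq : q ≠ 0) (hx : ∀ v, x v ≠ 0)
    (hg : IsGenericPoint q x), (evalSystem hq hx hg).Good ∧ (evalSystemInv hq hx hg).Good ∧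
    (∀ g, ∀ m ≤ n, ∑ j, sgn j * (evalSystemInv hq hx hg).sols j (g * (shiftB n)⁻¹) *
      (evalSystem hq hx hg).sols j (g * shiftOf (vT n) ^ (m + 1)) = 1) ∧
    (pairingValue (x (vT n)) (fun i => x (vA i)) (fun j => x (vB j)) q).det ≠ 0 := by
  obtain ⟨a, b, q, h, hgen⟩ := exists_generic_parameters n
  let p : (Var n → ℂ) → Prop := fun x => GoodAt q x ∧ GoodAt q⁻¹ x ∧ ∀ m ∈ Finset.range (n + 1),
    ∑ j, sgn j * sol (fun i => x (vA i)) (fun i => q⁻¹ * x (vB i)) q⁻¹ j (x (vT n)) *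
      sol (fun i => x (vA i)) (fun i => x (vB i)) q j (q ^ (m + 1) * x (vT n)) = 1
  have hp : ∀ a b, NonResonant a b q → ∀ᶠ t in gen, p (point t a b) := by
    intro a b h
    filter_upwards [h.eventually_goodAt, h.inv.eventually_goodAt,
      (Finset.eventually_all (Finset.range (n + 1))).2 fun m hm =>
        h.sol_pairing m (Finset.mem_range_succ_iff.1 hm)] with t h1 h2 h3
    exact ⟨h1, h2, h3⟩
  have hcount : {t | ¬ (IsGenericPoint q (point t a b) ∧
      ∀ g : Shift n, p (shiftPoint q g (point t a b)))}.Countable := by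
    have hS : Countable (Shift n) := inferInstanceAs (Countable (Var n → ℤ))
    refine (hgen.union (Set.countable_iUnion (h.countable_not_forall hp))).mono fun t ht => ?_
    by_cases hg : IsGenericPoint q (point t a b)
    · right
      by_contra hcon
      refine ht ⟨hg, fun g => ?_⟩
      by_contra hpg
      exact hcon (Set.mem_iUnion.2 ⟨g, hpg⟩)
    · exact Or.inl hg
  obtain ⟨t, ⟨hg, hpt⟩, ht, hdet⟩ := exists_of_countable_of_eventually_gen hcount
    (eventually_gen_ne_zero.and h.eventually_det_pairingValue_ne_zero)
  have hq := h.q_ne_zero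
  have hx := h.point_ne_zero ht
  refine ⟨q, point t a b, hq, hx, hg, EvalSystem.good_of_goodAt fun g => (hpt g).1,
    EvalSystem.good_of_goodAt fun g => (hpt g).2.1, fun g m hm => ?_, hdet⟩
  rw [← (hpt g).2.2 m (Finset.mem_range_succ_iff.2 hm)]
  refine Finset.sum_congr rfl fun j _ => ?_
  have e1 := (evalSystem hq hx hg).sols_mul_move_pow g j (m + 1)
  have e2 := (evalSystemInv hq hx hg).sols_mul_move g (shiftB n) j
  have e3 : ∀ v, (shiftB n).toAdd v = (Sum.elim 0 (Sum.elim 0 1) : Var n → ℤ) v := fun v => rfl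
  simp only [e3, Sum.elim_inl, Sum.elim_inr, Pi.zero_apply, Pi.one_apply, zpow_zero, one_mul,
    zpow_one] at e2
  refine congrArg₂ (fun u v => sgn j * u * v) e2 e1

variable {q : ℂ} {x : Var n → ℂ} {hq : q ≠ 0} {hx : ∀ v, x v ≠ 0} {hg : IsGenericPoint q x}

/-- The pairing of the solutions at `q⁻¹` with the solutions at `q`. -/
def pairFun (h : (evalSystem hq hx hg).Good) (h' : (evalSystemInv hq hx hg).Good)
    (m' m : heineModule n) (g : Shift n) : ℂ :=
  ∑ j, sgn j * h'.toSpace j m' g * h.toSpace j m g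

variable {h : (evalSystem hq hx hg).Good} {h' : (evalSystemInv hq hx hg).Good}

theorem pairFun_add_left (m₁ m₂ m : heineModule n) (g : Shift n) :
    pairFun h h' (m₁ + m₂) m g = pairFun h h' m₁ m g + pairFun h h' m₂ m g := by
  simp only [pairFun, ← Finset.sum_add_distrib]
  refine Finset.sum_congr rfl fun j _ => ?_
  rw [map_add, EvalSystem.add_apply]
  ring

theorem pairFun_add_right (m' m₁ m₂ : heineModule n) (g : Shift n) :
    pairFun h h' m' (m₁ + m₂) g = pairFun h h' m' m₁ g + pairFun h h' m' m₂ g := by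
  simp only [pairFun, ← Finset.sum_add_distrib]
  refine Finset.sum_congr rfl fun j _ => ?_
  rw [map_add, EvalSystem.add_apply]
  ring

theorem pairFun_scal_left (y : RatField n) (m' m : heineModule n) (g : Shift n) :
    pairFun h h' ((scal y : QWeyl n) • m') m g =
      evalField hq hx hg (g • qInv n y) * pairFun h h' m' m g := by
  simp only [pairFun, Finset.mul_sum]
  refine Finset.sum_congr rfl fun j _ => ?_
  rw [map_smul, EvalSystem.scal_smul_apply]
  change sgn j * (evalField hq hx hg (g • qInv n y) * _) * _ = _
  ring

theorem pairFun_scal_right (y : RatField n) (m' m : heineModule n) (g : Shift n) :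
    pairFun h h' m' ((scal y : QWeyl n) • m) g =
      evalField hq hx hg (g • y) * pairFun h h' m' m g := by
  simp only [pairFun, Finset.mul_sum]
  refine Finset.sum_congr rfl fun j _ => ?_
  rw [map_smul, EvalSystem.scal_smul_apply]
  change sgn j * _ * (evalField hq hx hg (g • y) * _) = _
  ring

/-- On functions attached to `q⁻¹` the shift `k` moves the index by `k⁻¹`, so both sides evaluate
the two factors at `g * k⁻¹` and at `g`. -/
theorem pairFun_oper_left (k : Shift n) (m' m : heineModule n) (g : Shift n) :
    pairFun h h' ((oper k : QWeyl n) • m') m g =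
      pairFun h h' m' ((oper k : QWeyl n) • m) (g * k⁻¹) := by
  refine Finset.sum_congr rfl fun j _ => ?_
  rw [map_smul, map_smul, EvalSystem.oper_smul_apply, EvalSystem.oper_smul_apply]
  change _ = _ * h.toSpace j m (g * k⁻¹ * k)
  rw [inv_mul_cancel_right]
  rfl

/-- A function on the group of shifts given by a rational function. -/
def IsRatFun (hq : q ≠ 0) (hx : ∀ v, x v ≠ 0) (hg : IsGenericPoint q x) (f : Shift n → ℂ) : Prop :=
  ∃ y : RatField n, ∀ g, f g = evalField hq hx hg (g • y)

theorem IsRatFun.zero : IsRatFun hq hx hg fun _ => 0 := ⟨0, fun g => by rw [smul_zero, map_zero]⟩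

theorem IsRatFun.add {f f' : Shift n → ℂ} (hf : IsRatFun hq hx hg f) (hf' : IsRatFun hq hx hg f') :
    IsRatFun hq hx hg fun g => f g + f' g := by
  obtain ⟨y, hy⟩ := hf
  obtain ⟨y', hy'⟩ := hf'
  exact ⟨y + y', fun g => by beta_reduce; rw [hy, hy', smul_add, map_add]⟩

theorem IsRatFun.mul {f : Shift n → ℂ} (hf : IsRatFun hq hx hg f) (z : RatField n) :
    IsRatFun hq hx hg fun g => evalField hq hx hg (g • z) * f g := by
  obtain ⟨y, hy⟩ := hf
  exact ⟨z * y, fun g => by beta_reduce; rw [hy, smul_mul', map_mul]⟩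

theorem IsRatFun.shift {f : Shift n → ℂ} (hf : IsRatFun hq hx hg f) (k : Shift n) :
    IsRatFun hq hx hg fun g => f (g * k) := by
  obtain ⟨y, hy⟩ := hf
  exact ⟨k • y, fun g => by beta_reduce; rw [hy, mul_smul]⟩

/-- Rationality starts from pairings equal to `1`, spreads over the second argument by spanning, and
over the first because a shift there can be traded for one in the second argument. -/
theorem isRatFun_pairFun
    (hpair : ∀ g, ∀ m ≤ n, ∑ j, sgn j * (evalSystemInv hq hx hg).sols j (g * (shiftB n)⁻¹) *
      (evalSystem hq hx hg).sols j (g * shiftOf (vT n) ^ (m + 1)) = 1) (m' m : heineModule n) :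
    IsRatFun hq hx hg (pairFun h h' m' m) := by
  -- In the system at `q⁻¹`, `shiftB` replaces `b` by `q⁻¹ b`. Hence `w` pairs to `1` with `σ_t,
  -- ..., σ_t^(n+1)` applied to the generator; the exponents begin at `1`, which is the offset
  -- passed to `eq_top_of_generator`.
  let w : heineModule n := (oper (shiftB n) : QWeyl n) • generator n
  have hw : ∀ m, IsRatFun hq hx hg (pairFun h h' w m) := by
    let N : AddSubgroup (heineModule n) :=
      { carrier := {m | IsRatFun hq hx hg (pairFun h h' w m)}
        zero_mem' := by
          have : pairFun h h' w 0 = fun _ => 0 := by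
            ext g
            simpa using pairFun_add_right (h := h) (h' := h') w 0 0 g
          rw [Set.mem_ofPred_eq, this]
          exact IsRatFun.zero
        add_mem' := fun {m₁ m₂} h₁ h₂ => by
          rw [Set.mem_ofPred_eq, funext (pairFun_add_right w m₁ m₂)]
          exact IsRatFun.add h₁ h₂
        neg_mem' := fun {m₁} h₁ => by
          have := IsRatFun.mul h₁ (-1)
          rwa [← funext (pairFun_scal_right (-1) w m₁), map_neg, map_one, neg_smul, one_smul] at this }
    have hN : N = ⊤ := by
      refine eq_top_of_generator N (fun y m hm => ?_) 1 fun k hk => ?_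
      · change IsRatFun hq hx hg (pairFun h h' w ((scal y : QWeyl n) • m))
        rw [funext (pairFun_scal_right y w m)]
        exact IsRatFun.mul hm y
      · refine ⟨1, fun g => ?_⟩
        rw [smul_one, map_one, ← hpair g k (Finset.mem_range_succ_iff.1 hk)]
        refine Finset.sum_congr rfl fun j _ => ?_
        rw [map_smul, map_smul, EvalSystem.oper_smul_apply, EvalSystem.oper_smul_apply,
          h.toSpace_generator, h'.toSpace_generator]
        rfl
    intro m
    have : m ∈ N := by rw [hN]; trivial
    exact this
  have hoper : ∀ k m', (∀ m, IsRatFun hq hx hg (pairFun h h' m' m)) →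
      ∀ m, IsRatFun hq hx hg (pairFun h h' ((oper k : QWeyl n) • m') m) := by
    intro k m' hm' m
    rw [funext (pairFun_oper_left k m' m)]
    exact (hm' _).shift k⁻¹
  have hgen : ∀ m, IsRatFun hq hx hg (pairFun h h' (generator n) m) := by
    have := hoper (shiftB n)⁻¹ w hw
    rwa [oper_smul_smul, inv_mul_cancel, map_one, one_smul] at this
  obtain ⟨P, rfl⟩ := eq_smul_generator m'
  induction P using SkewMonoidAlgebra.induction_on with
  | zero =>
    have : pairFun h h' ((0 : QWeyl n) • generator n) m = fun _ => 0 := by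
      ext g
      rw [zero_smul]
      simpa using pairFun_add_left (h := h) (h' := h') 0 0 m g
    rw [this]
    exact IsRatFun.zero
  | single k y =>
    rw [single_eq_scal_mul_oper, mul_smul, funext (pairFun_scal_left y _ m)]
    exact (hoper k _ hgen m).mul _
  | add P Q hP hQ =>
    rw [add_smul, funext (pairFun_add_left _ _ m)]
    exact hP.add hQ

/-- The rational functions `B m' m` are determined by their values at one generic point, so each
compatibility of the pairing is checked at the index `1`. -/
theorem vee_equiv_wedge (n : ℕ) :
    Nonempty (Vee n (heineModule n) ≃ₗ[QWeyl n] Wedge (heineModule n)) := by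
  obtain ⟨q, x, hq, hx, hg, h, h', hpair, hdet⟩ := exists_good_point n
  have hrat := isRatFun_pairFun (h := h) (h' := h') hpair
  choose B hB using hrat
  have huniq : ∀ {y z : RatField n}, evalField hq hx hg y = evalField hq hx hg z → y = z :=
    fun hyz => (evalField hq hx hg).injective hyz
  have hB1 : ∀ m' m, evalField hq hx hg (B m' m) = pairFun h h' m' m 1 := fun m' m => by
    rw [hB m' m 1, one_smul]
  refine nonempty_equiv_of_pairing B (fun m₁ m₂ m => huniq ?_) (fun m' m₁ m₂ => huniq ?_)
    (fun y m' m => huniq ?_) (fun y m' m => huniq ?_) (fun k m' m => huniq ?_) ?_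
  · rw [map_add, hB1, hB1, hB1, pairFun_add_left]
  · rw [map_add, hB1, hB1, hB1, pairFun_add_right]
  · rw [map_mul, hB1, hB1, pairFun_scal_left, one_smul]
  · rw [map_mul, hB1, hB1, pairFun_scal_right, one_smul]
  · rw [hB1, pairFun_oper_left, hB, one_mul]
  -- At the index `1` the Gram matrix evaluates to `pairingValue`, whose determinant is nonzero.
  · intro h0
    apply hdet
    have h1 := congrArg (evalField hq hx hg) h0
    rw [map_zero, RingHom.map_det] at h1
    rw [← h1]
    congr 1
    ext i k
    change _ = evalField hq hx hg (B _ _)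
    rw [hB1, pairingValue, Matrix.mul_apply]
    refine Finset.sum_congr rfl fun j _ => ?_
    rw [Matrix.mul_diagonal, Matrix.transpose_apply, map_smul, map_smul,
      EvalSystem.oper_smul_apply, EvalSystem.oper_smul_apply, h.toSpace_generator,
      h'.toSpace_generator, EvalSystem.sols_mul_move_pow, EvalSystem.sols_mul_move_pow,
      mul_comm (sgn j)]
    have hx1 : shiftPoint q (1 : Shift n) x = x := funext fun v => by simp [shiftPoint]
    change sol (fun i => x (vA i)) (fun j => x (vB j)) q⁻¹ j (q⁻¹ ^ i.val * x (vT n)) * sgn j *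
        sol (fun i => x (vA i)) (fun j => x (vB j)) q j (q ^ k.val * x (vT n)) =
      sol (fun i => shiftPoint q 1 x (vA i)) (fun j => shiftPoint q 1 x (vB j)) q⁻¹ j
          (q⁻¹ ^ i.val * shiftPoint q 1 x (vT n)) * sgn j *
        sol (fun i => shiftPoint q 1 x (vA i)) (fun j => shiftPoint q 1 x (vB j)) q j
          (q ^ k.val * shiftPoint q 1 x (vT n))
    rw [hx1]

end SelfDual

end Heine

end

theorem proposition3p1 (n : ℕ) :
    Nonempty (Heine.Vee n (Heine.heineModule n) ≃ₗ[Heine.QWeyl n]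
      Heine.Wedge (Heine.heineModule n)) ∧
    ∃ Q : Matrix.GeneralLinearGroup (Fin (n + 1)) (Heine.RatField n),
      (Q.1.map fun y => Heine.shiftOf (Heine.vT n) • y) *
          ((Heine.compA n).map fun y => Heine.shiftOf (Heine.vT n) • Heine.qInv n y)⁻¹ =
        ((Heine.compA n)⁻¹)ᵀ * Q.1 ∧
      ∀ (a : Fin (n + 1) → ℂ) (b : Fin n → ℂ) (q : ℂ), Heine.NonResonant a b q →
        (∀ j, Heine.IsPhi (Heine.upper a b q j) (Heine.lower b q j) q
          (Heine.phi (Heine.upper a b q j) (Heine.lower b q j) q)) ∧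
        ∀ᶠ t in codiscreteWithin ({0}ᶜ : Set ℂ),
          IsUnit (Heine.matU t a b q).det ∧
          ∃ Qt : Matrix (Fin (n + 1)) (Fin (n + 1)) ℂ,
            (∀ i j, Heine.HasValue q (Heine.point t a b) (Q.1 i j) (Qt i j)) ∧
            ((Heine.matU t a b q)⁻¹)ᵀ =
              Qt * Heine.matU t a b q⁻¹ *
                Matrix.diagonal (fun i : Fin (n + 1) => if i = 0 then (1 : ℂ) else -1) := by
  obtain ⟨Q, h1, h2⟩ := Heine.exists_connection_matrix n
  exact ⟨Heine.vee_equiv_wedge n, Q, h1, fun a b q h =>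
    ⟨fun j => (h.regular j).isPhi_phi, h2 a b q h⟩⟩
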